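/- Let $\mathbb{S}^1=\mathbb{R}/\mathbb{Z}$ and $\mathbb{T}^2=\mathbb{R}^2/\mathbb{Z}^2=\mathbb{S}^1\times\mathbb{S}^1$. A complete transversal of a $C^1$ (one-dimensional) foliation $\mathcal{F}$ of $\mathbb{T}^2$ is a $C^1$ simple closed curve $\gamma$ that is transverse to $\mathcal{F}$ and intersects every leaf of $\mathcal{F}$. Theorem. Let $\mathcal{F}$ and $\mathcal{G}$ be two transverse $C^1$ one-dimensional foliations on $\mathbb{T}^2$, and assume that they share the same complete transversal $\gamma$ (that is, $\gamma$ is a complete transversal of both $\mathcal{F}$ and $\mathcal{G}$). Then there exists a $C^1$ diffeomorphism $\theta\in\mathrm{Diff}^1(\mathbb{T}^2)$ such that (1) $\theta(\gamma)=\mathbb{S}^1\times\{0\}$; (2) for every $t\in\mathbb{S}^1$, both foliations $\theta(\mathcal{F})$ and $\theta(\mathcal{G})$ are transverse to the horizontal circle $\mathbb{S}^1\times\{t\}$. -/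

import Mathlib

open Set Topology

namespace TorusFoliation

/-- The torus `𝕋² = S¹ × S¹` with `S¹ = ℝ / ℤ`. -/
abbrev Torus : Type := UnitAddCircle × UnitAddCircle

/-- The universal covering map `ℝ² → 𝕋² = ℝ² / ℤ²`. It is a local `C^∞` diffeomorphism for the
standard smooth structure of the torus, and its differential identifies the tangent space of `𝕋²`
at `proj x` with `ℝ²`. -/
def proj (x : ℝ × ℝ) : Torus := ((x.1 : UnitAddCircle), (x.2 : UnitAddCircle))

/-- A self-map of the torus is of class `C¹` when it lifts to a `C¹` map of the plane. -/
def IsC1Map (f : Torus → Torus) : Prop :=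
  ∃ L : ℝ × ℝ → ℝ × ℝ, ContDiff ℝ 1 L ∧ ∀ x, proj (L x) = f (proj x)

/-- The group `Diff¹(𝕋²)`: homeomorphisms of the torus that are `C¹` with `C¹` inverse. -/
structure Diff1 where
  toHomeomorph : Torus ≃ₜ Torus
  isC1 : IsC1Map toHomeomorph
  isC1_symm : IsC1Map toHomeomorph.symm

/-- A `C¹` chart of the torus onto the plane: a `C¹` diffeomorphism (`C¹` with `C¹` inverse) from
an open subset of `𝕋²` onto `ℝ²`. -/
structure IsC1Chart (φ : OpenPartialHomeomorph Torus (ℝ × ℝ)) : Prop where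
  target_eq : φ.target = univ
  contDiffOn : ContDiffOn ℝ 1 (fun x => φ (proj x)) (proj ⁻¹' φ.source)
  symm_lift : ∃ L : ℝ × ℝ → ℝ × ℝ, ContDiff ℝ 1 L ∧ ∀ y, proj (L y) = φ.symm y

/-- A (one-dimensional) `C¹` foliation of the torus, given by a foliated `C¹` atlas: the plaques of
a foliated chart `φ` are the level sets of its second coordinate, and the changes of charts are
locally of the form `(u, v) ↦ (h (u, v), g v)`. The charts are onto `ℝ²`, so plaques are
connected. -/
structure Foliation where
  atlas : Set (OpenPartialHomeomorph Torus (ℝ × ℝ))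
  isC1Chart : ∀ φ ∈ atlas, IsC1Chart φ
  cover : ∀ p : Torus, ∃ φ ∈ atlas, p ∈ φ.source
  compatible : ∀ φ ∈ atlas, ∀ ψ ∈ atlas, ∀ p ∈ φ.source ∩ ψ.source,
    ∃ g : ℝ → ℝ, ∀ᶠ q in 𝓝 p, (ψ q).2 = g ((φ q).2)

namespace Foliation

/-- Two points lie on a common plaque of some foliated chart. -/
def SamePlaque (F : Foliation) (p q : Torus) : Prop :=
  ∃ φ ∈ F.atlas, p ∈ φ.source ∧ q ∈ φ.source ∧ (φ p).2 = (φ q).2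

/-- The leaf through `p`: all points joined to `p` by a finite chain of plaques. -/
def leaf (F : Foliation) (p : Torus) : Set Torus :=
  {q | Relation.EqvGen F.SamePlaque p q}

/-- The tangent line of the foliation at the point `proj x`, as a subspace of
`ℝ² = T_{proj x} 𝕋²`: the kernel of the differential of the second coordinate of a foliated chart
around that point (all such charts have the same kernel, hence the intersection). -/
noncomputable def tangentLine (F : Foliation) (x : ℝ × ℝ) : Submodule ℝ (ℝ × ℝ) :=
  ⨅ (φ : OpenPartialHomeomorph Torus (ℝ × ℝ)) (_ : φ ∈ F.atlas) (_ : proj x ∈ φ.source),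
    LinearMap.ker (fderiv ℝ (fun z => (φ (proj z)).2) x : (ℝ × ℝ) →ₗ[ℝ] ℝ)

/-- Two foliations are transverse when their tangent lines are complementary at every point. -/
def Transverse (F G : Foliation) : Prop :=
  ∀ x, IsCompl (F.tangentLine x) (G.tangentLine x)

/-- The closed curve `γ` is of class `C¹` and transverse to `F`: its velocity is nowhere
tangent to `F` (in particular it never vanishes). Lifts of `γ` to the plane differ by an
integer translation, so the choice of the lift does not matter. -/
def TransverseToCurve (F : Foliation) (γ : UnitAddCircle → Torus) : Prop :=
  ∃ c : ℝ → ℝ × ℝ, ContDiff ℝ 1 c ∧ (∀ s : ℝ, proj (c s) = γ (s : UnitAddCircle)) ∧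
    ∀ s, deriv c s ∉ F.tangentLine (c s)

/-- `γ` is a complete transversal of `F`: a `C¹` simple closed curve transverse to `F` that
intersects every leaf of `F`. -/
structure IsCompleteTransversal (F : Foliation) (γ : UnitAddCircle → Torus) : Prop where
  simple : Function.Injective γ
  transverse : F.TransverseToCurve γ
  meets_leaf : ∀ p, (F.leaf p ∩ range γ).Nonempty

/-- The image foliation `θ(F)`: its foliated charts are the `φ ∘ θ⁻¹`, for the foliated charts `φ`
of `F`. -/
def map (F : Foliation) (θ : Diff1) : Foliation where
  atlas := {ψ | ∃ φ ∈ F.atlas, ψ = θ.toHomeomorph.symm.transOpenPartialHomeomorph φ}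
  isC1Chart := by
    rintro _ ⟨φ, hφ, rfl⟩
    obtain ⟨h1, h2, L, hL, hLφ⟩ := F.isC1Chart φ hφ
    refine ⟨by simpa using h1, ?_, ?_⟩
    · obtain ⟨K, hK, hKθ⟩ := θ.isC1_symm
      have h : ContDiffOn ℝ 1 (fun x => φ (proj (K x)))
          (proj ⁻¹' (θ.toHomeomorph.symm.transOpenPartialHomeomorph φ).source) := by
        refine h2.comp hK.contDiffOn ?_
        intro x hx
        simpa [hKθ] using hx
      simpa [hKθ] using h
    · obtain ⟨K, hK, hKθ⟩ := θ.isC1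
      exact ⟨K ∘ L, hK.comp hL, fun y => by simp [hKθ, hLφ]⟩
  cover := by
    intro p
    obtain ⟨φ, hφ, hp⟩ := F.cover (θ.toHomeomorph.symm p)
    exact ⟨_, ⟨φ, hφ, rfl⟩, by simpa using hp⟩
  compatible := by
    rintro _ ⟨φ, hφ, rfl⟩ _ ⟨ψ, hψ, rfl⟩ p ⟨hp, hp'⟩
    obtain ⟨g, hg⟩ := F.compatible φ hφ ψ hψ (θ.toHomeomorph.symm p)
      ⟨by simpa using hp, by simpa using hp'⟩
    exact ⟨g, by simpa using (θ.toHomeomorph.symm.continuous.tendsto p).eventually hg⟩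

end Foliation

end TorusFoliation

/-!
Everything is lifted to the plane. The tangent lines of a foliation are spanned there by a
continuous unit field `X` (`Foliation.exists_tangentField`); it is only continuous, but the
foliated charts make it uniquely integrable, and its flow `Φ` has the lifted leaves as orbits
(`LineField.exists_flow`). A lift `c` of the complete transversal, with `c (s + 1) = c s + v`, is a
global section: every orbit crosses a lattice translate of `c`. The orbits starting on `c` return
first to one fixed translate `c + D`, crossing it in the same direction
(`GlobalSection.exists_firstHit_const`, `GlobalSection.firstHit_sign`). Hence `D` and `v` generate
the lattice, every orbit meets `c` exactly once, and the parameter of that point defines a `C¹`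
function `u` on the plane whose differential is a positive multiple of `cross X`; this is the leaf
coordinate (`GlobalSection.exists_leafCoordinate`).

Let `u` and `w` be the leaf coordinates of the two foliations, for the same lift `c`. Since `u` is
constant on the leaves of the first foliation and `w` on those of the second, transversality
implies that `τ = ± (u - w)`, with a suitable sign, increases along *both* families of leaves, and
it vanishes on `c`. The zero sets of the translates of `τ` by multiples of `D` cut the plane into
strips, and a sum of smooth steps across the strips, each a function of two consecutive translates
of `τ`, gives a height function `t` that increases along both families of leaves and satisfies
`t (x + v) = t x` and `t (x + D) = t x + 1` (`StripFunction.exists_height`).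

Interpolating between the translates of `u` by multiples of `D`, with weights depending on `t`
only, gives an angular function `a` with `a (x + v) = a x + 1` and `a (x + D) = a x` that is
increasing in `u` on each level of `t`. So `(a, t)` is a `C¹` diffeomorphism of the plane
conjugating the translations by `v` and `D` to those by the standard basis
(`LeafCoordinate.exists_straightening`). It descends to the required diffeomorphism of the torus:
`t` vanishes exactly on `c`, and neither foliation is tangent to a level of `t`, because `t`
increases along the leaves.
-/

open Set Topology

namespace TorusFoliation

/-! ### Lattice translations, lifted charts and the tangent field of a foliation -/

/-- The determinant of two vectors of the plane. -/
def cross (a b : ℝ × ℝ) : ℝ := a.1 * b.2 - a.2 * b.1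

lemma continuous_cross {α : Type*} [TopologicalSpace α] {f g : α → ℝ × ℝ} (hf : Continuous f)
    (hg : Continuous g) : Continuous fun x => cross (f x) (g x) := by
  unfold cross; fun_prop

lemma cross_self (a : ℝ × ℝ) : cross a a = 0 := by simp [cross, mul_comm]

lemma cross_comm (a b : ℝ × ℝ) : cross a b = -cross b a := by simp [cross]; ring

lemma cross_smul_left (k : ℝ) (a b : ℝ × ℝ) : cross (k • a) b = k * cross a b := by
  simp [cross]; ring

/-- A vector with vanishing determinant against a unit vector is a multiple of it. -/
lemma exists_smul_of_cross_eq_zero {a w : ℝ × ℝ} (ha : a.1 ^ 2 + a.2 ^ 2 = 1)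
    (h : cross a w = 0) : ∃ k : ℝ, w = k • a := by
  refine ⟨a.1 * w.1 + a.2 * w.2, ?_⟩
  unfold cross at h
  ext
  · simp only [Prod.smul_fst, smul_eq_mul]; linear_combination (-w.1) * ha - a.2 * h
  · simp only [Prod.smul_snd, smul_eq_mul]; linear_combination (-w.2) * ha + a.1 * h

/-- The lattice `ℤ²` of deck transformations of `proj`, as a subgroup of the plane. -/
def latt : ℤ × ℤ →+ ℝ × ℝ := (Int.castAddHom ℝ).prodMap (Int.castAddHom ℝ)

@[simp] lemma latt_fst (n : ℤ × ℤ) : (latt n).1 = n.1 := rfl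
@[simp] lemma latt_snd (n : ℤ × ℤ) : (latt n).2 = n.2 := rfl

lemma latt_injective : Function.Injective latt := by
  intro a b h
  have h1 := congrArg Prod.fst h
  have h2 := congrArg Prod.snd h
  simp only [latt_fst, latt_snd, Int.cast_inj] at h1 h2
  exact Prod.ext h1 h2

lemma latt_eq_zero_of_norm_lt {n : ℤ × ℤ} (h : ‖latt n‖ < 1) : n = 0 := by
  rw [Prod.norm_def, max_lt_iff] at h
  obtain ⟨h1, h2⟩ := h
  rw [latt_fst, Real.norm_eq_abs, ← Int.cast_abs] at h1
  rw [latt_snd, Real.norm_eq_abs, ← Int.cast_abs] at h2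
  have h1' : |n.1| < 1 := by exact_mod_cast h1
  have h2' : |n.2| < 1 := by exact_mod_cast h2
  exact Prod.ext (Int.abs_lt_one_iff.1 h1') (Int.abs_lt_one_iff.1 h2')

lemma coe_eq_coe_iff_exists_int {a b : ℝ} : (a : UnitAddCircle) = b ↔ ∃ n : ℤ, a = b + n := by
  rw [QuotientAddGroup.eq, AddSubgroup.mem_zmultiples_iff]
  constructor
  · rintro ⟨n, hn⟩
    refine ⟨-n, ?_⟩
    rw [zsmul_one] at hn
    push_cast; linarith
  · rintro ⟨n, hn⟩
    refine ⟨-n, ?_⟩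
    rw [zsmul_one]
    push_cast; linarith

lemma proj_eq_proj_iff {x y : ℝ × ℝ} : proj x = proj y ↔ ∃ n, x = y + latt n := by
  rw [proj, proj, Prod.mk.injEq, coe_eq_coe_iff_exists_int, coe_eq_coe_iff_exists_int]
  constructor
  · rintro ⟨⟨a, ha⟩, b, hb⟩
    exact ⟨(a, b), Prod.ext ha hb⟩
  · rintro ⟨n, rfl⟩
    exact ⟨⟨n.1, rfl⟩, n.2, rfl⟩

lemma proj_add_latt (x : ℝ × ℝ) (n : ℤ × ℤ) : proj (x + latt n) = proj x :=
  proj_eq_proj_iff.2 ⟨n, rfl⟩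

lemma continuous_proj : Continuous proj := by
  unfold proj
  exact ((AddCircle.continuous_mk' 1).comp continuous_fst).prodMk
    ((AddCircle.continuous_mk' 1).comp continuous_snd)

lemma isOpenQuotientMap_proj : IsOpenQuotientMap proj :=
  (QuotientAddGroup.isOpenQuotientMap_mk (N := AddSubgroup.zmultiples (1 : ℝ))).prodMap
    QuotientAddGroup.isOpenQuotientMap_mk

lemma proj_surjective : Function.Surjective proj := isOpenQuotientMap_proj.surjective

/-- Every point of the plane is a lattice translate of a point of the unit square. -/
lemma exists_mem_square (x : ℝ × ℝ) : ∃ n, x + latt n ∈ Icc (0 : ℝ × ℝ) 1 := by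
  refine ⟨(-⌊x.1⌋, -⌊x.2⌋), ?_, ?_⟩
  · constructor
    · simpa using! Int.floor_le x.1
    · simpa using! Int.floor_le x.2
  · constructor
    · have := (Int.lt_floor_add_one x.1).le
      simp; linarith
    · have := (Int.lt_floor_add_one x.2).le
      simp; linarith

/-- A continuous function with values in the lattice is locally constant. -/
lemma eventually_eq_of_latt {α : Type*} [TopologicalSpace α] {f : α → ℝ × ℝ} {a : α}
    (hf : ContinuousAt f a) (hl : ∀ᶠ x in 𝓝 a, ∃ n, f x = latt n) : ∀ᶠ x in 𝓝 a, f x = f a := by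
  obtain ⟨m, hm⟩ := hl.self_of_nhds
  have h := Metric.continuousAt_iff'.1 hf 1 one_pos
  filter_upwards [h, hl] with x hx hn
  obtain ⟨n, hn⟩ := hn
  rw [dist_eq_norm, hn, hm, ← map_sub] at hx
  have := latt_eq_zero_of_norm_lt hx
  rw [hn, hm, sub_eq_zero.1 this]

/-- A foliated chart, lifted to the plane: `ψ` is a `C¹` diffeomorphism from the open set `V`
onto the plane, with inverse `L`. -/
structure PlaneChart (V : Set (ℝ × ℝ)) (ψ L : ℝ × ℝ → ℝ × ℝ) : Prop where
  isOpen : IsOpen V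
  contDiffOn : ContDiffOn ℝ 1 ψ V
  contDiff : ContDiff ℝ 1 L
  mapsTo : ∀ y, L y ∈ V
  left : ∀ y, ψ (L y) = y
  right : ∀ x ∈ V, L (ψ x) = x

namespace PlaneChart
variable {V : Set (ℝ × ℝ)} {ψ L : ℝ × ℝ → ℝ × ℝ}

lemma hasFDerivAt (h : PlaneChart V ψ L) {x : ℝ × ℝ} (hx : x ∈ V) :
    HasFDerivAt ψ (fderiv ℝ ψ x) x :=
  ((h.contDiffOn.contDiffAt (h.isOpen.mem_nhds hx)).differentiableAt (by norm_num)).hasFDerivAt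

lemma fderiv_symm_apply (h : PlaneChart V ψ L) (y w : ℝ × ℝ) :
    fderiv ℝ ψ (L y) (fderiv ℝ L y w) = w := by
  have h1 := (h.hasFDerivAt (h.mapsTo y)).comp y
    ((h.contDiff.differentiable (by norm_num)) y).hasFDerivAt
  have h2 : ψ ∘ L = id := funext h.left
  rw [h2] at h1
  have := h1.unique (hasFDerivAt_id y)
  simpa using! congrArg (fun A => A w) this

lemma fderiv_apply_symm (h : PlaneChart V ψ L) {x : ℝ × ℝ} (hx : x ∈ V) (w : ℝ × ℝ) :
    fderiv ℝ L (ψ x) (fderiv ℝ ψ x w) = w := by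
  have h0 := ((h.contDiff.differentiable (by norm_num)) (ψ x)).hasFDerivAt
  have h1 := h0.comp x (h.hasFDerivAt hx)
  have h2 : L ∘ ψ =ᶠ[𝓝 x] id := by
    filter_upwards [h.isOpen.mem_nhds hx] with z hz using h.right z hz
  have := (h1.congr_of_eventuallyEq h2.symm).unique (hasFDerivAt_id x)
  simpa using! congrArg (fun A => A w) this

lemma hasFDerivAt_snd (h : PlaneChart V ψ L) {x : ℝ × ℝ} (hx : x ∈ V) :
    HasFDerivAt (fun z => (ψ z).2)
      ((ContinuousLinearMap.snd ℝ ℝ ℝ).comp (fderiv ℝ ψ x)) x :=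
  (ContinuousLinearMap.snd ℝ ℝ ℝ).hasFDerivAt.comp x (h.hasFDerivAt hx)

lemma fderiv_snd_apply (h : PlaneChart V ψ L) {x : ℝ × ℝ} (hx : x ∈ V) (w : ℝ × ℝ) :
    fderiv ℝ (fun z => (ψ z).2) x w = (fderiv ℝ ψ x w).2 := by
  rw [(h.hasFDerivAt_snd hx).fderiv]; rfl

lemma contDiffOn_snd (h : PlaneChart V ψ L) : ContDiffOn ℝ 1 (fun z => (ψ z).2) V :=
  contDiff_snd.comp_contDiffOn h.contDiffOn

end PlaneChart

/-- Every foliated chart of the torus lifts to a chart of the plane around each point over its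
domain. -/
lemma IsC1Chart.exists_planeChart {φ : OpenPartialHomeomorph Torus (ℝ × ℝ)} (hφ : IsC1Chart φ)
    {x₀ : ℝ × ℝ} (hx₀ : proj x₀ ∈ φ.source) :
    ∃ V L, x₀ ∈ V ∧ V ⊆ proj ⁻¹' φ.source ∧ PlaneChart V (fun x => φ (proj x)) L ∧
      ∀ y, proj (L y) = φ.symm y := by
  obtain ⟨L₀, hL₀, hL₀φ⟩ := hφ.symm_lift
  have hopen : IsOpen (proj ⁻¹' φ.source) := φ.open_source.preimage continuous_proj
  have hsrc : ∀ y, φ.symm y ∈ φ.source := fun y => φ.map_target (by simp [hφ.target_eq])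
  obtain ⟨n, hn⟩ : ∃ n, x₀ = L₀ (φ (proj x₀)) + latt n := by
    rw [← proj_eq_proj_iff, hL₀φ, φ.left_inv hx₀]
  let L : ℝ × ℝ → ℝ × ℝ := fun y => L₀ y + latt n
  have hL : ContDiff ℝ 1 L := hL₀.add contDiff_const
  have hLφ : ∀ y, proj (L y) = φ.symm y := fun y => by rw [proj_add_latt, hL₀φ]
  have hcont : ContinuousOn (fun x => φ (proj x)) (proj ⁻¹' φ.source) := hφ.contDiffOn.continuousOn
  have hleft : ∀ y, φ (proj (L y)) = y := fun y => by
    rw [hLφ, φ.right_inv (by simp [hφ.target_eq])]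
  -- the sheet over the domain of `φ` that is the image of `L`
  let V : Set (ℝ × ℝ) := {x | proj x ∈ φ.source ∧ L (φ (proj x)) = x}
  have hVopen : IsOpen V := by
    rw [isOpen_iff_mem_nhds]
    rintro x ⟨hx, hxL⟩
    have hc : ContinuousAt (fun z => L (φ (proj z)) - z) x :=
      (hL.continuous.continuousAt.comp (hcont.continuousAt (hopen.mem_nhds hx))).sub
        continuousAt_id
    have := eventually_eq_of_latt hc (by
      filter_upwards [hopen.mem_nhds hx] with z hz
      obtain ⟨k, hk⟩ : ∃ k, L (φ (proj z)) = z + latt k := by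
        rw [← proj_eq_proj_iff, hLφ, φ.left_inv hz]
      exact ⟨k, by rw [hk]; abel⟩)
    filter_upwards [this, hopen.mem_nhds hx] with z hz hz'
    refine ⟨hz', ?_⟩
    rw [hxL, sub_self, sub_eq_zero] at hz
    exact hz
  refine ⟨V, L, ⟨hx₀, hn.symm⟩, fun x hx => hx.1, ⟨hVopen, hφ.contDiffOn.mono fun x hx => hx.1,
    hL, fun y => ⟨?_, ?_⟩, hleft, fun x hx => hx.2⟩, hLφ⟩
  · show proj (L y) ∈ φ.source
    rw [hLφ]; exact hsrc y
  · show L (φ (proj (L y))) = _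
    rw [hleft]

namespace Foliation

/-- The second coordinate of a foliated chart is a submersion. -/
lemma fderiv_snd_ne_zero (F : Foliation) {φ : OpenPartialHomeomorph Torus (ℝ × ℝ)}
    (hφ : φ ∈ F.atlas) {x : ℝ × ℝ} (hx : proj x ∈ φ.source) :
    fderiv ℝ (fun z => (φ (proj z)).2) x ≠ 0 := by
  obtain ⟨V, L, hxV, -, h, -⟩ := (F.isC1Chart φ hφ).exists_planeChart hx
  intro h0
  have h1 := h.fderiv_snd_apply hxV (fderiv ℝ L (φ (proj x)) (0, 1))
  have h2 := h.fderiv_symm_apply (φ (proj x)) (0, 1)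
  rw [h.right x hxV] at h2
  rw [h2, h0] at h1
  simp at h1

lemma contDiffOn_snd (F : Foliation) {φ : OpenPartialHomeomorph Torus (ℝ × ℝ)}
    (hφ : φ ∈ F.atlas) : ContDiffOn ℝ 1 (fun z => (φ (proj z)).2) (proj ⁻¹' φ.source) :=
  contDiff_snd.comp_contDiffOn (F.isC1Chart φ hφ).contDiffOn

/-- In the plane, two nonzero linear forms with a common nonzero zero are proportional. -/
lemma _root_.TorusFoliation.exists_smul_of_common_zero {f g : ℝ × ℝ →L[ℝ] ℝ} (hf : f ≠ 0)
    (hg : g ≠ 0) {w : ℝ × ℝ} (hw : w ≠ 0) (hfw : f w = 0) (hgw : g w = 0) :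
    ∃ k : ℝ, k ≠ 0 ∧ g = k • f := by
  have key : ∀ f : ℝ × ℝ →L[ℝ] ℝ, ∀ v, f v = v.1 * f (1, 0) + v.2 * f (0, 1) := fun f v => by
    have : v = v.1 • ((1, 0) : ℝ × ℝ) + v.2 • ((0, 1) : ℝ × ℝ) := by ext <;> simp
    conv_lhs => rw [this]
    rw [map_add, map_smul, map_smul, smul_eq_mul, smul_eq_mul]
  have key0 : ∀ f : ℝ × ℝ →L[ℝ] ℝ, f (1, 0) = 0 → f (0, 1) = 0 → f = 0 := fun f h1 h2 => by
    ext <;> simp [h1, h2]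
  have hform : ∀ f : ℝ × ℝ →L[ℝ] ℝ, f ≠ 0 → f w = 0 →
      ∃ k : ℝ, k ≠ 0 ∧ ∀ v, f v = k * cross w v := by
    intro f hf hfw
    rw [key] at hfw
    by_cases h1 : w.1 = 0
    · have h2 : w.2 ≠ 0 := fun h2 => hw (Prod.ext h1 h2)
      have h3 : f (0, 1) = 0 := by simpa [h1, h2] using hfw
      refine ⟨-f (1, 0) / w.2, ?_, fun v => ?_⟩
      · refine div_ne_zero (neg_ne_zero.2 fun h4 => hf (key0 f h4 h3)) h2
      · rw [key f v, h3]; unfold cross; rw [h1]; field_simp; ring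
    · have h3 : f (1, 0) = -(w.2 * f (0, 1)) / w.1 := by field_simp; linarith
      refine ⟨f (0, 1) / w.1, ?_, fun v => ?_⟩
      · refine div_ne_zero (fun h4 => hf (key0 f ?_ h4)) h1
        rw [h3, h4]; simp
      · rw [key f v, h3]; unfold cross; field_simp; ring
  obtain ⟨a, ha, hfa⟩ := hform f hf hfw
  obtain ⟨b, hb, hgb⟩ := hform g hg hgw
  refine ⟨b / a, div_ne_zero hb ha, ?_⟩
  refine ContinuousLinearMap.ext fun v => ?_
  rw [hgb, smul_apply, hfa, smul_eq_mul]
  field_simp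

/-- The differentials of two local first integrals are proportional. -/
lemma fderiv_snd_proportional (F : Foliation) {φ ψ : OpenPartialHomeomorph Torus (ℝ × ℝ)}
    (hφ : φ ∈ F.atlas) (hψ : ψ ∈ F.atlas) {x : ℝ × ℝ} (hx : proj x ∈ φ.source)
    (hx' : proj x ∈ ψ.source) :
    ∃ k : ℝ, k ≠ 0 ∧
      fderiv ℝ (fun z => (ψ (proj z)).2) x = k • fderiv ℝ (fun z => (φ (proj z)).2) x := by
  obtain ⟨V, L, hxV, hVs, h, -⟩ := (F.isC1Chart φ hφ).exists_planeChart hx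
  set y := φ (proj x) with hy
  have hLy : L y = x := h.right x hxV
  -- the velocity of the plaque of `φ` through `x` is a common zero
  refine exists_smul_of_common_zero (F.fderiv_snd_ne_zero hφ hx) (F.fderiv_snd_ne_zero hψ hx')
    (w := fderiv ℝ L y (1, 0)) ?_ ?_ ?_
  · intro h0
    have h2 := h.fderiv_symm_apply y (1, 0)
    rw [h0, map_zero] at h2
    simpa using congrArg Prod.fst h2
  · have h1 := h.fderiv_snd_apply (x := x) hxV (fderiv ℝ L y (1, 0))
    have h2 := h.fderiv_symm_apply y (1, 0)
    rw [hLy] at h2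
    rw [h1, h2]
  · obtain ⟨g, hg⟩ := F.compatible φ hφ ψ hψ (proj x) ⟨hx, hx'⟩
    have hw : HasFDerivAt (fun z => (ψ (proj z)).2)
        (fderiv ℝ (fun z => (ψ (proj z)).2) x) (L y) := by
      rw [hLy]
      exact (((F.contDiffOn_snd hψ).contDiffAt
        ((ψ.open_source.preimage continuous_proj).mem_nhds hx')).differentiableAt
          (by norm_num)).hasFDerivAt
    have hline : HasDerivAt (fun t : ℝ => y + t • ((1, 0) : ℝ × ℝ)) (1, 0) 0 := by
      simpa using ((hasDerivAt_id (0 : ℝ)).smul_const ((1, 0) : ℝ × ℝ)).const_add y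
    have hL := ((h.contDiff.differentiable (by norm_num)) y).hasFDerivAt
    have hL' : HasDerivAt (fun t : ℝ => L (y + t • ((1, 0) : ℝ × ℝ))) (fderiv ℝ L y (1, 0)) 0 :=
      HasFDerivAt.comp_hasDerivAt (f := fun t : ℝ => y + t • ((1, 0) : ℝ × ℝ)) 0
        (by simpa using hL) hline
    have hcomp : HasDerivAt (fun t : ℝ => (ψ (proj (L (y + t • ((1, 0) : ℝ × ℝ))))).2)
        (fderiv ℝ (fun z => (ψ (proj z)).2) x (fderiv ℝ L y (1, 0))) 0 :=
      HasFDerivAt.comp_hasDerivAt (f := fun t : ℝ => L (y + t • ((1, 0) : ℝ × ℝ)))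
        (l := fun z => (ψ (proj z)).2) 0 (by simpa using hw) hL'
    refine hcomp.unique ((hasDerivAt_const (0 : ℝ) (g y.2)).congr_of_eventuallyEq ?_)
    have hc : Filter.Tendsto (fun t : ℝ => proj (L (y + t • ((1, 0) : ℝ × ℝ)))) (𝓝 0)
        (𝓝 (proj x)) := by
      have : ContinuousAt (fun t : ℝ => proj (L (y + t • ((1, 0) : ℝ × ℝ)))) 0 :=
        continuous_proj.continuousAt.comp hL'.continuousAt
      have h0 : proj (L (y + (0 : ℝ) • ((1, 0) : ℝ × ℝ))) = proj x := by simp [hLy]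
      simpa [ContinuousAt, hLy] using this
    filter_upwards [hc.eventually hg] with t ht
    rw [ht, h.left]
    simp

/-- The continuous unit vector field `X` on the plane is tangent to the lift of the foliation. -/
structure TangentField (F : Foliation) (X : ℝ × ℝ → ℝ × ℝ) : Prop where
  continuous : Continuous X
  unit : ∀ x, (X x).1 ^ 2 + (X x).2 ^ 2 = 1
  conormal : ∀ φ ∈ F.atlas, ∀ x, proj x ∈ φ.source →
    ∃ k : ℝ, k ≠ 0 ∧ ∀ w, fderiv ℝ (fun z => (φ (proj z)).2) x w = k * cross (X x) w

/-- The tangent line field of a foliation, lifted to the plane, is spanned by a continuous unit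
vector field: the plane is simply connected, so a square root of the square of the conormal
direction exists. -/
lemma exists_tangentField (F : Foliation) : ∃ X, F.TangentField X := by
  choose ch hch hmem using fun x => F.cover (proj x)
  -- the gradient of the second coordinate of a chart, turned by a right angle, as a complex number
  let z : OpenPartialHomeomorph Torus (ℝ × ℝ) → ℝ × ℝ → ℂ := fun φ x =>
    ⟨fderiv ℝ (fun z => (φ (proj z)).2) x (0, 1), -fderiv ℝ (fun z => (φ (proj z)).2) x (1, 0)⟩
  have hz0 : ∀ φ ∈ F.atlas, ∀ x, proj x ∈ φ.source → z φ x ≠ 0 := by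
    intro φ hφ x hx h0
    apply F.fderiv_snd_ne_zero hφ hx
    have h1 := congrArg Complex.re h0
    have h2 := congrArg Complex.im h0
    simp only [z, Complex.zero_re, Complex.zero_im, neg_eq_zero] at h1 h2
    ext <;> simp [h1, h2]
  -- changes of charts multiply `z` by a nonzero real number, so `q` does not depend on the chart
  let q : OpenPartialHomeomorph Torus (ℝ × ℝ) → ℝ × ℝ → ℂ := fun φ x =>
    (z φ x / (‖z φ x‖ : ℂ)) ^ 2
  have hqq : ∀ φ ∈ F.atlas, ∀ ψ ∈ F.atlas, ∀ x, proj x ∈ φ.source → proj x ∈ ψ.source →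
      q ψ x = q φ x := by
    intro φ hφ ψ hψ x hx hx'
    obtain ⟨k, hk, hkf⟩ := F.fderiv_snd_proportional hφ hψ hx hx'
    have hzz : z ψ x = (k : ℂ) * z φ x := by
      apply Complex.ext <;> simp [z, hkf]
    simp only [q, hzz, norm_mul, Complex.norm_real, Real.norm_eq_abs]
    have hk2 : ((|k| : ℝ) : ℂ) ^ 2 = (k : ℂ) ^ 2 := by
      rw [← Complex.ofReal_pow, sq_abs, Complex.ofReal_pow]
    have hn : ((‖z φ x‖ : ℝ) : ℂ) ≠ 0 := by simpa using hz0 φ hφ x hx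
    have hk' : (k : ℂ) ≠ 0 := by simpa using hk
    push_cast
    rw [div_pow, div_pow, mul_pow, mul_pow, hk2]
    field_simp
  have hqc : Continuous fun x => q (ch x) x := by
    rw [continuous_iff_continuousAt]
    intro x
    have hop : proj ⁻¹' (ch x).source ∈ 𝓝 x :=
      ((ch x).open_source.preimage continuous_proj).mem_nhds (hmem x)
    have hev : (fun y => q (ch y) y) =ᶠ[𝓝 x] q (ch x) := by
      filter_upwards [hop] with y hy
      exact hqq _ (hch x) _ (hch y) y hy (hmem y)
    refine ContinuousAt.congr ?_ hev.symm
    have hfd : ContinuousAt (fderiv ℝ (fun z => ((ch x) (proj z)).2)) x :=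
      ((F.contDiffOn_snd (hch x)).contDiffAt hop).continuousAt_fderiv (by norm_num)
    have hzc : ContinuousAt (z (ch x)) x := by
      have h1 := hfd.clm_apply (continuousAt_const (y := ((0, 1) : ℝ × ℝ)))
      have h2 := hfd.clm_apply (continuousAt_const (y := ((1, 0) : ℝ × ℝ)))
      have := (Complex.equivRealProdCLM.symm.continuous.continuousAt).comp (h1.prodMk h2.neg)
      refine this.congr (Filter.Eventually.of_forall fun y => ?_)
      apply Complex.ext <;> simp [z]
    refine ContinuousAt.pow (hzc.div (Complex.continuous_ofReal.continuousAt.comp hzc.norm) ?_) 2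
    simpa using hz0 _ (hch x) x (hmem x)
  have hq1 : ∀ x, ‖q (ch x) x‖ = 1 := by
    intro x
    have : ‖z (ch x) x‖ ≠ 0 := by simpa using hz0 _ (hch x) x (hmem x)
    simp only [q, norm_pow, norm_div, Complex.norm_real, norm_norm]
    rw [div_self this, one_pow]
  -- `q` lifts through the squaring map of the punctured plane
  have hcov : IsCoveringMapOn (fun x : ℂ => x ^ 2) {0}ᶜ := isCoveringMapOn_npow 2 (by norm_num)
  obtain ⟨r, hr⟩ : ∃ r : ℂ, r ^ 2 = q (ch 0) 0 := ⟨_, rfl⟩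
  obtain ⟨N, ⟨-, hN⟩, -⟩ := hcov.existsUnique_continuousMap_lifts ⟨_, hqc⟩ (a₀ := (0 : ℝ × ℝ))
    (e₀ := r) hr (fun a => by
      intro h0
      have := hq1 a
      simp only [ContinuousMap.coe_mk, mem_singleton_iff] at h0
      rw [h0] at this; simp at this)
  have hN2 : ∀ x, N x ^ 2 = q (ch x) x := fun x => congrFun hN x
  have hN1 : ∀ x, ‖N x‖ = 1 := by
    intro x
    have : ‖N x‖ ^ 2 = 1 := by rw [← norm_pow, hN2, hq1]
    nlinarith [norm_nonneg (N x)]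
  refine ⟨fun x => ((N x).re, (N x).im), ⟨by fun_prop, fun x => ?_, fun φ hφ x hx => ?_⟩⟩
  · have := Complex.sq_norm (N x)
    rw [hN1, Complex.normSq_apply] at this
    simp only; linarith
  · have h1 : N x ^ 2 = (z φ x / (‖z φ x‖ : ℂ)) ^ 2 := by
      rw [hN2]; exact hqq φ hφ _ (hch x) x hx (hmem x)
    have hn : ‖z φ x‖ ≠ 0 := by simpa using hz0 φ hφ x hx
    have hn' : (‖z φ x‖ : ℂ) ≠ 0 := by exact_mod_cast hn
    have hzN : ∃ k : ℝ, k ≠ 0 ∧ z φ x = k * N x := by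
      rcases sq_eq_sq_iff_eq_or_eq_neg.1 h1 with h | h
      · exact ⟨‖z φ x‖, hn, by rw [h]; field_simp⟩
      · exact ⟨-‖z φ x‖, neg_ne_zero.2 hn, by rw [h]; push_cast; field_simp⟩
    obtain ⟨k, hk, hzk⟩ := hzN
    refine ⟨k, hk, fun w => ?_⟩
    have e1 : fderiv ℝ (fun z => (φ (proj z)).2) x (0, 1) = k * (N x).re := by
      simpa [z] using congrArg Complex.re hzk
    have e2 : -fderiv ℝ (fun z => (φ (proj z)).2) x (1, 0) = k * (N x).im := by
      simpa [z] using congrArg Complex.im hzk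
    have : w = w.1 • ((1, 0) : ℝ × ℝ) + w.2 • ((0, 1) : ℝ × ℝ) := by ext <;> simp
    conv_lhs => rw [this]
    rw [map_add, map_smul, map_smul, e1]
    unfold cross
    simp only [smul_eq_mul]
    linear_combination (-w.1) * e2

end Foliation

/-! ### The flow of a uniquely integrable unit field -/

/-- A chart of the plane adapted to a vector field `X`: the horizontal lines of the chart are
carried to curves tangent to `X`, with the speed factor `lam`. -/
structure FlowChart (X : ℝ × ℝ → ℝ × ℝ) (V : Set (ℝ × ℝ)) (ψ L : ℝ × ℝ → ℝ × ℝ)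
    (lam : ℝ × ℝ → ℝ) : Prop extends PlaneChart V ψ L where
  continuous_lam : Continuous lam
  lam_pos : ∀ y, 0 < lam y
  fderiv_symm : ∀ y, fderiv ℝ L y (1, 0) = lam y • X (L y)

/-- The time needed to go from `(0, y.2)` to `y` along a horizontal line at speed `1 / lam`. -/
noncomputable def travelTime (lam : ℝ × ℝ → ℝ) (y : ℝ × ℝ) : ℝ := ∫ w in (0 : ℝ)..y.1, lam (w, y.2)

/-- Horizontal reparametrization of the plane by travel time. -/
noncomputable def straighten (lam : ℝ × ℝ → ℝ) (y : ℝ × ℝ) : ℝ × ℝ := (travelTime lam y, y.2)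

section straighten
variable {lam : ℝ × ℝ → ℝ}

lemma hasDerivAt_travelTime (hc : Continuous lam) (u v : ℝ) :
    HasDerivAt (fun u => travelTime lam (u, v)) (lam (u, v)) u := by
  have hc' : Continuous fun w : ℝ => lam (w, v) := by fun_prop
  exact intervalIntegral.integral_hasDerivAt_right (hc'.intervalIntegrable _ _)
    (hc'.stronglyMeasurableAtFilter _ _) hc'.continuousAt

lemma strictMono_travelTime (hc : Continuous lam) (hp : ∀ y, 0 < lam y) (v : ℝ) :
    StrictMono fun u => travelTime lam (u, v) :=
  strictMono_of_hasDerivAt_pos (fun u => hasDerivAt_travelTime hc u v) fun _ => hp _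

lemma continuous_travelTime (hc : Continuous lam) : Continuous (travelTime lam) := by
  unfold travelTime
  exact intervalIntegral.continuous_parametric_intervalIntegral_of_continuous
    (f := fun (y : ℝ × ℝ) w => lam (w, y.2)) (by fun_prop) continuous_fst

lemma straighten_injective (hc : Continuous lam) (hp : ∀ y, 0 < lam y) :
    Function.Injective (straighten lam) := by
  rintro ⟨u, v⟩ ⟨u', v'⟩ h
  have h2 : v = v' := congrArg Prod.snd h
  subst h2
  have h1 : travelTime lam (u, v) = travelTime lam (u', v) := congrArg Prod.fst h
  rw [(strictMono_travelTime hc hp v).injective h1]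

/-- The factor `lam` is only continuous, so the inverse function theorem does not apply; openness
comes from monotonicity in the horizontal direction. -/
lemma isOpenEmbedding_straighten (hc : Continuous lam) (hp : ∀ y, 0 < lam y) :
    IsOpenEmbedding (straighten lam) := by
  have hcont := continuous_travelTime hc
  refine .of_continuous_injective_isOpenMap (hcont.prodMk continuous_snd)
    (straighten_injective hc hp) ?_
  rw [isOpenMap_iff_nhds_le]
  rintro ⟨u, v⟩
  intro A hA
  rw [Filter.mem_map] at hA
  obtain ⟨ε, hε, hball⟩ := Metric.mem_nhds_iff.1 hA
  -- the travel time separates the end points of a small horizontal interval around `u`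
  have hlt1 : travelTime lam (u - ε / 2, v) < travelTime lam (u, v) :=
    strictMono_travelTime hc hp v (by linarith)
  have hlt2 : travelTime lam (u, v) < travelTime lam (u + ε / 2, v) :=
    strictMono_travelTime hc hp v (by linarith)
  have e1 : ∀ᶠ p : ℝ × ℝ in 𝓝 (straighten lam (u, v)),
      travelTime lam (u - ε / 2, p.2) < p.1 :=
    ContinuousAt.eventually_lt (f := fun p : ℝ × ℝ => travelTime lam (u - ε / 2, p.2))
      (by fun_prop) continuousAt_fst hlt1
  have e2 : ∀ᶠ p : ℝ × ℝ in 𝓝 (straighten lam (u, v)),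
      p.1 < travelTime lam (u + ε / 2, p.2) :=
    ContinuousAt.eventually_lt (g := fun p : ℝ × ℝ => travelTime lam (u + ε / 2, p.2))
      continuousAt_fst (by fun_prop) hlt2
  have e3 : ∀ᶠ p : ℝ × ℝ in 𝓝 (straighten lam (u, v)), p.2 ∈ Metric.ball v ε :=
    continuousAt_snd.eventually (Metric.ball_mem_nhds _ hε)
  filter_upwards [e1, e2, e3] with p h1 h2 h3
  have hcv : Continuous fun w => travelTime lam (w, p.2) := by fun_prop
  obtain ⟨w, hw, hwp⟩ := intermediate_value_Icc (a := u - ε / 2) (b := u + ε / 2) (by linarith)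
    hcv.continuousOn ⟨h1.le, h2.le⟩
  have hmem : ((w, p.2) : ℝ × ℝ) ∈ Metric.ball (u, v) ε := by
    rw [Metric.mem_ball, Prod.dist_eq, max_lt_iff]
    refine ⟨?_, h3⟩
    rw [Real.dist_eq, abs_lt]
    constructor <;> linarith [hw.1, hw.2]
  have := hball hmem
  simp only [mem_preimage, straighten] at this
  have hwp' : travelTime lam (w, p.2) = p.1 := hwp
  rwa [hwp'] at this

end straighten

namespace FlowChart
variable {X : ℝ × ℝ → ℝ × ℝ} {V : Set (ℝ × ℝ)} {ψ L : ℝ × ℝ → ℝ × ℝ} {lam : ℝ × ℝ → ℝ}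

lemma fderiv_apply_field (h : FlowChart X V ψ L lam) {x : ℝ × ℝ} (hx : x ∈ V) :
    fderiv ℝ ψ x (X x) = ((lam (ψ x))⁻¹, 0) := by
  have h1 := h.fderiv_symm_apply (ψ x) (1, 0)
  rw [h.fderiv_symm, h.right x hx, map_smul] at h1
  have h0 := (h.lam_pos (ψ x)).ne'
  have h2 : fderiv ℝ ψ x (X x) = (lam (ψ x))⁻¹ • ((1, 0) : ℝ × ℝ) := by
    rw [← h1, smul_smul, inv_mul_cancel₀ h0, one_smul]
  rw [h2]; simp

/-- In the straightened chart, integral curves of `X` are horizontal and of unit speed. -/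
lemma straighten_solution (h : FlowChart X V ψ L lam) {x : ℝ → ℝ × ℝ} {a b : ℝ}
    (hx : ∀ t ∈ Ioo a b, HasDerivAt x (X (x t)) t) (hV : ∀ t ∈ Ioo a b, x t ∈ V) {s t : ℝ}
    (hs : s ∈ Ioo a b) (ht : t ∈ Ioo a b) :
    straighten lam (ψ (x t)) = straighten lam (ψ (x s)) + (t - s, 0) := by
  have hd : ∀ t ∈ Ioo a b, HasDerivAt (fun t => ψ (x t)) ((lam (ψ (x t)))⁻¹, 0) t := by
    intro t ht
    have := (h.hasFDerivAt (hV t ht)).comp_hasDerivAt t (hx t ht)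
    rwa [h.fderiv_apply_field (hV t ht)] at this
  have h2 : ∀ t ∈ Ioo a b, HasDerivAt (fun t => (ψ (x t)).2) 0 t := fun t ht =>
    (ContinuousLinearMap.snd ℝ ℝ ℝ).hasFDerivAt.comp_hasDerivAt t (hd t ht)
  have h1 : ∀ t ∈ Ioo a b, HasDerivAt (fun t => (ψ (x t)).1) (lam (ψ (x t)))⁻¹ t := fun t ht =>
    (ContinuousLinearMap.fst ℝ ℝ ℝ).hasFDerivAt.comp_hasDerivAt t (hd t ht)
  have hconst : ∀ t ∈ Ioo a b, (ψ (x t)).2 = (ψ (x s)).2 := fun t ht =>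
    isOpen_Ioo.is_const_of_deriv_eq_zero isPreconnected_Ioo
      (fun t ht => (h2 t ht).differentiableAt.differentiableWithinAt)
      (fun t ht => (h2 t ht).deriv) ht hs
  have hT : ∀ t ∈ Ioo a b,
      HasDerivAt (fun t => travelTime lam ((ψ (x t)).1, (ψ (x s)).2) - t) 0 t := by
    intro t ht
    have e := ((hasDerivAt_travelTime h.continuous_lam (ψ (x t)).1 (ψ (x s)).2).comp t
      (h1 t ht)).sub (hasDerivAt_id t)
    have hl : lam ((ψ (x t)).1, (ψ (x s)).2) = lam (ψ (x t)) := by rw [← hconst t ht]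
    rw [hl, mul_inv_cancel₀ (h.lam_pos _).ne', sub_self] at e
    exact e
  have hTc : travelTime lam ((ψ (x t)).1, (ψ (x s)).2) - t
      = travelTime lam ((ψ (x s)).1, (ψ (x s)).2) - s :=
    isOpen_Ioo.is_const_of_deriv_eq_zero isPreconnected_Ioo
      (fun t ht => (hT t ht).differentiableAt.differentiableWithinAt)
      (fun t ht => (hT t ht).deriv) ht hs
  have hTc' : travelTime lam (ψ (x t)) - t = travelTime lam (ψ (x s)) - s := by
    have e : ψ (x t) = ((ψ (x t)).1, (ψ (x s)).2) := Prod.ext rfl (hconst t ht)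
    rw [e]
    exact hTc
  ext
  · simp only [straighten, Prod.fst_add]; linarith
  · simp only [straighten, Prod.snd_add, add_zero]; exact hconst t ht

/-- Existence and continuity of the local flow: in the straightened chart it is the horizontal
translation. -/
lemma exists_local_flow (h : FlowChart X V ψ L lam) {x₀ : ℝ × ℝ} (hx₀ : x₀ ∈ V) :
    ∃ ε > 0, ∃ N, IsOpen N ∧ x₀ ∈ N ∧ ∃ f : ℝ → ℝ × ℝ → ℝ × ℝ,
      (∀ x ∈ N, f 0 x = x) ∧
      (∀ x ∈ N, ∀ t ∈ Ioo (-ε) ε, HasDerivAt (fun t => f t x) (X (f t x)) t) ∧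
      ∀ t ∈ Ioo (-ε) ε, ContinuousOn (f t) N := by
  have hemb := isOpenEmbedding_straighten h.continuous_lam h.lam_pos
  set S := hemb.toOpenPartialHomeomorph (straighten lam) with hS
  have hSa : ∀ y, S y = straighten lam y := fun y => rfl
  have hSsymm : ∀ y, S.symm (straighten lam y) = y := fun y => by
    rw [← hSa]; exact S.left_inv (by simp [hS])
  have htgt : S.target = range (straighten lam) := by simp [hS]
  have hopen : IsOpen (range (straighten lam)) := hemb.isOpen_range
  have hψc : ContinuousOn ψ V := h.contDiffOn.continuousOn
  obtain ⟨δ, hδ, hball⟩ := Metric.isOpen_iff.1 hopen _ (mem_range_self (ψ x₀))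
  have hg : ContinuousOn (fun x => straighten lam (ψ x)) V := hemb.continuous.comp_continuousOn hψc
  let N := V ∩ (fun x => straighten lam (ψ x)) ⁻¹' Metric.ball (straighten lam (ψ x₀)) (δ / 2)
  have hin : ∀ x ∈ N, ∀ t ∈ Ioo (-(δ / 2)) (δ / 2),
      straighten lam (ψ x) + (t, 0) ∈ range (straighten lam) := by
    rintro x ⟨-, hx⟩ t ht
    apply hball
    rw [mem_preimage, Metric.mem_ball, dist_eq_norm] at hx
    rw [Metric.mem_ball, dist_eq_norm]
    have h3 : ‖((t, 0) : ℝ × ℝ)‖ < δ / 2 := by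
      rw [Prod.norm_def, max_lt_iff]
      simp only [norm_zero, Real.norm_eq_abs]
      exact ⟨abs_lt.2 ht, by linarith⟩
    calc ‖straighten lam (ψ x) + (t, 0) - straighten lam (ψ x₀)‖
        = ‖(straighten lam (ψ x) - straighten lam (ψ x₀)) + (t, 0)‖ := by congr 1; abel
      _ ≤ ‖straighten lam (ψ x) - straighten lam (ψ x₀)‖ + ‖((t, 0) : ℝ × ℝ)‖ := norm_add_le _ _
      _ < δ := by linarith
  refine ⟨δ / 2, by positivity, N, hg.isOpen_inter_preimage h.isOpen Metric.isOpen_ball,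
    ⟨hx₀, Metric.mem_ball_self (by positivity)⟩,
    fun t x => L (S.symm (straighten lam (ψ x) + (t, 0))), ?_, ?_, ?_⟩
  · intro x hx
    have : straighten lam (ψ x) + ((0, 0) : ℝ × ℝ) = straighten lam (ψ x) := by simp
    simp only [this, hSsymm]
    exact h.right x hx.1
  · intro x hx t ht
    set p := straighten lam (ψ x) with hp
    have hmem := hin x hx t ht
    obtain ⟨y, hy⟩ := hmem
    have hsy : S.symm (p + (t, 0)) = y := by rw [← hy, hSsymm]
    -- the second coordinate is constant along the curve
    have hsnd : ∀ q ∈ range (straighten lam), (S.symm q).2 = q.2 := by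
      rintro _ ⟨z, rfl⟩; rw [hSsymm]; rfl
    have hcS : ContinuousAt (fun r : ℝ => S.symm (p + (r, 0))) t := by
      have h1 : ContinuousAt S.symm (p + (t, 0)) := by
        apply S.symm.continuousAt
        rw [S.symm_source, htgt, ← hy]; exact mem_range_self y
      exact ContinuousAt.comp (f := fun r : ℝ => p + ((r, 0) : ℝ × ℝ)) h1 (by fun_prop)
    have hu : HasDerivAt (fun r : ℝ => (S.symm (p + (r, 0))).1 ) (lam y)⁻¹ t := by
      have hT : HasDerivAt (fun u => travelTime lam (u, y.2) - p.1) (lam y)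
          ((S.symm (p + (t, 0))).1) := by
        rw [hsy]
        exact (hasDerivAt_travelTime h.continuous_lam y.1 y.2).sub_const _
      refine hT.of_local_left_inverse (g := fun r : ℝ => (S.symm (p + (r, 0))).1)
        (continuous_fst.continuousAt.comp hcS) (h.lam_pos y).ne' ?_
      filter_upwards [isOpen_Ioo.mem_nhds ht] with r hr
      obtain ⟨z, hz⟩ := hin x hx r hr
      rw [← hp] at hz
      rw [← hz, hSsymm]
      have h2 : z.2 = y.2 := by
        have e1 : z.2 = (p + (r, 0)).2 := congrArg Prod.snd (a₁ := straighten lam z) hz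
        have e2 : y.2 = (p + (t, 0)).2 := congrArg Prod.snd (a₁ := straighten lam y) hy
        rw [e1, e2]; rfl
      have h1 : travelTime lam z = (p + (r, 0)).1 := congrArg Prod.fst hz
      rw [← h2]
      simp only [Prod.fst_add] at h1
      show travelTime lam z - p.1 = r
      linarith
    have hSd : HasDerivAt (fun r : ℝ => S.symm (p + (r, 0))) ((lam y)⁻¹, 0) t := by
      have hh := hu.prodMk (hasDerivAt_const t p.2)
      refine hh.congr_of_eventuallyEq ?_
      filter_upwards [isOpen_Ioo.mem_nhds ht] with r hr
      refine Prod.ext rfl ?_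
      rw [hsnd _ (hin x hx r hr)]; simp [hp]
    have hL := ((h.contDiff.differentiable (by norm_num)) (S.symm (p + (t, 0)))).hasFDerivAt
    have := hL.comp_hasDerivAt t hSd
    have e : fderiv ℝ L (S.symm (p + (t, 0))) ((lam y)⁻¹, 0) = X (L (S.symm (p + (t, 0)))) := by
      have e1 : (((lam y)⁻¹, 0) : ℝ × ℝ) = (lam y)⁻¹ • ((1, 0) : ℝ × ℝ) := by simp
      rw [e1, map_smul, h.fderiv_symm, hsy, smul_smul, inv_mul_cancel₀ (h.lam_pos y).ne', one_smul]
    rw [e] at this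
    exact this
  · intro t ht
    refine h.contDiff.continuous.comp_continuousOn ?_
    refine S.continuousOn_symm.comp (f := fun x => straighten lam (ψ x) + ((t, 0) : ℝ × ℝ))
      ((hg.mono fun x hx => hx.1).add continuousOn_const) ?_
    intro x hx
    rw [htgt]
    exact hin x hx t ht

end FlowChart

/-- A continuous unit vector field on the plane which spans a line field that is invariant under
the lattice, and is tangent to a `C¹` foliation. -/
structure LineField (X : ℝ × ℝ → ℝ × ℝ) : Prop where
  continuous : Continuous X
  unit : ∀ x, (X x).1 ^ 2 + (X x).2 ^ 2 = 1
  chart : ∀ x, ∃ V ψ L lam, x ∈ V ∧ FlowChart X V ψ L lam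
  period : ∀ n, ∃ σ : ℝ, (σ = 1 ∨ σ = -1) ∧ ∀ x, X (x + latt n) = σ • X x

namespace LineField
variable {X : ℝ × ℝ → ℝ × ℝ}

lemma norm_le (h : LineField X) (x : ℝ × ℝ) : ‖X x‖ ≤ 1 := by
  have := h.unit x
  rw [Prod.norm_def, max_le_iff, Real.norm_eq_abs, Real.norm_eq_abs, abs_le_one_iff_mul_self_le_one,
    abs_le_one_iff_mul_self_le_one]
  constructor <;> nlinarith [sq_nonneg (X x).1, sq_nonneg (X x).2]

/-- Although `X` is only continuous, its integral curves are unique: they are horizontal lines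
in the straightened charts. -/
lemma solution_unique (h : LineField X) {x y : ℝ → ℝ × ℝ} {a b t₀ : ℝ}
    (hx : ∀ t ∈ Ioo a b, HasDerivAt x (X (x t)) t) (hy : ∀ t ∈ Ioo a b, HasDerivAt y (X (y t)) t)
    (ht₀ : t₀ ∈ Ioo a b) (h0 : x t₀ = y t₀) : ∀ t ∈ Ioo a b, x t = y t := by
  have hxc : ContinuousOn x (Ioo a b) := fun t ht => (hx t ht).continuousAt.continuousWithinAt
  have hyc : ContinuousOn y (Ioo a b) := fun t ht => (hy t ht).continuousAt.continuousWithinAt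
  let u := {t | t ∈ Ioo a b ∧ x t = y t}
  have hu : IsOpen u := by
    rw [isOpen_iff_mem_nhds]
    rintro t ⟨ht, hxy⟩
    obtain ⟨V, ψ, L, lam, hV, hch⟩ := h.chart (x t)
    have e1 : ∀ᶠ s in 𝓝 t, x s ∈ V :=
      (hx t ht).continuousAt.eventually (hch.isOpen.mem_nhds hV)
    have e2 : ∀ᶠ s in 𝓝 t, y s ∈ V :=
      (hy t ht).continuousAt.eventually (hch.isOpen.mem_nhds (hxy ▸ hV))
    obtain ⟨ε, hε, hball⟩ := Metric.eventually_nhds_iff_ball.1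
      (e1.and (e2.and (isOpen_Ioo.mem_nhds ht)))
    rw [Real.ball_eq_Ioo] at hball
    have htm : t ∈ Ioo (t - ε) (t + ε) := ⟨by linarith, by linarith⟩
    filter_upwards [isOpen_Ioo.mem_nhds htm] with s hs
    refine ⟨(hball s hs).2.2, ?_⟩
    have f1 := hch.straighten_solution (fun r hr => hx r (hball r hr).2.2)
      (fun r hr => (hball r hr).1) htm hs
    have f2 := hch.straighten_solution (fun r hr => hy r (hball r hr).2.2)
      (fun r hr => (hball r hr).2.1) htm hs
    rw [hxy, ← f2] at f1
    have f3 := straighten_injective hch.continuous_lam hch.lam_pos f1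
    rw [← hch.right _ (hball s hs).1, f3, hch.right _ (hball s hs).2.1]
  have hsub : Ioo a b ⊆ u := by
    refine isPreconnected_Ioo.subset_of_closure_inter_subset hu ⟨t₀, ht₀, ht₀, h0⟩ ?_
    rintro t ⟨htc, ht⟩
    refine ⟨ht, ?_⟩
    have hcl : IsClosed {s : Ioo a b | x s = y s} :=
      isClosed_eq hxc.domRestrict hyc.domRestrict
    have : (⟨t, ht⟩ : Ioo a b) ∈ closure {s : Ioo a b | x s = y s} := by
      rw [closure_subtype]
      refine closure_mono ?_ htc
      rintro s ⟨hs, hs'⟩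
      exact ⟨⟨s, hs⟩, hs', rfl⟩
    rw [hcl.closure_eq] at this
    exact this
  exact fun t ht => (hsub ht).2

/-- By compactness of a fundamental square and invariance under the lattice, the local flows exist
for a uniform time. -/
lemma exists_uniform_local_flow (h : LineField X) :
    ∃ ε > 0, ∀ x₀, ∃ N, IsOpen N ∧ x₀ ∈ N ∧ ∃ f : ℝ → ℝ × ℝ → ℝ × ℝ,
      (∀ x ∈ N, f 0 x = x) ∧
      (∀ x ∈ N, ∀ t ∈ Ioo (-ε) ε, HasDerivAt (fun t => f t x) (X (f t x)) t) ∧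
      ∀ t ∈ Ioo (-ε) ε, ContinuousOn (f t) N := by
  let P : ℝ → ℝ × ℝ → Prop := fun ε x₀ => ∃ N, IsOpen N ∧ x₀ ∈ N ∧ ∃ f : ℝ → ℝ × ℝ → ℝ × ℝ,
      (∀ x ∈ N, f 0 x = x) ∧
      (∀ x ∈ N, ∀ t ∈ Ioo (-ε) ε, HasDerivAt (fun t => f t x) (X (f t x)) t) ∧
      ∀ t ∈ Ioo (-ε) ε, ContinuousOn (f t) N
  have hmono : ∀ ε ε' x, ε' ≤ ε → P ε x → P ε' x := by
    rintro ε ε' x hε ⟨N, hN, hx, f, h0, h1, h2⟩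
    have hss : Ioo (-ε') ε' ⊆ Ioo (-ε) ε := Ioo_subset_Ioo (by linarith) hε
    exact ⟨N, hN, hx, f, h0, fun x hx t ht => h1 x hx t (hss ht), fun t ht => h2 t (hss ht)⟩
  have hcpt : ∃ ε > 0, ∀ x ∈ Icc (0 : ℝ × ℝ) 1, P ε x := by
    refine (isCompact_Icc (a := (0 : ℝ × ℝ)) (b := 1)).induction_on
      (p := fun s => ∃ ε > 0, ∀ x ∈ s, P ε x) ⟨1, one_pos, by simp⟩ ?_ ?_ ?_
    · rintro s t hst ⟨ε, hε, hP⟩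
      exact ⟨ε, hε, fun x hx => hP x (hst hx)⟩
    · rintro s t ⟨ε, hε, hP⟩ ⟨ε', hε', hP'⟩
      refine ⟨min ε ε', lt_min hε hε', ?_⟩
      rintro x (hx | hx)
      · exact hmono _ _ _ (min_le_left _ _) (hP x hx)
      · exact hmono _ _ _ (min_le_right _ _) (hP' x hx)
    · intro x _
      obtain ⟨V, ψ, L, lam, hV, hch⟩ := h.chart x
      obtain ⟨ε, hε, N, hN, hx, hf⟩ := hch.exists_local_flow hV
      exact ⟨N, mem_nhdsWithin_of_mem_nhds (hN.mem_nhds hx), ε, hε, fun y hy => ⟨N, hN, hy, hf⟩⟩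
  obtain ⟨ε, hε, hP⟩ := hcpt
  refine ⟨ε, hε, fun x => ?_⟩
  obtain ⟨n, hn⟩ := exists_mem_square x
  obtain ⟨N, hN, hx, f, h0, h1, h2⟩ := hP _ hn
  obtain ⟨σ, hσ, hσX⟩ := h.period n
  have hσσ : σ * σ = 1 := by rcases hσ with rfl | rfl <;> norm_num
  have hσt : ∀ t ∈ Ioo (-ε) ε, σ * t ∈ Ioo (-ε) ε := by
    rintro t ⟨ht1, ht2⟩
    rcases hσ with rfl | rfl
    · simpa using ⟨ht1, ht2⟩
    · constructor <;> linarith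
  refine ⟨(fun z => z + latt n) ⁻¹' N, hN.preimage (by fun_prop), hx,
    fun t z => f (σ * t) (z + latt n) - latt n, ?_, ?_, ?_⟩
  · intro z hz
    simp [h0 _ hz]
  · intro z hz t ht
    have e := (h1 _ hz _ (hσt t ht)).scomp t (((hasDerivAt_id t).const_mul σ))
    have e' := e.sub_const (latt n)
    have hX := hσX (f (σ * t) (z + latt n) - latt n)
    rw [sub_add_cancel] at hX
    simp only [mul_one] at e'
    rw [hX, smul_smul, hσσ, one_smul] at e'
    exact e'
  · intro t ht
    refine ContinuousOn.sub ?_ continuousOn_const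
    exact (h2 _ (hσt t ht)).comp (by fun_prop) fun z hz => hz

/-- Two integral curves that agree at a time can be concatenated there. -/
lemma solution_glue (h : LineField X) {x y : ℝ → ℝ × ℝ} {a b c d t₀ : ℝ} (hac : a ≤ c)
    (hbd : b ≤ d)
    (hx : ∀ t ∈ Ioo a b, HasDerivAt x (X (x t)) t) (hy : ∀ t ∈ Ioo c d, HasDerivAt y (X (y t)) t)
    (ht₀ : t₀ ∈ Ioo c b) (h0 : x t₀ = y t₀) :
    ∀ t ∈ Ioo a d, HasDerivAt (fun t => if t < t₀ then x t else y t)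
      (X (if t < t₀ then x t else y t)) t := by
  have huniq := h.solution_unique (a := c) (b := b)
    (fun t ht => hx t ⟨hac.trans_lt ht.1, ht.2⟩) (fun t ht => hy t ⟨ht.1, ht.2.trans_le hbd⟩) ht₀ h0
  intro t ht
  rcases lt_trichotomy t t₀ with hlt | rfl | hgt
  · rw [if_pos hlt]
    refine (hx t ⟨ht.1, hlt.trans ht₀.2⟩).congr_of_eventuallyEq ?_
    filter_upwards [isOpen_Iio.mem_nhds hlt] with s hs
    rw [if_pos (show s < t₀ from hs)]
  · rw [if_neg (lt_irrefl _)]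
    refine (hy t ⟨ht₀.1, ht.2⟩).congr_of_eventuallyEq ?_
    filter_upwards [isOpen_Ioo.mem_nhds ht₀] with s hs
    split_ifs
    · exact huniq s hs
    · rfl
  · rw [if_neg hgt.not_gt]
    refine (hy t ⟨ht₀.1.trans hgt, ht.2⟩).congr_of_eventuallyEq ?_
    filter_upwards [isOpen_Ioi.mem_nhds hgt] with s hs
    rw [if_neg (not_lt.2 (le_of_lt hs))]

/-- Solutions are continued by a fixed amount of time on both sides, repeatedly. -/
lemma exists_global_solution (h : LineField X) (x₀ : ℝ × ℝ) :
    ∃ x : ℝ → ℝ × ℝ, x 0 = x₀ ∧ ∀ t, HasDerivAt x (X (x t)) t := by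
  obtain ⟨ε, hε, hloc⟩ := h.exists_uniform_local_flow
  have hloc' : ∀ p t₀, ∃ y : ℝ → ℝ × ℝ, y t₀ = p ∧
      ∀ t ∈ Ioo (t₀ - ε) (t₀ + ε), HasDerivAt y (X (y t)) t := by
    intro p t₀
    obtain ⟨N, -, hp, f, h0, h1, -⟩ := hloc p
    refine ⟨fun t => f (t - t₀) p, by simp [h0 p hp], fun t ht => ?_⟩
    have := (h1 p hp (t - t₀) ⟨by linarith [ht.1], by linarith [ht.2]⟩).comp_sub_const t t₀
    exact this
  have hstep : ∀ k : ℕ, ∃ x : ℝ → ℝ × ℝ, x 0 = x₀ ∧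
      ∀ t ∈ Ioo (-((k + 1) * (ε / 2))) ((k + 1) * (ε / 2)), HasDerivAt x (X (x t)) t := by
    intro k
    induction k with
    | zero =>
      obtain ⟨y, hy0, hy⟩ := hloc' x₀ 0
      refine ⟨y, hy0, fun t ht => hy t ?_⟩
      constructor
      · have := ht.1; push_cast at this; linarith
      · have := ht.2; push_cast at this; linarith
    | succ k ih =>
      obtain ⟨x, hx0, hx⟩ := ih
      set A : ℝ := (k + 1) * (ε / 2) with hA
      have hAε : ε / 2 ≤ A := by
        rw [hA]; nlinarith [(Nat.cast_nonneg k : (0 : ℝ) ≤ k)]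
      have hA' : ((k + 1 : ℕ) + 1 : ℝ) * (ε / 2) = A + ε / 2 := by push_cast; ring
      rw [hA']
      obtain ⟨y, hy0, hy⟩ := hloc' (x (A - ε / 4)) (A - ε / 4)
      have g1 := h.solution_glue (a := -A) (b := A) (c := max (-A) (A - ε / 4 - ε))
        (d := A - ε / 4 + ε) (t₀ := A - ε / 4) (le_max_left _ _) (by linarith) hx
        (fun t ht => hy t ⟨(le_max_right _ _).trans_lt ht.1, ht.2⟩)
        ⟨max_lt (by linarith) (by linarith), by linarith⟩ hy0.symm
      set z : ℝ → ℝ × ℝ := fun t => if t < A - ε / 4 then x t else y t with hz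
      have hz0 : z 0 = x₀ := by
        rw [hz]; simp only; rw [if_pos (by linarith), hx0]
      obtain ⟨w, hw0, hw⟩ := hloc' (z (-A + ε / 4)) (-A + ε / 4)
      have g2 := h.solution_glue (a := -A + ε / 4 - ε) (b := min (-A + ε / 4 + ε) (A - ε / 4 + ε))
        (c := -A) (d := A - ε / 4 + ε) (t₀ := -A + ε / 4) (by linarith) (min_le_right _ _)
        (fun t ht => hw t ⟨ht.1, ht.2.trans_le (min_le_left _ _)⟩) g1
        ⟨by linarith, lt_min (by linarith) (by linarith)⟩ hw0
      refine ⟨_, ?_, fun t ht => g2 t ⟨by linarith [ht.1], by linarith [ht.2]⟩⟩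
      rw [if_neg (by linarith), hz0]
  choose xs hxs0 hxs using hstep
  have hagree : ∀ k l : ℕ, k ≤ l → ∀ t ∈ Ioo (-((k + 1) * (ε / 2))) ((k + 1) * (ε / 2)),
      xs k t = xs l t := by
    intro k l hkl
    have hkl' : (k : ℝ) ≤ l := by exact_mod_cast hkl
    have hle : ((k : ℝ) + 1) * (ε / 2) ≤ (l + 1) * (ε / 2) := by nlinarith
    have h0 : 0 < ((k : ℝ) + 1) * (ε / 2) := by positivity
    refine h.solution_unique (t₀ := 0) (hxs k)
      (fun t ht => hxs l t ⟨by linarith [ht.1], by linarith [ht.2]⟩) ⟨by linarith, h0⟩ ?_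
    rw [hxs0, hxs0]
  let K : ℝ → ℕ := fun t => ⌈|t| / (ε / 2)⌉₊
  have hK : ∀ t, t ∈ Ioo (-((K t + 1) * (ε / 2))) ((K t + 1) * (ε / 2)) := by
    intro t
    have h1 : |t| / (ε / 2) ≤ K t := Nat.le_ceil _
    rw [div_le_iff₀ (by positivity)] at h1
    rw [mem_Ioo, ← abs_lt]
    linarith
  refine ⟨fun t => xs (K t) t, hxs0 _, fun t => ?_⟩
  refine (hxs (K t) t (hK t)).congr_of_eventuallyEq ?_
  filter_upwards [isOpen_Ioo.mem_nhds (hK t)] with s hs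
  rcases le_total (K s) (K t) with hle | hle
  · exact hagree _ _ hle s (hK s)
  · exact (hagree _ _ hle s hs).symm

end LineField

/-- `Φ` is the global flow of the vector field `X`. -/
structure IsFlowOf (X : ℝ × ℝ → ℝ × ℝ) (Φ : ℝ → ℝ × ℝ → ℝ × ℝ) : Prop where
  zero : ∀ x, Φ 0 x = x
  hasDerivAt : ∀ x t, HasDerivAt (fun t => Φ t x) (X (Φ t x)) t
  add : ∀ s t x, Φ (s + t) x = Φ s (Φ t x)
  continuous : Continuous fun p : ℝ × (ℝ × ℝ) => Φ p.1 p.2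

namespace LineField
variable {X : ℝ × ℝ → ℝ × ℝ} {Φ : ℝ → ℝ × ℝ → ℝ × ℝ}

/-- Integral curves give a global flow. It is continuous in the space variable for small times,
hence for all times, and Lipschitz in time. -/
lemma exists_flow (h : LineField X) : ∃ Φ, IsFlowOf X Φ := by
  choose x hx0 hx using h.exists_global_solution
  have huniq : ∀ y : ℝ → ℝ × ℝ, ∀ a : ℝ, 0 < a → (∀ t ∈ Ioo (-a) a, HasDerivAt y (X (y t)) t) →
      ∀ t ∈ Ioo (-a) a, x (y 0) t = y t := fun y a ha hy =>
    h.solution_unique (fun t _ => hx (y 0) t) hy ⟨by linarith, ha⟩ (hx0 _)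
  have hadd : ∀ s t p, x p (s + t) = x (x p t) s := by
    intro s t p
    have := huniq (fun s => x p (s + t)) (|s| + 1) (by positivity)
      (fun r _ => (hx p (r + t)).comp_add_const r t) s
      ⟨by linarith [neg_abs_le s], by linarith [le_abs_self s]⟩
    simp only [zero_add] at this
    exact this.symm
  refine ⟨fun t p => x p t, hx0, hx, hadd, ?_⟩
  obtain ⟨ε, hε, hloc⟩ := h.exists_uniform_local_flow
  have hsmall : ∀ t ∈ Ioo (-ε) ε, Continuous fun p => x p t := by
    intro t ht
    rw [continuous_iff_continuousAt]
    intro p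
    obtain ⟨N, hN, hp, f, h0, h1, h2⟩ := hloc p
    refine ((h2 t ht).continuousAt (hN.mem_nhds hp)).congr ?_
    filter_upwards [hN.mem_nhds hp] with q hq
    have := huniq (fun t => f t q) ε hε (h1 q hq) t ht
    simp only [h0 q hq] at this
    exact this.symm
  have hall : ∀ t, Continuous fun p => x p t := by
    intro t
    obtain ⟨k, hk⟩ := exists_nat_gt (|t| / ε)
    have hk0 : (0 : ℝ) < k := (by positivity : 0 ≤ |t| / ε).trans_lt hk
    have hmem : t / k ∈ Ioo (-ε) ε := by
      rw [mem_Ioo, ← abs_lt, abs_div, Nat.abs_cast, div_lt_iff₀ hk0]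
      rw [div_lt_iff₀ hε] at hk; linarith
    have hj : ∀ j : ℕ, Continuous fun p => x p (j * (t / k)) := by
      intro j
      induction j with
      | zero =>
        have e : (fun p => x p ((0 : ℕ) * (t / k))) = id := by funext p; simp [hx0]
        rw [e]; exact continuous_id
      | succ j ih =>
        have : (fun p => x p ((j + 1 : ℕ) * (t / k))) = fun p => x (x p (j * (t / k))) (t / k) := by
          funext p
          rw [← hadd]; push_cast; ring_nf
        rw [this]
        exact (hsmall _ hmem).comp ih
    have := hj k
    rwa [mul_div_cancel₀ t hk0.ne'] at this
  refine continuous_prod_of_continuous_lipschitzWith (fun q : ℝ × (ℝ × ℝ) => x q.2 q.1) 1 hall fun p => ?_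
  refine lipschitzWith_of_nnnorm_deriv_le (fun t => (hx p t).differentiableAt) fun t => ?_
  rw [(hx p t).deriv]
  exact h.norm_le _

end LineField

/-! ### First integrals near the orbits of a transverse curve -/

namespace IsFlowOf
variable {X : ℝ × ℝ → ℝ × ℝ} {Φ : ℝ → ℝ × ℝ → ℝ × ℝ}

lemma neg_apply (hΦ : IsFlowOf X Φ) (t : ℝ) (x : ℝ × ℝ) : Φ (-t) (Φ t x) = x := by
  rw [← hΦ.add, neg_add_cancel, hΦ.zero]

lemma eq_iff (hΦ : IsFlowOf X Φ) {t : ℝ} {x y : ℝ × ℝ} : Φ t x = y ↔ x = Φ (-t) y := by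
  constructor
  · rintro rfl; rw [hΦ.neg_apply]
  · rintro rfl
    have := hΦ.neg_apply (-t) y
    rwa [neg_neg] at this

lemma continuous_apply (hΦ : IsFlowOf X Φ) {α : Type*} [TopologicalSpace α] {f : α → ℝ}
    {g : α → ℝ × ℝ} (hf : Continuous f) (hg : Continuous g) :
    Continuous fun a => Φ (f a) (g a) :=
  hΦ.continuous.comp (hf.prodMk hg)

/-- A deck transformation maps orbits to orbits, with the direction reversed if it reverses the
orientation of the line field. -/
lemma translate (hΦ : IsFlowOf X Φ) (hX : LineField X) {n : ℤ × ℤ} {σ : ℝ}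
    (hσ : σ = 1 ∨ σ = -1) (h : ∀ x, X (x + latt n) = σ • X x) (t : ℝ) (x : ℝ × ℝ) :
    Φ t (x + latt n) = Φ (σ * t) x + latt n := by
  have hσσ : σ * σ = 1 := by rcases hσ with rfl | rfl <;> norm_num
  refine hX.solution_unique (a := -(|t| + 1)) (b := |t| + 1) (t₀ := 0)
    (fun s _ => hΦ.hasDerivAt (x + latt n) s) (y := fun t => Φ (σ * t) x + latt n)
    (fun s _ => ?_) ⟨by linarith [abs_nonneg t], by positivity⟩ ?_ t
    ⟨by linarith [neg_abs_le t], by linarith [le_abs_self t]⟩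
  · have e := ((hΦ.hasDerivAt x (σ * s)).scomp s ((hasDerivAt_id s).const_mul σ)).add_const (latt n)
    rw [mul_one] at e
    rw [h]
    exact e
  · simp [hΦ.zero]

end IsFlowOf

namespace FlowChart
variable {X : ℝ × ℝ → ℝ × ℝ} {V : Set (ℝ × ℝ)} {ψ L : ℝ × ℝ → ℝ × ℝ} {lam : ℝ × ℝ → ℝ}
  {Φ : ℝ → ℝ × ℝ → ℝ × ℝ}

/-- As long as an orbit stays in the domain of a chart, the second coordinate is constant. -/
lemma snd_flow (h : FlowChart X V ψ L lam) (hΦ : IsFlowOf X Φ) {x : ℝ × ℝ} {a b s t : ℝ}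
    (hV : ∀ r ∈ Ioo a b, Φ r x ∈ V) (hs : s ∈ Ioo a b) (ht : t ∈ Ioo a b) :
    (ψ (Φ t x)).2 = (ψ (Φ s x)).2 := by
  have := h.straighten_solution (fun r _ => hΦ.hasDerivAt x r) hV hs ht
  have := congrArg Prod.snd this
  simpa [straighten] using this

/-- Two nearby points with the same second coordinate are joined by a short piece of orbit. -/
lemma exists_flow_eq (h : FlowChart X V ψ L lam) (hΦ : IsFlowOf X Φ) {x₀ : ℝ × ℝ} (hx₀ : x₀ ∈ V)
    {η : ℝ} (hη : 0 < η) :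
    ∃ N ∈ 𝓝 x₀, ∀ x ∈ N, ∀ y ∈ N, (ψ x).2 = (ψ y).2 → ∃ t, |t| < η ∧ Φ t x = y := by
  have h1 : ∀ᶠ p : ℝ × (ℝ × ℝ) in 𝓝 (0, x₀), Φ p.1 p.2 ∈ V := by
    apply hΦ.continuous.continuousAt.eventually
    simp only [hΦ.zero]
    exact h.isOpen.mem_nhds hx₀
  rw [nhds_prod_eq] at h1
  obtain ⟨A, hA, B, hB, hAB⟩ := Filter.eventually_prod_iff.1 h1
  obtain ⟨ε, hε, hball⟩ := Metric.eventually_nhds_iff_ball.1 hA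
  rw [Real.ball_eq_Ioo, zero_sub, zero_add] at hball
  have hψ : ContinuousAt (fun x => travelTime lam (ψ x)) x₀ :=
    (continuous_travelTime h.continuous_lam).continuousAt.comp
      (h.hasFDerivAt hx₀).continuousAt
  have hm : 0 < min η ε := lt_min hη hε
  have h2 := Metric.continuousAt_iff'.1 hψ (min η ε / 2) (by positivity)
  refine ⟨_, h2.and (hB.and (h.isOpen.mem_nhds hx₀)), ?_⟩
  rintro x ⟨hx1, hx2, hx3⟩ y ⟨hy1, hy2, hy3⟩ hxy
  rw [Real.dist_eq, abs_lt] at hx1 hy1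
  have hlt : |travelTime lam (ψ y) - travelTime lam (ψ x)| < min η ε := by
    rw [abs_lt]; constructor <;> linarith
  refine ⟨travelTime lam (ψ y) - travelTime lam (ψ x), hlt.trans_le (min_le_left _ _), ?_⟩
  set t := travelTime lam (ψ y) - travelTime lam (ψ x) with ht
  have hV : ∀ r ∈ Ioo (-ε) ε, Φ r x ∈ V := fun r hr => hAB (hball r hr) hx2
  have htm : t ∈ Ioo (-ε) ε := abs_lt.1 (hlt.trans_le (min_le_right _ _))
  have hs := h.straighten_solution (fun r _ => hΦ.hasDerivAt x r) hV
    (s := 0) ⟨by linarith, hε⟩ htm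
  rw [hΦ.zero] at hs
  have : straighten lam (ψ (Φ t x)) = straighten lam (ψ y) := by
    rw [hs]
    refine Prod.ext ?_ ?_
    · simp [straighten, ht]
    · simp [straighten, hxy]
  have := straighten_injective h.continuous_lam h.lam_pos this
  rw [← h.right _ (hV t htm), this, h.right _ hy3]

/-- A horizontal line of a chart lies on one orbit. -/
lemma exists_flow_eq_of_snd_eq (h : FlowChart X V ψ L lam) (hΦ : IsFlowOf X Φ) {y z : ℝ × ℝ}
    (hyz : y.2 = z.2) : ∃ t, Φ t (L y) = L z := by
  let U : Set ℝ := {u | ∃ t, Φ t (L y) = L (u, z.2)}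
  have hloc : ∀ u₀ : ℝ, ∃ N ∈ 𝓝 u₀, ∀ u ∈ N, ∀ u' ∈ N, u ∈ U → u' ∈ U := by
    intro u₀
    obtain ⟨N, hN, hNf⟩ := h.exists_flow_eq hΦ (h.mapsTo (u₀, z.2)) one_pos
    have hc : ContinuousAt (fun u : ℝ => L (u, z.2)) u₀ := by
      have := h.contDiff.continuous
      fun_prop
    refine ⟨_, hc hN, ?_⟩
    rintro u hu u' hu' ⟨t, ht⟩
    obtain ⟨r, -, hr⟩ := hNf _ hu _ hu' (by rw [h.left, h.left])
    exact ⟨r + t, by rw [hΦ.add, ht, hr]⟩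
  have hcl : IsClopen U := by
    refine ⟨⟨isOpen_iff_mem_nhds.2 fun u hu => ?_⟩, isOpen_iff_mem_nhds.2 fun u hu => ?_⟩
    · obtain ⟨N, hN, hN'⟩ := hloc u
      filter_upwards [hN] with u' hu' hmem
      exact hu (hN' _ hu' _ (mem_of_mem_nhds hN) hmem)
    · obtain ⟨N, hN, hN'⟩ := hloc u
      filter_upwards [hN] with u' hu'
      exact hN' _ (mem_of_mem_nhds hN) _ hu' hu
  have huniv := hcl.eq_univ ⟨y.1, 0, by rw [hΦ.zero, ← hyz]⟩
  have : z.1 ∈ U := huniv ▸ mem_univ _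
  exact this

/-- The Jacobian factor relating the second coordinate of a chart to the determinant against `X`. -/
lemma cross_eq (h : FlowChart X V ψ L lam) {x : ℝ × ℝ} (hx : x ∈ V) (ξ : ℝ × ℝ) :
    cross (X x) ξ = (fderiv ℝ ψ x ξ).2 * cross (X x) (fderiv ℝ L (ψ x) (0, 1)) := by
  have h1 := h.fderiv_apply_symm hx ξ
  set p := fderiv ℝ ψ x ξ with hp
  have h2 : p = p.1 • ((1, 0) : ℝ × ℝ) + p.2 • ((0, 1) : ℝ × ℝ) := by ext <;> simp
  rw [h2, map_add, map_smul, map_smul, h.fderiv_symm, h.right x hx] at h1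
  rw [← h1]
  simp [cross]; ring

/-- A flow chart either preserves or reverses the orientation. -/
lemma jacobian_pos_or_neg (hX : LineField X) (h : FlowChart X V ψ L lam) :
    (∀ y, 0 < cross (X (L y)) (fderiv ℝ L y (0, 1))) ∨
      ∀ y, cross (X (L y)) (fderiv ℝ L y (0, 1)) < 0 := by
  have hc : Continuous fun y => cross (X (L y)) (fderiv ℝ L y (0, 1)) :=
    continuous_cross (hX.continuous.comp h.contDiff.continuous)
      ((h.contDiff.continuous_fderiv (by norm_num)).clm_apply continuous_const)
  have hne : ∀ y, cross (X (L y)) (fderiv ℝ L y (0, 1)) ≠ 0 := by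
    intro y h0
    have h1 := h.cross_eq (h.mapsTo y) (-(X (L y)).2, (X (L y)).1)
    rw [h.left, h0, mul_zero] at h1
    have h2 := hX.unit (L y)
    unfold cross at h1
    simp only at h1
    nlinarith
  have hpre : IsPreconnected (range fun y => cross (X (L y)) (fderiv ℝ L y (0, 1))) :=
    isPreconnected_range hc
  by_contra! hcon
  obtain ⟨⟨a, ha⟩, b, hb⟩ := hcon
  obtain ⟨y, hy⟩ := hpre.ordConnected.out (mem_range_self a) (mem_range_self b) ⟨ha, hb⟩
  exact hne y hy

end FlowChart

/-- A `C¹` curve crossing the orbits of `X` transversally, from right to left. -/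
structure TransverseCurve (X : ℝ × ℝ → ℝ × ℝ) (c : ℝ → ℝ × ℝ) : Prop where
  contDiff : ContDiff ℝ 1 c
  cross_pos : ∀ s, 0 < cross (X (c s)) (deriv c s)

lemma TransverseCurve.hasDerivAt {X : ℝ × ℝ → ℝ × ℝ} {c : ℝ → ℝ × ℝ} (hc : TransverseCurve X c)
    (s : ℝ) : HasDerivAt c (deriv c s) s :=
  (hc.contDiff.differentiable (by norm_num) s).hasDerivAt

/-- `w` is a `C¹` first integral of `X` near the point `Φ r₀ (c s₀)`: it gives the parameter of the
point of the curve `c` where the orbit comes from. Its differential is a positive multiple of the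
determinant against `X`. -/
structure IsFirstIntegralAt (X : ℝ × ℝ → ℝ × ℝ) (Φ : ℝ → ℝ × ℝ → ℝ × ℝ) (c : ℝ → ℝ × ℝ)
    (s₀ r₀ : ℝ) (w : ℝ × ℝ → ℝ) : Prop where
  contDiffAt : ContDiffAt ℝ 1 w (Φ r₀ (c s₀))
  fderiv_eq : ∃ κ > 0, ∀ ξ,
    fderiv ℝ w (Φ r₀ (c s₀)) ξ = κ * cross (X (Φ r₀ (c s₀))) ξ
  apply_flow : ∀ᶠ p : ℝ × ℝ in 𝓝 (s₀, r₀), w (Φ p.2 (c p.1)) = p.1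
  flow_apply : ∀ η > 0, ∀ᶠ x in 𝓝 (Φ r₀ (c s₀)), ∃ r, |r - r₀| < η ∧ Φ r (c (w x)) = x

section
variable {X : ℝ × ℝ → ℝ × ℝ} {Φ : ℝ → ℝ × ℝ → ℝ × ℝ} {c : ℝ → ℝ × ℝ}

/-- Near the curve itself, the first integral is the second coordinate of a flow chart,
reparametrized by the curve. -/
lemma exists_firstIntegral_zero (hX : LineField X) (hΦ : IsFlowOf X Φ) (hc : TransverseCurve X c)
    (s₀ : ℝ) : ∃ w, IsFirstIntegralAt X Φ c s₀ 0 w := by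
  obtain ⟨V, ψ, L, lam, hV, h⟩ := hX.chart (c s₀)
  have hcc := hc.contDiff.continuous
  set j := cross (X (c s₀)) (fderiv ℝ L (ψ (c s₀)) (0, 1)) with hj
  let m : ℝ → ℝ := fun s => (ψ (c s)).2
  have hcross : 0 < cross (X (c s₀)) (deriv c s₀) := hc.cross_pos s₀
  have hce := h.cross_eq hV (deriv c s₀)
  set m' := (fderiv ℝ ψ (c s₀) (deriv c s₀)).2 with hm'
  rw [← hj] at hce
  have hm0 : m' ≠ 0 := by rintro h0; rw [h0, zero_mul] at hce; linarith
  have hj0 : j ≠ 0 := by rintro h0; rw [h0, mul_zero] at hce; linarith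
  have hψ2 : ContDiffAt ℝ 1 (fun z => (ψ z).2) (c s₀) :=
    h.contDiffOn_snd.contDiffAt (h.isOpen.mem_nhds hV)
  have hmC : ContDiffAt ℝ 1 m s₀ := hψ2.comp s₀ hc.contDiff.contDiffAt
  have hmd : HasDerivAt m m' s₀ := by
    have := (h.hasFDerivAt_snd hV).comp_hasDerivAt s₀ (hc.hasDerivAt s₀)
    exact this
  have hmd' : HasFDerivAt m
      ((ContinuousLinearEquiv.unitsEquivAut ℝ (Units.mk0 m' hm0) : ℝ ≃L[ℝ] ℝ) : ℝ →L[ℝ] ℝ) s₀ := by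
    refine hmd.hasFDerivAt.congr_fderiv ?_
    ext; simp
  let e := hmC.toOpenPartialHomeomorph m hmd' (by norm_num)
  have hes : s₀ ∈ e.source := hmC.mem_toOpenPartialHomeomorph_source hmd' (by norm_num)
  have hem : ∀ s, e s = m s := fun s => rfl
  have hms : m s₀ ∈ e.target := e.map_source hes
  have hsymm : e.symm (m s₀) = s₀ := e.left_inv hes
  have hinvC : ContDiffAt ℝ 1 e.symm (m s₀) := hmC.to_localInverse hmd' (by norm_num)
  have hinvd : HasDerivAt e.symm m'⁻¹ (m s₀) :=
    e.hasDerivAt_symm hms hm0 (by rw [hsymm]; exact hmd)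
  let w : ℝ × ℝ → ℝ := fun x => e.symm ((ψ x).2)
  have hwd : HasFDerivAt w (m'⁻¹ • ((ContinuousLinearMap.snd ℝ ℝ ℝ).comp (fderiv ℝ ψ (c s₀))))
      (c s₀) := hinvd.comp_hasFDerivAt (c s₀) (h.hasFDerivAt_snd hV)
  have hwC : ContDiffAt ℝ 1 w (c s₀) := ContDiffAt.comp (c s₀) hinvC hψ2
  have hwc : ContinuousAt w (c s₀) := hwC.continuousAt
  have hw0 : w (c s₀) = s₀ := hsymm
  refine ⟨w, ?_, ?_, ?_, ?_⟩
  · rw [hΦ.zero]; exact hwC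
  · rw [hΦ.zero]
    refine ⟨(cross (X (c s₀)) (deriv c s₀))⁻¹, inv_pos.2 hcross, fun ξ => ?_⟩
    rw [hwd.fderiv, hce, h.cross_eq hV ξ, ← hj]
    simp only [smul_apply, ContinuousLinearMap.comp_apply, ContinuousLinearMap.coe_snd',
      smul_eq_mul]
    field_simp
  · have hcont : ContinuousAt (fun p : ℝ × ℝ => Φ p.2 (c p.1)) (s₀, 0) :=
      (hΦ.continuous_apply continuous_snd (hcc.comp continuous_fst)).continuousAt
    have e1 : ∀ᶠ p : ℝ × ℝ in 𝓝 (s₀, 0), Φ p.2 (c p.1) ∈ V := by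
      apply hcont.eventually
      simp only [hΦ.zero]
      exact h.isOpen.mem_nhds hV
    obtain ⟨ε, hε, hball⟩ := Metric.eventually_nhds_iff_ball.1 e1
    have e2 : ∀ᶠ p : ℝ × ℝ in 𝓝 (s₀, 0), p.1 ∈ e.source :=
      continuousAt_fst.eventually (e.open_source.mem_nhds hes)
    filter_upwards [Metric.ball_mem_nhds ((s₀, 0) : ℝ × ℝ) hε, e2] with p hp hp2
    rw [Metric.mem_ball, Prod.dist_eq, max_lt_iff] at hp
    have hp1 := hp.2
    rw [Real.dist_eq, sub_zero] at hp1
    have := h.snd_flow hΦ (x := c p.1) (a := -ε) (b := ε) (s := 0) (t := p.2) (fun r hr => ?_)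
      ⟨by linarith, hε⟩ (abs_lt.1 hp1)
    · rw [hΦ.zero] at this
      show e.symm ((ψ (Φ p.2 (c p.1))).2) = p.1
      rw [this]
      exact e.left_inv hp2
    · apply hball (p.1, r)
      rw [Metric.mem_ball, Prod.dist_eq, max_lt_iff]
      refine ⟨hp.1, ?_⟩
      rw [Real.dist_eq, sub_zero]
      exact abs_lt.2 hr
  · intro η hη
    rw [hΦ.zero]
    obtain ⟨N, hN, hNf⟩ := h.exists_flow_eq hΦ hV hη
    have e1 : ∀ᶠ x in 𝓝 (c s₀), c (w x) ∈ N := by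
      have : ContinuousAt (fun x => c (w x)) (c s₀) := hcc.continuousAt.comp hwc
      apply this.eventually
      simp only [hw0]
      exact hN
    have e2 : ∀ᶠ x in 𝓝 (c s₀), (ψ x).2 ∈ e.target :=
      hψ2.continuousAt.eventually (e.open_target.mem_nhds hms)
    filter_upwards [hN, e1, e2] with x hx hx1 hx2
    obtain ⟨t, ht, hxt⟩ := hNf _ hx1 _ hx (e.right_inv hx2)
    exact ⟨t, by simpa using ht, hxt⟩

/-- A first integral propagates along the orbit through a chart: it is a function of the second
coordinate of the chart. -/
lemma IsFirstIntegralAt.transport (hX : LineField X) (hΦ : IsFlowOf X Φ) (hc : Continuous c)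
    {V : Set (ℝ × ℝ)} {ψ L : ℝ × ℝ → ℝ × ℝ} {lam : ℝ × ℝ → ℝ} (h : FlowChart X V ψ L lam)
    {s₀ r₁ ε : ℝ} (hε : 0 < ε) (hV : ∀ s r, |s - s₀| < ε → |r - r₁| < ε → Φ r (c s) ∈ V)
    {r r' : ℝ} (hr : |r - r₁| < ε) (hr' : |r' - r₁| < ε) {w : ℝ × ℝ → ℝ}
    (hw : IsFirstIntegralAt X Φ c s₀ r w) : ∃ w', IsFirstIntegralAt X Φ c s₀ r' w' := by
  obtain ⟨hwC, ⟨κ, hκ, hwd⟩, hw1, hw2⟩ := hw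
  set q := Φ r (c s₀) with hq
  set q' := Φ r' (c s₀) with hq'
  have hs₀ : |s₀ - s₀| < ε := by simpa using hε
  have hqV : q ∈ V := hV s₀ r hs₀ hr
  have hqV' : q' ∈ V := hV s₀ r' hs₀ hr'
  have hsnd : ∀ s ρ ρ', |s - s₀| < ε → |ρ - r₁| < ε → |ρ' - r₁| < ε →
      (ψ (Φ ρ' (c s))).2 = (ψ (Φ ρ (c s))).2 := by
    intro s ρ ρ' hs hρ hρ'
    rw [abs_lt] at hρ hρ'
    refine h.snd_flow hΦ (a := r₁ - ε) (b := r₁ + ε) (fun t ht => hV s t hs ?_)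
      ⟨by linarith, by linarith⟩ ⟨by linarith, by linarith⟩
    rw [abs_lt]; constructor <;> linarith [ht.1, ht.2]
  have hb : (ψ q').2 = (ψ q).2 := hsnd s₀ r r' hs₀ hr hr'
  set a := (ψ q).1 with ha
  have hLq : L (a, (ψ q).2) = q := h.right q hqV
  have hLq' : L (a, (ψ q').2) = q := by rw [hb]; exact hLq
  let w' : ℝ × ℝ → ℝ := fun x => w (L (a, (ψ x).2))
  have hψ2 : ContDiffAt ℝ 1 (fun z => (ψ z).2) q' :=
    h.contDiffOn_snd.contDiffAt (h.isOpen.mem_nhds hqV')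
  have hLC : ContDiffAt ℝ 1 (fun x => L (a, (ψ x).2)) q' :=
    (h.contDiff.contDiffAt (x := (a, (ψ q').2))).comp q' (contDiffAt_const.prodMk hψ2)
  have hLc : ContinuousAt (fun x => L (a, (ψ x).2)) q' := hLC.continuousAt
  have hLt : Filter.Tendsto (fun x => L (a, (ψ x).2)) (𝓝 q') (𝓝 q) := by
    have := hLc.tendsto
    simp only [hLq'] at this
    exact this
  have hwC' : ContDiffAt ℝ 1 w (L (a, (ψ q').2)) := by rw [hLq']; exact hwC
  have hwq : w q = s₀ := hw1.self_of_nhds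
  refine ⟨w', hwC'.comp q' hLC, ?_, ?_, ?_⟩
  · set j := cross (X q) (fderiv ℝ L (ψ q) (0, 1)) with hj
    set j' := cross (X q') (fderiv ℝ L (ψ q') (0, 1)) with hj'
    have hjj : 0 < j / j' := by
      rcases h.jacobian_pos_or_neg hX with hpos | hneg
      · refine div_pos ?_ ?_
        · have := hpos (ψ q); rwa [h.right q hqV] at this
        · have := hpos (ψ q'); rwa [h.right q' hqV'] at this
      · refine div_pos_of_neg_of_neg ?_ ?_
        · have := hneg (ψ q); rwa [h.right q hqV] at this
        · have := hneg (ψ q'); rwa [h.right q' hqV'] at this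
    have hj0' : j' ≠ 0 := by rintro h0; rw [h0, div_zero] at hjj; exact hjj.false
    refine ⟨κ * (j / j'), mul_pos hκ hjj, fun ξ => ?_⟩
    have d1 : HasFDerivAt (fun x : ℝ × ℝ => ((a, (ψ x).2) : ℝ × ℝ))
        ((0 : ℝ × ℝ →L[ℝ] ℝ).prod ((ContinuousLinearMap.snd ℝ ℝ ℝ).comp (fderiv ℝ ψ q'))) q' :=
      (hasFDerivAt_const a q').prodMk (h.hasFDerivAt_snd hqV')
    have d2 : HasFDerivAt L (fderiv ℝ L (ψ q)) (a, (ψ q').2) := by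
      rw [hb]; exact ((h.contDiff.differentiable (by norm_num)) (ψ q)).hasFDerivAt
    have d3 : HasFDerivAt w (fderiv ℝ w q) (L (a, (ψ q').2)) := by
      rw [hLq']; exact (hwC.differentiableAt (by norm_num)).hasFDerivAt
    have d4 : HasFDerivAt w' _ q' := d3.comp q' (d2.comp q' d1)
    rw [d4.fderiv]
    have hξ : ((0 : ℝ × ℝ →L[ℝ] ℝ).prod ((ContinuousLinearMap.snd ℝ ℝ ℝ).comp (fderiv ℝ ψ q'))) ξ
        = (fderiv ℝ ψ q' ξ).2 • ((0, 1) : ℝ × ℝ) := by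
      ext <;> simp
    rw [ContinuousLinearMap.comp_apply, ContinuousLinearMap.comp_apply, hξ, map_smul, map_smul, hwd,
      h.cross_eq hqV' ξ, ← hj, ← hj', smul_eq_mul]
    field_simp
  · -- both `L (a, _)` and `Φ r (c s)` are close to `q` and on the same horizontal line
    obtain ⟨ε₁, hε₁, hball⟩ := Metric.eventually_nhds_iff_ball.1 hw1
    obtain ⟨N, hN, hNf⟩ := h.exists_flow_eq hΦ hqV hε₁
    have hcont : ContinuousAt (fun p : ℝ × ℝ => Φ p.2 (c p.1)) (s₀, r') :=
      (hΦ.continuous_apply continuous_snd (hc.comp continuous_fst)).continuousAt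
    have hcont' : ContinuousAt (fun p : ℝ × ℝ => Φ r (c p.1)) (s₀, r') :=
      (hΦ.continuous_apply continuous_const (hc.comp continuous_fst)).continuousAt
    have e1 : ∀ᶠ p : ℝ × ℝ in 𝓝 (s₀, r'), L (a, (ψ (Φ p.2 (c p.1))).2) ∈ N :=
      hcont.eventually (hLt.eventually hN)
    have e2 : ∀ᶠ p : ℝ × ℝ in 𝓝 (s₀, r'), Φ r (c p.1) ∈ N := hcont'.eventually hN
    have e3 : ∀ᶠ p : ℝ × ℝ in 𝓝 (s₀, r'), |p.1 - s₀| < min ε ε₁ :=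
      ContinuousAt.eventually_lt (f := fun p : ℝ × ℝ => |p.1 - s₀|) (by fun_prop)
        continuousAt_const (by simpa using ⟨hε, hε₁⟩)
    have e4 : ∀ᶠ p : ℝ × ℝ in 𝓝 (s₀, r'), |p.2 - r₁| < ε :=
      ContinuousAt.eventually_lt (f := fun p : ℝ × ℝ => |p.2 - r₁|) (by fun_prop)
        continuousAt_const hr'
    filter_upwards [e1, e2, e3, e4] with p h1 h2 h3 h4
    rw [lt_min_iff] at h3
    obtain ⟨t, ht, hte⟩ := hNf _ h2 _ h1 (by
      rw [h.left]; exact hsnd p.1 p.2 r h3.1 h4 hr)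
    show w (L (a, (ψ (Φ p.2 (c p.1))).2)) = p.1
    rw [← hte, ← hΦ.add]
    apply hball (p.1, t + r)
    rw [Metric.mem_ball, Prod.dist_eq, max_lt_iff]
    refine ⟨h3.2, ?_⟩
    rw [Real.dist_eq]; simpa using ht
  · intro η hη
    obtain ⟨N, hN, hNf⟩ := h.exists_flow_eq hΦ hqV' (half_pos hη)
    rw [abs_lt] at hr hr'
    -- a time change small enough to stay in the chart, both before and after the shift
    obtain ⟨δ, hδ, hδ1, hδ2⟩ : ∃ δ > 0, (∀ ρ, |ρ - r| < δ → |ρ - r₁| < ε) ∧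
        ∀ ρ, |ρ - r| < δ → |ρ + (r' - r) - r₁| < ε := by
      refine ⟨min (min (r - (r₁ - ε)) (r₁ + ε - r)) (min (r' - (r₁ - ε)) (r₁ + ε - r')), ?_, ?_, ?_⟩
      · refine lt_min (lt_min ?_ ?_) (lt_min ?_ ?_) <;> linarith
      · intro ρ hρ
        obtain ⟨h1, h2⟩ := lt_min_iff.1 (lt_min_iff.1 hρ).1
        rw [abs_lt]; constructor <;> linarith [(abs_lt.1 h1).1, (abs_lt.1 h2).2]
      · intro ρ hρ
        obtain ⟨h1, h2⟩ := lt_min_iff.1 (lt_min_iff.1 hρ).2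
        rw [abs_lt]; constructor <;> linarith [(abs_lt.1 h1).1, (abs_lt.1 h2).2]
    have e1 := hLt.eventually (hw2 (min δ (η / 2)) (lt_min hδ (half_pos hη)))
    have hcw : ContinuousAt w' q' := (hwC'.comp q' hLC).continuousAt
    have e2 : ∀ᶠ x in 𝓝 q', |w' x - s₀| < ε := by
      refine ContinuousAt.eventually_lt (f := fun x => |w' x - s₀|) ?_ continuousAt_const ?_
      · exact (hcw.sub continuousAt_const).abs
      · show |w (L (a, (ψ q').2)) - s₀| < ε
        rw [hLq', hwq]; exact hs₀
    have e3 : ∀ᶠ x in 𝓝 q', Φ (r' - r) (L (a, (ψ x).2)) ∈ N := by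
      have : Filter.Tendsto (fun x => Φ (r' - r) (L (a, (ψ x).2))) (𝓝 q') (𝓝 (Φ (r' - r) q)) :=
        (hΦ.continuous_apply continuous_const continuous_id).continuousAt.tendsto.comp hLt
      apply this.eventually
      rw [hq, ← hΦ.add, sub_add_cancel]
      exact hN
    filter_upwards [e1, e2, e3, hN] with x h1 h2 h3 h4
    obtain ⟨ρ, hρ, hρe⟩ := h1
    rw [lt_min_iff] at hρ
    have hfe : Φ (r' - r) (L (a, (ψ x).2)) = Φ (ρ + (r' - r)) (c (w' x)) := by
      rw [← hρe, ← hΦ.add, add_comm]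
    obtain ⟨t, ht, hte⟩ := hNf _ h3 _ h4 (by
      rw [hfe, hsnd _ ρ _ h2 (hδ1 ρ hρ.1) (hδ2 ρ hρ.1), hρe, h.left])
    refine ⟨t + (ρ + (r' - r)), ?_, by rw [hΦ.add, ← hfe, hte]⟩
    have : t + (ρ + (r' - r)) - r' = t + (ρ - r) := by ring
    rw [this]
    linarith [abs_add_le t (ρ - r), hρ.2]

/-- Around every point of the orbit of a point of a transverse curve, the parameter of the curve
is a `C¹` first integral. -/
lemma exists_firstIntegral (hX : LineField X) (hΦ : IsFlowOf X Φ) (hc : TransverseCurve X c)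
    (s₀ r₀ : ℝ) : ∃ w, IsFirstIntegralAt X Φ c s₀ r₀ w := by
  -- the times for which a first integral exists form an open and closed set
  let U : Set ℝ := {r | ∃ w, IsFirstIntegralAt X Φ c s₀ r w}
  have hcc := hc.contDiff.continuous
  have hloc : ∀ r₁ : ℝ, ∃ N ∈ 𝓝 r₁, ∀ r ∈ N, ∀ r' ∈ N, r ∈ U → r' ∈ U := by
    intro r₁
    obtain ⟨V, ψ, L, lam, hV, h⟩ := hX.chart (Φ r₁ (c s₀))
    have hcont : ContinuousAt (fun p : ℝ × ℝ => Φ p.2 (c p.1)) (s₀, r₁) :=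
      (hΦ.continuous_apply continuous_snd (hcc.comp continuous_fst)).continuousAt
    obtain ⟨ε, hε, hball⟩ := Metric.eventually_nhds_iff_ball.1
      (hcont.eventually (h.isOpen.mem_nhds hV))
    refine ⟨Metric.ball r₁ ε, Metric.ball_mem_nhds _ hε, ?_⟩
    rintro r hr r' hr' ⟨w, hw⟩
    refine hw.transport hX hΦ hcc h hε (fun s ρ hs hρ => ?_) hr hr'
    apply hball (s, ρ)
    rw [Metric.mem_ball, Prod.dist_eq, max_lt_iff]
    exact ⟨hs, hρ⟩
  have hcl : IsClopen U := by
    refine ⟨⟨isOpen_iff_mem_nhds.2 fun u hu => ?_⟩, isOpen_iff_mem_nhds.2 fun u hu => ?_⟩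
    · obtain ⟨N, hN, hN'⟩ := hloc u
      filter_upwards [hN] with u' hu' hmem
      exact hu (hN' _ hu' _ (mem_of_mem_nhds hN) hmem)
    · obtain ⟨N, hN, hN'⟩ := hloc u
      filter_upwards [hN] with u' hu'
      exact hN' _ (mem_of_mem_nhds hN) _ hu' hu
  have huniv := hcl.eq_univ ⟨0, exists_firstIntegral_zero hX hΦ hc s₀⟩
  have : r₀ ∈ U := huniv ▸ mem_univ _
  exact this

end

/-! ### First return to a global section -/

/-- The union of all lattice translates of the curve `c`. -/
def translates (c : ℝ → ℝ × ℝ) : Set (ℝ × ℝ) := {x | ∃ s n, x = c s + latt n}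

lemma curve_add_intCast {c : ℝ → ℝ × ℝ} {v : ℤ × ℤ} (h : ∀ s, c (s + 1) = c s + latt v) (s : ℝ)
    (j : ℤ) : c (s + j) = c s + latt (j • v) := by
  induction j using Int.induction_on with
  | zero => simp
  | succ i ih =>
    push_cast at ih ⊢
    rw [← add_assoc, h, ih, add_smul, one_smul, map_add, add_assoc]
  | pred i ih =>
    push_cast at ih ⊢
    have := h (s + (-i - 1))
    have e : s + (-(i : ℝ) - 1) + 1 = s + -i := by ring
    rw [e, ih] at this
    rw [sub_smul, one_smul, map_sub, ← add_sub_assoc, ← add_sub_assoc, this]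
    rw [add_sub_assoc, add_sub_cancel_right]

/-- The lift `c` of a simple closed curve of the torus is a global section of the flow `Φ` of the
line field spanned by `X`: it is transverse to `X`, and every orbit meets one of its translates. -/
structure GlobalSection (X : ℝ × ℝ → ℝ × ℝ) (Φ : ℝ → ℝ × ℝ → ℝ × ℝ) (c : ℝ → ℝ × ℝ) (v : ℤ × ℤ) :
    Prop where
  lineField : LineField X
  flow : IsFlowOf X Φ
  curve : TransverseCurve X c
  period : ∀ s, c (s + 1) = c s + latt v
  simple : ∀ s s' n, c s = c s' + latt n → ∃ j : ℤ, s = s' + j ∧ n = j • v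
  complete : ∀ x, ∃ t, Φ t x ∈ translates c

namespace GlobalSection
variable {X : ℝ × ℝ → ℝ × ℝ} {Φ : ℝ → ℝ × ℝ → ℝ × ℝ} {c : ℝ → ℝ × ℝ} {v : ℤ × ℤ}

lemma continuous_curve (h : GlobalSection X Φ c v) : Continuous c := h.curve.contDiff.continuous

lemma period_int (h : GlobalSection X Φ c v) (s : ℝ) (j : ℤ) : c (s + j) = c s + latt (j • v) :=
  curve_add_intCast h.period s j

lemma add_latt_mem_translates {x : ℝ × ℝ} (n : ℤ × ℤ) (hx : x ∈ translates c) :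
    x + latt n ∈ translates c := by
  obtain ⟨s, m, rfl⟩ := hx
  exact ⟨s, m + n, by rw [map_add, add_assoc]⟩

lemma add_latt_mem_translates_iff {x : ℝ × ℝ} {n : ℤ × ℤ} :
    x + latt n ∈ translates c ↔ x ∈ translates c := by
  refine ⟨fun hx => ?_, add_latt_mem_translates n⟩
  have := add_latt_mem_translates (-n) hx
  rwa [map_neg, add_neg_cancel_right] at this

/-- The translates of a compact piece of the curve form a closed set. -/
lemma isClosed_translates_image (h : GlobalSection X Φ c v) {K : Set ℝ} (hK : IsCompact K) :
    IsClosed {x | ∃ s ∈ K, ∃ n, x = c s + latt n} := by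
  have h1 : IsClosed ((fun s => proj (c s)) '' K) :=
    (hK.image (continuous_proj.comp h.continuous_curve)).isClosed
  convert h1.preimage continuous_proj using 1
  ext x
  simp only [mem_ofPred_eq, mem_preimage, mem_image]
  refine exists_congr fun s => and_congr_right fun _ => ?_
  rw [eq_comm (a := proj (c s)), proj_eq_proj_iff]

/-- Every point of the translates of `c` is on a translate of the arc with parameters within `1 / 2`
of `a`. -/
lemma exists_near (h : GlobalSection X Φ c v) (a s : ℝ) (n : ℤ × ℤ) :
    ∃ s' ∈ Icc (a - 1 / 2) (a + 1 / 2), ∃ m, c s + latt n = c s' + latt m := by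
  refine ⟨s - round (s - a), ?_, n + round (s - a) • v, ?_⟩
  · have := abs_sub_round (s - a)
    rw [abs_le] at this
    constructor <;> linarith [this.1, this.2]
  · have := h.period_int (s - round (s - a)) (round (s - a))
    rw [sub_add_cancel] at this
    rw [this, map_add]; abel

lemma isClosed_translates (h : GlobalSection X Φ c v) : IsClosed (translates c) := by
  convert h.isClosed_translates_image (isCompact_Icc (a := (0 : ℝ) - 1 / 2) (b := 0 + 1 / 2)) using 1
  ext x
  constructor
  · rintro ⟨s, n, rfl⟩; exact h.exists_near 0 s n
  · rintro ⟨s, -, n, rfl⟩; exact ⟨s, n, rfl⟩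

/-- Near a point of `c`, the only translate of `c` is `c` itself, near the given parameter. -/
lemma eventually_mem_translates (h : GlobalSection X Φ c v) (s₀ : ℝ) {η : ℝ} (hη : 0 < η) :
    ∀ᶠ x in 𝓝 (c s₀), x ∈ translates c → ∃ s, |s - s₀| < η ∧ x = c s := by
  obtain ⟨δ, hδ, hδc⟩ := Metric.continuousAt_iff.1 (h.continuous_curve.continuousAt (x := s₀))
    (1 / 2) (by norm_num : (0 : ℝ) < 1 / 2)
  set ε := min η δ with hε
  have hε0 : 0 < ε := lt_min hη hδ
  have hcl := h.isClosed_translates_image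
    ((isCompact_Icc (a := s₀ - 1 / 2) (b := s₀ + 1 / 2)).diff (isOpen_Ioo (a := s₀ - ε)
      (b := s₀ + ε)))
  have hnot : c s₀ ∉ {x | ∃ s ∈ Icc (s₀ - 1 / 2) (s₀ + 1 / 2) \ Ioo (s₀ - ε) (s₀ + ε),
      ∃ n, x = c s + latt n} := by
    rintro ⟨s, ⟨hs1, hs2⟩, n, hn⟩
    obtain ⟨j, hj, -⟩ := h.simple _ _ _ hn
    have hj0 : j = 0 := by
      have h1 : ((j : ℤ) : ℝ) < 1 := by linarith [hs1.1, hs1.2]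
      have h2 : (-1 : ℝ) < j := by linarith [hs1.1, hs1.2]
      have h1' : j < 1 := by exact_mod_cast h1
      have h2' : -1 < j := by exact_mod_cast h2
      omega
    rw [hj0, Int.cast_zero, add_zero] at hj
    apply hs2
    rw [← hj]
    exact ⟨by linarith, by linarith⟩
  have e1 := hcl.isOpen_compl.mem_nhds hnot
  have e2 := Metric.ball_mem_nhds (c s₀) (by norm_num : (0 : ℝ) < 1 / 2)
  filter_upwards [e1, e2] with x hx1 hx2 hx
  obtain ⟨s, n, rfl⟩ := hx
  obtain ⟨s', hs', m, hm⟩ := h.exists_near s₀ s n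
  have hs'' : s' ∈ Ioo (s₀ - ε) (s₀ + ε) := by
    by_contra hcon
    exact hx1 ⟨s', ⟨hs', hcon⟩, m, hm⟩
  have habs : |s' - s₀| < ε := by rw [abs_lt]; constructor <;> linarith [hs''.1, hs''.2]
  refine ⟨s', habs.trans_le (min_le_left _ _), ?_⟩
  have hd := hδc (x := s') (by rw [Real.dist_eq]; exact habs.trans_le (min_le_right _ _))
  rw [hm] at hx2 ⊢
  have hm0 : m = 0 := by
    apply latt_eq_zero_of_norm_lt
    rw [Metric.mem_ball, dist_eq_norm] at hx2
    rw [dist_eq_norm] at hd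
    calc ‖latt m‖ = ‖(c s' + latt m - c s₀) - (c s' - c s₀)‖ := by congr 1; abel
      _ ≤ ‖c s' + latt m - c s₀‖ + ‖c s' - c s₀‖ := norm_sub_le _ _
      _ < 1 := by linarith
  rw [hm0, map_zero, add_zero]

/-- The orientation character of the line field. -/
lemma exists_sign (h : GlobalSection X Φ c v) (n : ℤ × ℤ) :
    ∃ σ : ℝ, (σ = 1 ∨ σ = -1) ∧ (∀ x, X (x + latt n) = σ • X x) ∧
      ∀ t x, Φ t (x + latt n) = Φ (σ * t) x + latt n := by
  obtain ⟨σ, hσ, hσX⟩ := h.lineField.period n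
  exact ⟨σ, hσ, hσX, h.flow.translate h.lineField hσ hσX⟩

lemma flow_translate (h : GlobalSection X Φ c v) {n : ℤ × ℤ} (hn : ∀ x, X (x + latt n) = X x)
    (t : ℝ) (x : ℝ × ℝ) : Φ t (x + latt n) = Φ t x + latt n := by
  have := h.flow.translate h.lineField (Or.inl rfl) (n := n) (by simpa using hn) t x
  rwa [one_mul] at this

/-- The deck transformation `v` preserves the curve with its orientation and maps `X` to `± X`;
since the curve crosses `X` positively, the sign is `+`. -/
lemma field_period (h : GlobalSection X Φ c v) (x : ℝ × ℝ) : X (x + latt v) = X x := by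
  obtain ⟨σ, hσ, hσX, -⟩ := h.exists_sign v
  rcases hσ with rfl | rfl
  · rw [hσX, one_smul]
  · exfalso
    have h1 : HasDerivAt (fun s => c (s + 1)) (deriv c 1) 0 := by
      have := (h.curve.hasDerivAt (0 + 1)).comp_add_const 0 1
      rwa [zero_add] at this
    have h2 : HasDerivAt (fun s => c (s + 1)) (deriv c 0) 0 := by
      have := (h.curve.hasDerivAt 0).add_const (latt v)
      exact this.congr_of_eventuallyEq (Filter.Eventually.of_forall fun s => h.period s)
    have h3 := h1.unique h2
    have p0 := h.curve.cross_pos 0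
    have p1 := h.curve.cross_pos 1
    have hc1 : c 1 = c 0 + latt v := by simpa using h.period 0
    rw [h3, hc1, hσX, cross_smul_left] at p1
    linarith

/-- Crossing a translate of `c` is an open condition. -/
lemma hit_near (h : GlobalSection X Φ c v) {x₀ : ℝ × ℝ} {t s₀ : ℝ} {n : ℤ × ℤ}
    (hx : Φ t x₀ = c s₀ + latt n) {η : ℝ} (hη : 0 < η) :
    ∀ᶠ x in 𝓝 x₀, ∃ t' s, |t' - t| < η ∧ |s - s₀| < η ∧ Φ t' x = c s + latt n := by
  obtain ⟨w, hw⟩ := exists_firstIntegral_zero h.lineField h.flow h.curve s₀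
  have hw1 := hw.flow_apply η hη
  have hwc := hw.contDiffAt.continuousAt
  have hws : w (c s₀) = s₀ := by have := hw.apply_flow.self_of_nhds; rwa [h.flow.zero] at this
  rw [h.flow.zero] at hw1 hwc
  obtain ⟨σ, hσ, -, hσΦ⟩ := h.exists_sign n
  have hσσ : σ * σ = 1 := by rcases hσ with rfl | rfl <;> norm_num
  have hσa : |σ| = 1 := by rcases hσ with rfl | rfl <;> simp
  have hcont : Filter.Tendsto (fun x => Φ t x - latt n) (𝓝 x₀) (𝓝 (c s₀)) := by
    have : Continuous fun x => Φ t x - latt n :=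
      (h.flow.continuous_apply continuous_const continuous_id).sub continuous_const
    have := this.tendsto x₀
    rwa [hx, add_sub_cancel_right] at this
  have e2 : ∀ᶠ y in 𝓝 (c s₀), |w y - s₀| < η := by
    have := Metric.continuousAt_iff'.1 hwc η hη
    rwa [hws] at this
  filter_upwards [hcont.eventually hw1, hcont.eventually e2] with x h1 h2
  obtain ⟨r, hr, hre⟩ := h1
  refine ⟨-(σ * r) + t, w (Φ t x - latt n), ?_, h2, ?_⟩
  · rw [sub_zero] at hr
    rw [add_sub_cancel_right, abs_neg, abs_mul, hσa, one_mul]; exact hr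
  · rw [h.flow.add]
    have : Φ t x = (Φ t x - latt n) + latt n := by rw [sub_add_cancel]
    conv_lhs => rw [this]
    rw [hσΦ]
    have e : σ * -(σ * r) = -r := by linear_combination (-r) * hσσ
    rw [e, (h.flow.eq_iff.1 hre).symm]

/-- Orbits starting on the curve do not return to its translates before a definite time. -/
lemma exists_return_time (h : GlobalSection X Φ c v) :
    ∃ δ > 0, ∀ s r, 0 < |r| → |r| < δ → Φ r (c s) ∉ translates c := by
  let P : Set ℝ → Prop := fun A => ∃ δ > 0, ∀ s ∈ A, ∀ r, 0 < |r| → |r| < δ →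
    Φ r (c s) ∉ translates c
  have hP : P (Icc 0 1) := by
    refine isCompact_Icc.induction_on (p := P) ⟨1, one_pos, by simp⟩ ?_ ?_ ?_
    · rintro A B hAB ⟨δ, hδ, hB⟩
      exact ⟨δ, hδ, fun s hs => hB s (hAB hs)⟩
    · rintro A B ⟨δ, hδ, hA⟩ ⟨δ', hδ', hB⟩
      refine ⟨min δ δ', lt_min hδ hδ', ?_⟩
      rintro s (hs | hs) r hr0 hr
      · exact hA s hs r hr0 (hr.trans_le (min_le_left _ _))
      · exact hB s hs r hr0 (hr.trans_le (min_le_right _ _))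
    · intro s₀ _
      obtain ⟨w, hw⟩ := exists_firstIntegral_zero h.lineField h.flow h.curve s₀
      have hw1 := hw.apply_flow
      obtain ⟨V, ψ, L, lam, hV, hch⟩ := h.lineField.chart (c s₀)
      have hcont : Filter.Tendsto (fun p : ℝ × ℝ => Φ p.2 (c p.1)) (𝓝 (s₀, 0)) (𝓝 (c s₀)) := by
        have : Continuous fun p : ℝ × ℝ => Φ p.2 (c p.1) :=
          h.flow.continuous_apply continuous_snd (h.continuous_curve.comp continuous_fst)
        have := this.tendsto (s₀, 0)
        simpa only [h.flow.zero] using this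
      obtain ⟨ε, hε, hball⟩ := Metric.eventually_nhds_iff_ball.1
        (hw1.and (hcont.eventually (hch.isOpen.mem_nhds hV)))
      have e2 := hcont.eventually (h.eventually_mem_translates s₀ hε)
      obtain ⟨ε', hε', hball'⟩ := Metric.eventually_nhds_iff_ball.1 e2
      have hm : 0 < min ε ε' := lt_min hε hε'
      refine ⟨Metric.ball s₀ (min ε ε'), mem_nhdsWithin_of_mem_nhds (Metric.ball_mem_nhds _ hm),
        min ε ε', hm, fun s hs r hr0 hr hmem => ?_⟩
      rw [Metric.mem_ball, lt_min_iff] at hs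
      rw [lt_min_iff] at hr
      have hin : ∀ ρ : ℝ, |ρ| < ε → (s, ρ) ∈ Metric.ball ((s₀, 0) : ℝ × ℝ) ε := by
        intro ρ hρ
        rw [Metric.mem_ball, Prod.dist_eq, max_lt_iff]
        exact ⟨hs.1, by rw [Real.dist_eq, sub_zero]; exact hρ⟩
      have hin' : (s, r) ∈ Metric.ball ((s₀, 0) : ℝ × ℝ) ε' := by
        rw [Metric.mem_ball, Prod.dist_eq, max_lt_iff]
        exact ⟨hs.2, by rw [Real.dist_eq, sub_zero]; exact hr.2⟩
      obtain ⟨s', hs', hs'e⟩ := hball' _ hin' hmem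
      simp only at hs'e
      -- the first integral shows that the orbit comes back to the same point
      have f1 := (hball _ (hin r hr.1)).1
      have f2 := (hball (s', 0) (by
        rw [Metric.mem_ball, Prod.dist_eq, max_lt_iff]
        exact ⟨hs', by simpa using hε⟩)).1
      simp only [h.flow.zero] at f1 f2
      rw [hs'e, f2] at f1
      rw [f1] at hs'e
      have f3 := hch.straighten_solution (fun t _ => h.flow.hasDerivAt (c s) t)
        (fun t ht => (hball _ (hin t (abs_lt.2 ht))).2) (a := -ε) (b := ε) (s := 0) (t := r)
        ⟨by linarith, hε⟩ (abs_lt.1 hr.1)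
      rw [hs'e, h.flow.zero] at f3
      have f4 := congrArg Prod.fst f3
      simp only [Prod.fst_add, sub_zero] at f4
      have : r = 0 := by linarith
      rw [this, abs_zero] at hr0
      exact hr0.false
  obtain ⟨δ, hδ, hδP⟩ := hP
  refine ⟨δ, hδ, fun s r hr0 hr hmem => ?_⟩
  have hs := h.period_int (Int.fract s) ⌊s⌋
  rw [Int.fract_add_floor] at hs
  obtain ⟨σ, hσ, -, hσΦ⟩ := h.exists_sign (⌊s⌋ • v)
  have hσa : |σ| = 1 := by rcases hσ with rfl | rfl <;> simp
  rw [hs, hσΦ, add_latt_mem_translates_iff] at hmem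
  refine hδP (Int.fract s) ⟨Int.fract_nonneg s, (Int.fract_lt_one s).le⟩ (σ * r) ?_ ?_ hmem
  · rwa [abs_mul, hσa, one_mul]
  · rwa [abs_mul, hσa, one_mul]

/-- Every orbit crosses the translates of `c` in forward time. -/
lemma exists_forward_hit (h : GlobalSection X Φ c v) (x : ℝ × ℝ) :
    ∃ t > 0, Φ t x ∈ translates c := by
  let P : Set (ℝ × ℝ) → Prop := fun A => ∃ M > 0, ∀ x ∈ A, ∃ t, |t| < M ∧ Φ t x ∈ translates c
  have hP : P (Icc 0 1) := by
    refine isCompact_Icc.induction_on (p := P) ⟨1, one_pos, by simp⟩ ?_ ?_ ?_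
    · rintro A B hAB ⟨M, hM, hB⟩
      exact ⟨M, hM, fun s hs => hB s (hAB hs)⟩
    · rintro A B ⟨M, hM, hA⟩ ⟨M', hM', hB⟩
      refine ⟨max M M', lt_max_of_lt_left hM, ?_⟩
      rintro s (hs | hs)
      · obtain ⟨t, ht, hts⟩ := hA s hs
        exact ⟨t, ht.trans_le (le_max_left _ _), hts⟩
      · obtain ⟨t, ht, hts⟩ := hB s hs
        exact ⟨t, ht.trans_le (le_max_right _ _), hts⟩
    · intro x₀ _
      obtain ⟨t, s₀, n, htn⟩ := h.complete x₀
      refine ⟨_, mem_nhdsWithin_of_mem_nhds (h.hit_near htn one_pos), |t| + 1, by positivity, ?_⟩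
      rintro y ⟨t', s, ht', -, hy⟩
      refine ⟨t', ?_, s, n, hy⟩
      have := abs_add_le (t' - t) t
      rw [sub_add_cancel] at this
      linarith
  obtain ⟨M, hM, hMP⟩ := hP
  have hall : ∀ x, ∃ t, |t| < M ∧ Φ t x ∈ translates c := by
    intro x
    obtain ⟨n, hn⟩ := exists_mem_square x
    obtain ⟨t, ht, hts⟩ := hMP _ hn
    obtain ⟨σ, hσ, -, hσΦ⟩ := h.exists_sign n
    have hσa : |σ| = 1 := by rcases hσ with rfl | rfl <;> simp
    rw [hσΦ, add_latt_mem_translates_iff] at hts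
    exact ⟨σ * t, by rwa [abs_mul, hσa, one_mul], hts⟩
  obtain ⟨t, ht, hts⟩ := hall (Φ M x)
  rw [← h.flow.add] at hts
  exact ⟨t + M, by linarith [neg_abs_le t], hts⟩

/-- The orbit of `c s` meets the translates of `c` for the first time at time `R`, at the point
`c s' + n`. -/
def FirstHit (Φ : ℝ → ℝ × ℝ → ℝ × ℝ) (c : ℝ → ℝ × ℝ) (s R s' : ℝ) (n : ℤ × ℤ) : Prop :=
  0 < R ∧ Φ R (c s) = c s' + latt n ∧ ∀ r ∈ Ioo 0 R, Φ r (c s) ∉ translates c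

/-- The return times form a closed set bounded away from `0`. -/
lemma exists_firstHit (h : GlobalSection X Φ c v) (s : ℝ) : ∃ R s' n, FirstHit Φ c s R s' n := by
  obtain ⟨δ, hδ, hδr⟩ := h.exists_return_time
  let H : Set ℝ := {t | δ ≤ t ∧ Φ t (c s) ∈ translates c}
  have hcl : IsClosed H := isClosed_Ici.inter (h.isClosed_translates.preimage
    (h.flow.continuous_apply continuous_id continuous_const))
  have hpos : ∀ t > 0, Φ t (c s) ∈ translates c → t ∈ H := by
    intro t ht hts
    refine ⟨?_, hts⟩
    by_contra! hlt
    exact hδr s t (by rwa [abs_of_pos ht]) (by rwa [abs_of_pos ht]) hts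
  have hne : H.Nonempty := by
    obtain ⟨t, ht, hts⟩ := h.exists_forward_hit (c s)
    exact ⟨t, hpos t ht hts⟩
  have hbdd : BddBelow H := ⟨δ, fun t ht => ht.1⟩
  obtain ⟨hR, s', n, hRs⟩ := hcl.csInf_mem hne hbdd
  refine ⟨sInf H, s', n, hδ.trans_le hR, hRs, fun r hr hmem => ?_⟩
  exact (csInf_le hbdd (hpos r hr.1 hmem)).not_gt hr.2

lemma FirstHit.eq_time {s R R' s₁ s₂ : ℝ} {n m : ℤ × ℤ} (h1 : FirstHit Φ c s R s₁ n)
    (h2 : FirstHit Φ c s R' s₂ m) : R = R' := by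
  rcases lt_trichotomy R R' with hlt | heq | hlt
  · exact absurd ⟨s₁, n, h1.2.1⟩ (h2.2.2 R ⟨h1.1, hlt⟩)
  · exact heq
  · exact absurd ⟨s₂, m, h2.2.1⟩ (h1.2.2 R' ⟨h2.1, hlt⟩)

/-- The first hit is unique up to the representation of a point of the translates of `c`. -/
lemma FirstHit.exists_int (h : GlobalSection X Φ c v) {s R R' s₁ s₂ : ℝ} {n m : ℤ × ℤ}
    (h1 : FirstHit Φ c s R s₁ n) (h2 : FirstHit Φ c s R' s₂ m) :
    ∃ j : ℤ, s₁ = s₂ + j ∧ m = n + j • v := by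
  have e := h1.2.1
  rw [h1.eq_time h2, h2.2.1] at e
  obtain ⟨j, hj, hjv⟩ := h.simple s₁ s₂ (m - n) (by
    rw [map_sub, add_sub, e, add_sub_cancel_right])
  exact ⟨j, hj, by rw [← hjv]; abel⟩

lemma FirstHit.shift (h : GlobalSection X Φ c v) {s R s' : ℝ} {n : ℤ × ℤ}
    (h1 : FirstHit Φ c s R s' n) (j : ℤ) : FirstHit Φ c s R (s' + j) (n - j • v) := by
  refine ⟨h1.1, ?_, h1.2.2⟩
  rw [h1.2.1, h.period_int, map_sub]; abel

/-- The first return depends continuously on the starting point. -/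
lemma FirstHit.eventually (h : GlobalSection X Φ c v) {s₀ R s₁ : ℝ} {n : ℤ × ℤ}
    (h1 : FirstHit Φ c s₀ R s₁ n) {η : ℝ} (hη : 0 < η) :
    ∀ᶠ s in 𝓝 s₀, ∃ R' s', |R' - R| < η ∧ |s' - s₁| < η ∧ FirstHit Φ c s R' s' n := by
  obtain ⟨δ, hδ, hδr⟩ := h.exists_return_time
  obtain ⟨σ, hσ, -, hσΦ⟩ := h.exists_sign n
  have hσa : |σ| = 1 := by rcases hσ with rfl | rfl <;> simp
  have hRδ : δ ≤ R := by
    by_contra! hlt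
    exact hδr s₀ R (by rw [abs_of_pos h1.1]; exact h1.1) (by rwa [abs_of_pos h1.1])
      ⟨s₁, n, h1.2.1⟩
  have e1 := h.continuous_curve.continuousAt.eventually
    (h.hit_near h1.2.1 (lt_min hη (half_pos hδ)))
  have e2 : ∀ᶠ s in 𝓝 s₀, ∀ r ∈ Icc δ (R - δ / 2), Φ r (c s) ∉ translates c := by
    refine isCompact_Icc.eventually_forall_of_forall_eventually fun r hr => ?_
    have hcont : Continuous fun p : ℝ × ℝ => Φ p.2 (c p.1) :=
      h.flow.continuous_apply continuous_snd (h.continuous_curve.comp continuous_fst)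
    have hnot : Φ r (c s₀) ∉ translates c := h1.2.2 r ⟨by linarith [hr.1], by linarith [hr.2]⟩
    exact (hcont.tendsto (s₀, r)).eventually (h.isClosed_translates.isOpen_compl.mem_nhds hnot)
  filter_upwards [e1, e2] with s hs1 hs2
  obtain ⟨R', s', hR', hs', hRe⟩ := hs1
  rw [lt_min_iff] at hR' hs'
  have hab := abs_lt.1 hR'.2
  refine ⟨R', s', hR'.1, hs'.1, by linarith, hRe, fun r hr hmem => ?_⟩
  rcases lt_or_ge r δ with hrδ | hrδ
  · exact hδr s r (by rw [abs_of_pos hr.1]; exact hr.1) (by rwa [abs_of_pos hr.1]) hmem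
  rcases le_or_gt r (R - δ / 2) with hle | hgt
  · exact hs2 r ⟨hrδ, hle⟩ hmem
  · -- two crossings would be too close to each other
    have e : Φ r (c s) = Φ (σ * (r - R')) (c s') + latt n := by
      rw [← hσΦ, ← hRe, ← h.flow.add, sub_add_cancel]
    rw [e, add_latt_mem_translates_iff] at hmem
    have habs : |σ * (r - R')| = R' - r := by
      rw [abs_mul, hσa, one_mul, abs_of_neg (by linarith [hr.2])]; ring
    exact hδr s' _ (by rw [habs]; linarith [hr.2]) (by rw [habs]; linarith) hmem

/-- All orbits starting on `c` return first to one and the same translate `c + D`. -/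
lemma exists_firstHit_const (h : GlobalSection X Φ c v) :
    ∃ D, ∀ s, ∃ R s', FirstHit Φ c s R s' D := by
  let A : ℤ × ℤ → Set ℝ := fun n => {s | ∃ R s', FirstHit Φ c s R s' n}
  have hopen : ∀ n, IsOpen (A n) := by
    intro n
    rw [isOpen_iff_mem_nhds]
    rintro s₀ ⟨R, s₁, h1⟩
    filter_upwards [h1.eventually h one_pos] with s hs
    obtain ⟨R', s', -, -, h2⟩ := hs
    exact ⟨R', s', h2⟩
  have hsub : ∀ n m s, s ∈ A n → s ∈ A m → A m ⊆ A n := by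
    rintro n m s ⟨R, s₁, h1⟩ ⟨R', s₂, h2⟩ r ⟨R'', s₃, h3⟩
    obtain ⟨j, -, hj⟩ := h1.exists_int h h2
    refine ⟨R'', s₃ + j, ?_⟩
    have := h3.shift h j
    rwa [hj, add_sub_cancel_right] at this
  obtain ⟨R, s', D, h0⟩ := h.exists_firstHit 0
  refine ⟨D, fun s => ?_⟩
  have hcl : IsClopen (A D) := by
    refine ⟨⟨?_⟩, hopen D⟩
    rw [isOpen_iff_mem_nhds]
    intro r hr
    obtain ⟨R, s', n, hn⟩ := h.exists_firstHit r
    filter_upwards [(hopen n).mem_nhds ⟨R, s', hn⟩] with q hq hqD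
    exact hr (hsub D n q hqD hq ⟨R, s', hn⟩)
  have huniv := hcl.eq_univ ⟨0, R, s', h0⟩
  have : s ∈ A D := huniv ▸ mem_univ s
  exact this

/-- The first return to `c + D` takes place in the direction of the first crossing. Otherwise the
first return map of `c` would be decreasing, while it commutes with the period. -/
lemma firstHit_sign (h : GlobalSection X Φ c v) {D : ℤ × ℤ}
    (hD : ∀ s, ∃ R s', FirstHit Φ c s R s' D) (x : ℝ × ℝ) : X (x + latt D) = X x := by
  obtain ⟨σ, hσ, hσX, hσΦ⟩ := h.exists_sign D
  rcases hσ with rfl | rfl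
  · rw [hσX, one_smul]
  exfalso
  have hX0 : ∀ x, X x ≠ 0 := by
    intro x hx
    have := h.lineField.unit x
    rw [hx] at this; simp at this
  -- if `v = 0`, the curve is closed in the plane and going back along an orbit gives `D = -D`
  have hv : v ≠ 0 := by
    rintro rfl
    obtain ⟨R, s', h1⟩ := hD 0
    have hback : FirstHit Φ c s' R 0 (-D) := by
      have key : ∀ r, Φ r (c s') = Φ (R - r) (c 0) + latt (-D) := by
        intro r
        have e : c s' + latt D + latt (-D) = c s' := by rw [map_neg, add_neg_cancel_right]
        have e2 := hσΦ (-r) (c s')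
        rw [neg_one_mul, neg_neg, ← h1.2.1, ← h.flow.add] at e2
        rw [map_neg, sub_eq_neg_add, e2, add_neg_cancel_right]
      refine ⟨h1.1, ?_, fun r hr hmem => ?_⟩
      · rw [key, sub_self, h.flow.zero]
      · rw [key, add_latt_mem_translates_iff] at hmem
        exact h1.2.2 (R - r) ⟨by linarith [hr.2], by linarith [hr.1]⟩ hmem
    obtain ⟨R', s'', h2⟩ := hD s'
    obtain ⟨j, -, hj⟩ := hback.exists_int h h2
    rw [smul_zero, add_zero] at hj
    have hD0 : D = 0 := self_eq_neg.1 hj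
    have := hσX 0
    rw [hD0, map_zero, add_zero, neg_one_smul] at this
    exact hX0 0 (self_eq_neg.1 this)
  have huniq : ∀ s R R' s₁ s₂, FirstHit Φ c s R s₁ D → FirstHit Φ c s R' s₂ D → s₁ = s₂ := by
    intro s R R' s₁ s₂ h1 h2
    obtain ⟨j, hj, hjv⟩ := h1.exists_int h h2
    have h0 : j • v = 0 := by simpa using hjv
    rcases smul_eq_zero.1 h0 with h0 | h0
    · simpa [h0] using hj
    · exact absurd h0 hv
  -- the first return map `g`
  choose R g hg using hD
  have hcont : ∀ s₀, ContinuousAt R s₀ ∧ ContinuousAt g s₀ := by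
    intro s₀
    rw [Metric.continuousAt_iff', Metric.continuousAt_iff']
    constructor <;> intro η hη <;>
    · filter_upwards [(hg s₀).eventually h hη] with s hs
      obtain ⟨R', s', hR', hs', h2⟩ := hs
      rw [Real.dist_eq]
      first
        | rw [(hg s).eq_time h2]; exact hR'
        | rw [huniq _ _ _ _ _ (hg s) h2]; exact hs'
  -- `g` is a local inverse of the first integral along `c + D`, which is decreasing because the
  -- deck transformation `D` reverses `X`
  have hderiv : ∀ s₀, ∃ a < 0, HasDerivAt g a s₀ := by
    intro s₀
    obtain ⟨w, hw⟩ := exists_firstIntegral h.lineField h.flow h.curve s₀ (R s₀)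
    obtain ⟨κ, hκ, hwd⟩ := hw.fderiv_eq
    have hq : Φ (R s₀) (c s₀) = c (g s₀) + latt D := (hg s₀).2.1
    have hm : HasDerivAt (fun s => w (c s + latt D))
        (κ * cross (X (Φ (R s₀) (c s₀))) (deriv c (g s₀))) (g s₀) := by
      rw [← hwd]
      have h1 : HasFDerivAt w (fderiv ℝ w (Φ (R s₀) (c s₀))) (c (g s₀) + latt D) := by
        rw [← hq]; exact (hw.contDiffAt.differentiableAt (by norm_num)).hasFDerivAt
      exact h1.comp_hasDerivAt (g s₀) ((h.curve.hasDerivAt (g s₀)).add_const (latt D))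
    rw [hq, hσX, cross_smul_left] at hm
    have hpos := h.curve.cross_pos (g s₀)
    have hneg : κ * (-1 * cross (X (c (g s₀))) (deriv c (g s₀))) < 0 := by
      have := mul_pos hκ hpos; linarith
    refine ⟨_, inv_lt_zero.2 hneg, hm.of_local_left_inverse (hcont s₀).2 hneg.ne ?_⟩
    have : ContinuousAt (fun s => (s, R s)) s₀ := continuousAt_id.prodMk (hcont s₀).1
    filter_upwards [this.eventually hw.apply_flow] with s hs
    rwa [(hg s).2.1] at hs
  choose a ha hga using hderiv
  have hanti : StrictAnti g := strictAnti_of_hasDerivAt_neg hga ha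
  have hshift : g 1 = g 0 + 1 := by
    have h1 : FirstHit Φ c 1 (R 0) (g 0 + 1) D := by
      have hc1 : c 1 = c 0 + latt v := by simpa using h.period 0
      refine ⟨(hg 0).1, ?_, fun r hr hmem => (hg 0).2.2 r hr ?_⟩
      · rw [hc1, h.flow_translate h.field_period, (hg 0).2.1, h.period]; abel
      · rwa [hc1, h.flow_translate h.field_period, add_latt_mem_translates_iff] at hmem
    exact huniq _ _ _ _ _ (hg 1) h1
  have := hanti (show (0 : ℝ) < 1 by norm_num)
  linarith

/-- The section of the reversed flow. The curve is reversed too, so that it still crosses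
positively. -/
lemma neg (h : GlobalSection X Φ c v) :
    GlobalSection (fun x => -X x) (fun t => Φ (-t)) (fun s => c (-s)) (-v) := by
  have htr : ∀ x, x ∈ translates (fun s => c (-s)) ↔ x ∈ translates c := by
    intro x
    constructor
    · rintro ⟨s, n, rfl⟩; exact ⟨-s, n, rfl⟩
    · rintro ⟨s, n, rfl⟩; exact ⟨-s, n, by simp⟩
  have hderiv : ∀ s, HasDerivAt (fun s => c (-s)) (-deriv c (-s)) s := by
    intro s
    have := (h.curve.hasDerivAt (-s)).scomp s (hasDerivAt_neg s)
    simpa using! this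
  refine ⟨⟨h.lineField.continuous.neg, fun x => ?_, fun x => ?_, fun n => ?_⟩, ⟨fun x => ?_,
    fun x t => ?_, fun s t x => ?_, ?_⟩, ⟨?_, fun s => ?_⟩, fun s => ?_, fun s s' n hn => ?_,
    fun x => ?_⟩
  · have := h.lineField.unit x; simpa using this
  · obtain ⟨V, ψ, L, lam, hV, hch⟩ := h.lineField.chart x
    let ρ : ℝ × ℝ →L[ℝ] ℝ × ℝ :=
      (-ContinuousLinearMap.fst ℝ ℝ ℝ).prod (ContinuousLinearMap.snd ℝ ℝ ℝ)
    have hρ : ∀ y, ρ y = (-y.1, y.2) := fun y => rfl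
    have hρρ : ∀ y, ρ (ρ y) = y := fun y => by simp [hρ]
    refine ⟨V, fun x => ρ (ψ x), fun y => L (ρ y), fun y => lam (ρ y), hV,
      ⟨⟨hch.isOpen, ρ.contDiff.comp_contDiffOn hch.contDiffOn, hch.contDiff.comp ρ.contDiff,
        fun y => hch.mapsTo _, fun y => by rw [hch.left, hρρ],
        fun x hx => by rw [hρρ, hch.right x hx]⟩, hch.continuous_lam.comp ρ.continuous,
        fun y => hch.lam_pos _, fun y => ?_⟩⟩
    have h1 := ((hch.contDiff.differentiable (by norm_num)) (ρ y)).hasFDerivAt.comp y ρ.hasFDerivAt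
    have h2 : fderiv ℝ (fun y => L (ρ y)) y = (fderiv ℝ L (ρ y)).comp ρ := h1.fderiv
    have h3 : ρ (1, 0) = -((1, 0) : ℝ × ℝ) := by simp [hρ]
    rw [h2, ContinuousLinearMap.comp_apply, h3, map_neg, hch.fderiv_symm, smul_neg]
  · obtain ⟨σ, hσ, hσX⟩ := h.lineField.period n
    exact ⟨σ, hσ, fun x => by rw [hσX, smul_neg]⟩
  · simp [h.flow.zero]
  · have := (h.flow.hasDerivAt x (-t)).scomp t (hasDerivAt_neg t)
    simpa using! this
  · rw [neg_add, h.flow.add]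
  · exact h.flow.continuous_apply (continuous_fst.neg) continuous_snd
  · exact h.curve.contDiff.comp contDiff_neg
  · rw [(hderiv s).deriv]
    have := h.curve.cross_pos (-s)
    unfold cross at this ⊢
    simp only [Prod.fst_neg, Prod.snd_neg]
    linarith
  · have := h.period (-s - 1)
    rw [sub_add_cancel] at this
    rw [map_neg, this, neg_add, ← sub_eq_add_neg]; abel
  · obtain ⟨j, hj, hjn⟩ := h.simple _ _ _ hn
    exact ⟨-j, by push_cast; linarith, by rw [hjn, neg_smul_neg]⟩
  · obtain ⟨t, ht⟩ := h.complete x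
    exact ⟨-t, by rw [htr, neg_neg]; exact ht⟩

end GlobalSection

/-! ### The leaf coordinate -/

/-- The vectors `D` and `v` generate the lattice. -/
def Generates (D v : ℤ × ℤ) : Prop := ∀ n, ∃ k j : ℤ, n = k • D + j • v

lemma Generates.independent {D v : ℤ × ℤ} (h : Generates D v) {k j : ℤ}
    (hkj : k • D + j • v = 0) : k = 0 ∧ j = 0 := by
  obtain ⟨k₁, j₁, h₁⟩ := h (1, 0)
  obtain ⟨k₂, j₂, h₂⟩ := h (0, 1)
  have a1 := congrArg Prod.fst h₁
  have a2 := congrArg Prod.snd h₁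
  have b1 := congrArg Prod.fst h₂
  have b2 := congrArg Prod.snd h₂
  have c1 := congrArg Prod.fst hkj
  have c2 := congrArg Prod.snd hkj
  simp only [Prod.fst_add, Prod.snd_add, Prod.smul_fst, Prod.smul_snd, smul_eq_mul, Prod.fst_zero,
    Prod.snd_zero] at a1 a2 b1 b2 c1 c2
  -- the determinant of `D` and `v` divides `1`
  have hdet : (k₁ * j₂ - j₁ * k₂) * (D.1 * v.2 - D.2 * v.1) = 1 := by
    have : (k₁ * D.1 + j₁ * v.1) * (k₂ * D.2 + j₂ * v.2)
        - (k₁ * D.2 + j₁ * v.2) * (k₂ * D.1 + j₂ * v.1) = 1 := by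
      rw [← a1, ← a2, ← b1, ← b2]; norm_num
    linear_combination this
  have hd : D.1 * v.2 - D.2 * v.1 ≠ 0 := by
    intro h0; rw [h0, mul_zero] at hdet; exact zero_ne_one hdet
  constructor
  · have : k * (D.1 * v.2 - D.2 * v.1) = 0 := by linear_combination v.2 * c1 - v.1 * c2
    exact (mul_eq_zero.1 this).resolve_right hd
  · have : j * (D.1 * v.2 - D.2 * v.1) = 0 := by linear_combination D.1 * c2 - D.2 * c1
    exact (mul_eq_zero.1 this).resolve_right hd

/-- A map invariant under two generators is invariant under the lattice. -/
lemma Generates.period {D v : ℤ × ℤ} (h : Generates D v) {α : Type*} {f : ℝ × ℝ → α}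
    (hD : ∀ x, f (x + latt D) = f x) (hv : ∀ x, f (x + latt v) = f x) (n : ℤ × ℤ) (x : ℝ × ℝ) :
    f (x + latt n) = f x := by
  have key : ∀ w : ℤ × ℤ, (∀ x, f (x + latt w) = f x) → ∀ k : ℤ, ∀ x, f (x + latt (k • w)) = f x := by
    intro w hw k
    induction k using Int.induction_on with
    | zero => simp
    | succ i ih => intro x; rw [add_smul, one_smul, map_add, ← add_assoc, hw, ih]
    | pred i ih =>
      intro x
      have e : x + latt ((-(i : ℤ) - 1) • w) + latt w = x + latt (-(i : ℤ) • w) := by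
        rw [sub_smul, one_smul, map_sub]; abel
      rw [← hw, e, ih]
  obtain ⟨k, j, rfl⟩ := h n
  rw [map_add, ← add_assoc, key v hv, key D hD]

namespace GlobalSection
variable {X : ℝ × ℝ → ℝ × ℝ} {Φ : ℝ → ℝ × ℝ → ℝ × ℝ} {c : ℝ → ℝ × ℝ} {v : ℤ × ℤ}

lemma le_firstHit (h : GlobalSection X Φ c v) :
    ∃ δ > 0, ∀ s R s' n, FirstHit Φ c s R s' n → δ ≤ R := by
  obtain ⟨δ, hδ, hδr⟩ := h.exists_return_time
  refine ⟨δ, hδ, fun s R s' n h1 => ?_⟩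
  by_contra! hlt
  exact hδr s R (by rw [abs_of_pos h1.1]; exact h1.1) (by rwa [abs_of_pos h1.1]) ⟨s', n, h1.2.1⟩

/-- A point of the translates of `c` reached from `c` in positive time lies on a translate by a
positive multiple of `D`, modulo `v`: it is reached after a positive number of first returns. -/
lemma forward_hits (h : GlobalSection X Φ c v) {D : ℤ × ℤ}
    (hD : ∀ s, ∃ R s', FirstHit Φ c s R s' D) {s t s' : ℝ} {n : ℤ × ℤ} (ht : 0 < t)
    (hts : Φ t (c s) = c s' + latt n) : ∃ k j : ℤ, 0 < k ∧ n = k • D + j • v := by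
  obtain ⟨δ, hδ, hδR⟩ := h.le_firstHit
  have hDX := h.firstHit_sign hD
  have key : ∀ N : ℕ, ∀ s t s' n, 0 < t → t ≤ N * δ → Φ t (c s) = c s' + latt n →
      ∃ k j : ℤ, 0 < k ∧ n = k • D + j • v := by
    intro N
    induction N with
    | zero => intro s t s' n ht htN; simp at htN; linarith
    | succ N ih =>
      intro s t s' n ht htN hts
      obtain ⟨R, s₁, h1⟩ := hD s
      have hR := hδR _ _ _ _ h1
      rcases lt_trichotomy t R with hlt | rfl | hgt
      · exact absurd ⟨s', n, hts⟩ (h1.2.2 t ⟨ht, hlt⟩)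
      · obtain ⟨j, -, hj⟩ := h1.exists_int h (⟨h1.1, hts, h1.2.2⟩ : FirstHit Φ c s t s' n)
        exact ⟨1, j, one_pos, by rw [hj, one_smul]⟩
      · have e : Φ (t - R) (c s₁) = c s' + latt (n - D) := by
          have e1 : Φ (t - R) (c s₁ + latt D) = c s' + latt n := by
            rw [← h1.2.1, ← h.flow.add, sub_add_cancel, hts]
          rw [h.flow_translate hDX] at e1
          rw [map_sub, ← add_sub_assoc, ← e1, add_sub_cancel_right]
        obtain ⟨k, j, hk, hkj⟩ := ih s₁ (t - R) s' (n - D) (by linarith)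
          (by push_cast at htN; linarith) e
        exact ⟨k + 1, j, by omega, by rw [add_smul, one_smul, add_right_comm, ← hkj]; abel⟩
  obtain ⟨N, hN⟩ := exists_nat_gt (t / δ)
  rw [div_lt_iff₀ hδ] at hN
  exact key N s t s' n ht hN.le hts

/-- After `k` first returns, the orbit is on `c + k D`. -/
lemma forward_crossing (h : GlobalSection X Φ c v) {D : ℤ × ℤ}
    (hD : ∀ s, ∃ R s', FirstHit Φ c s R s' D) :
    ∃ δ > 0, ∀ k : ℕ, ∀ s, ∃ t s', Φ t (c s) = c s' + latt (k • D) ∧ k * δ ≤ t := by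
  obtain ⟨δ, hδ, hδR⟩ := h.le_firstHit
  have hDX := h.firstHit_sign hD
  refine ⟨δ, hδ, fun k => ?_⟩
  induction k with
  | zero => intro s; exact ⟨0, s, by simp [h.flow.zero], by simp⟩
  | succ k ih =>
    intro s
    obtain ⟨R, s₁, h1⟩ := hD s
    have hR := hδR _ _ _ _ h1
    obtain ⟨t, s', ht, htk⟩ := ih s₁
    refine ⟨t + R, s', ?_, by push_cast; linarith⟩
    rw [h.flow.add, h1.2.1, h.flow_translate hDX, ht, add_smul, one_smul, map_add, add_assoc]

/-- The backward first return is the inverse of the forward one. -/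
lemma exists_backward_firstHit (h : GlobalSection X Φ c v) {D : ℤ × ℤ}
    (hD : ∀ s, ∃ R s', FirstHit Φ c s R s' D) :
    ∃ (D' : ℤ × ℤ) (j : ℤ), D' = -D + j • v ∧
      ∀ s, ∃ R s', FirstHit (fun t => Φ (-t)) (fun s => c (-s)) s R s' D' := by
  obtain ⟨D', hD'⟩ := h.neg.exists_firstHit_const
  have hDX := h.firstHit_sign hD
  obtain ⟨R, s', h1⟩ := hD 0
  have key : ∀ r, Φ r (c s') = Φ (r + R) (c 0) + latt (-D) := by
    intro r
    rw [h.flow.add, h1.2.1, h.flow_translate hDX, map_neg, add_neg_cancel_right]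
  have hback : FirstHit (fun t => Φ (-t)) (fun s => c (-s)) (-s') R 0 (-D) := by
    refine ⟨h1.1, ?_, ?_⟩
    · simp only [neg_neg, neg_zero]
      rw [key, neg_add_cancel, h.flow.zero]
    · rintro r hr ⟨s, n, hsn⟩
      simp only [neg_neg] at hsn
      rw [key] at hsn
      refine h1.2.2 (-r + R) ⟨by linarith [hr.2], by linarith [hr.1]⟩
        (add_latt_mem_translates_iff.1 ⟨-s, n, hsn⟩)
  obtain ⟨R', s'', h2⟩ := hD' (-s')
  obtain ⟨j, -, hj⟩ := hback.exists_int h.neg h2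
  exact ⟨D', -j, by rw [hj]; simp, hD'⟩

/-- Every orbit starting on `c` crosses all translates `c + k D`, in increasing order and at times
growing at least linearly with `k`. -/
lemma exists_crossing (h : GlobalSection X Φ c v) {D : ℤ × ℤ}
    (hD : ∀ s, ∃ R s', FirstHit Φ c s R s' D) :
    ∃ δ > 0, ∀ k : ℤ, ∀ s, ∃ t s', Φ t (c s) = c s' + latt (k • D) ∧
      (0 ≤ k → k * δ ≤ t) ∧ (k ≤ 0 → t ≤ k * δ) := by
  obtain ⟨D', j, hD'j, hD'⟩ := h.exists_backward_firstHit hD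
  obtain ⟨δ, hδ, h1⟩ := h.forward_crossing hD
  obtain ⟨δ', hδ', h2⟩ := h.neg.forward_crossing hD'
  refine ⟨min δ δ', lt_min hδ hδ', fun k s => ?_⟩
  rcases lt_trichotomy k 0 with hk | rfl | hk
  · obtain ⟨l, rfl⟩ : ∃ l : ℕ, k = -(l : ℤ) := ⟨k.natAbs, by omega⟩
    obtain ⟨t, s', ht, htl⟩ := h2 l (-s)
    simp only [neg_neg] at ht
    refine ⟨-t, -s' + ((l : ℤ) * j : ℤ), ?_, fun h0 => absurd h0 (by omega), fun _ => ?_⟩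
    · rw [ht, h.period_int, add_assoc, ← map_add, hD'j]
      congr 2
      rw [smul_add, smul_neg, neg_smul, natCast_zsmul, mul_smul, natCast_zsmul, add_comm]
    · push_cast
      have : (l : ℝ) * min δ δ' ≤ l * δ' := by gcongr; exact min_le_right _ _
      linarith
  · exact ⟨0, s, by simp [h.flow.zero], by simp, by simp⟩
  · obtain ⟨l, rfl⟩ : ∃ l : ℕ, k = l := ⟨k.toNat, by omega⟩
    obtain ⟨t, s', ht, htl⟩ := h1 l s
    refine ⟨t, s', by rw [ht, natCast_zsmul], fun _ => ?_, fun h0 => absurd h0 (by omega)⟩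
    have : (l : ℝ) * min δ δ' ≤ l * δ := by gcongr; exact min_le_left _ _
    push_cast
    linarith

/-- The orbit of a point of `c` meets no other translates of `c` than the `c + k D`, and it meets
`c` only at time `0`. -/
lemma hits (h : GlobalSection X Φ c v) {D : ℤ × ℤ} (hD : ∀ s, ∃ R s', FirstHit Φ c s R s' D)
    {s t s' : ℝ} {n : ℤ × ℤ} (hts : Φ t (c s) = c s' + latt n) :
    ∃ k j : ℤ, n = k • D + j • v ∧ (k = 0 → t = 0) := by
  obtain ⟨D', j', hD'j, hD'⟩ := h.exists_backward_firstHit hD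
  rcases lt_trichotomy t 0 with ht | rfl | ht
  · obtain ⟨k, j, hk, hn⟩ := h.neg.forward_hits hD' (s := -s) (t := -t) (s' := -s') (n := n)
      (by linarith) (by simpa using hts)
    refine ⟨-k, k * j' - j, ?_, fun h0 => by omega⟩
    rw [hn, hD'j, smul_add, smul_neg, smul_neg, sub_smul, mul_smul, neg_smul]; abel
  · rw [h.flow.zero] at hts
    obtain ⟨j, -, hj⟩ := h.simple _ _ _ hts
    exact ⟨0, j, by rw [hj]; simp, fun _ => rfl⟩
  · obtain ⟨k, j, hk, hn⟩ := h.forward_hits hD ht hts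
    exact ⟨k, j, hn, fun h0 => by omega⟩

/-- Every orbit meets `c` itself: the saturations of the translates of `c` are open, disjoint or
equal, and cover the connected plane. -/
lemma exists_hit (h : GlobalSection X Φ c v) {D : ℤ × ℤ}
    (hD : ∀ s, ∃ R s', FirstHit Φ c s R s' D) (x : ℝ × ℝ) : ∃ t s, Φ t x = c s := by
  let W : ℤ × ℤ → Set (ℝ × ℝ) := fun n => {x | ∃ t s, Φ t x = c s + latt n}
  have hopen : ∀ n, IsOpen (W n) := by
    intro n
    rw [isOpen_iff_mem_nhds]
    rintro x ⟨t, s, hts⟩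
    filter_upwards [h.hit_near hts one_pos] with y hy
    obtain ⟨t', s', -, -, hy⟩ := hy
    exact ⟨t', s', hy⟩
  obtain ⟨δ, -, hcr⟩ := h.exists_crossing hD
  have hsub : ∀ n m : ℤ × ℤ, (∃ k j : ℤ, m - n = k • D + j • v) → W n ⊆ W m := by
    rintro n m ⟨k, j, hkj⟩ x ⟨t, s, hts⟩
    obtain ⟨σ, hσ, -, hσΦ⟩ := h.exists_sign n
    have hσσ : σ * σ = 1 := by rcases hσ with rfl | rfl <;> norm_num
    obtain ⟨r, s', hr, -⟩ := hcr k s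
    refine ⟨σ * r + t, s' - j, ?_⟩
    rw [h.flow.add, hts, hσΦ, ← mul_assoc, hσσ, one_mul, hr]
    have e := h.period_int (s' - j) j
    rw [sub_add_cancel] at e
    have e2 : m = n + (k • D + j • v) := by rw [← hkj]; abel
    rw [e, e2, map_add, map_add]; abel
  have hrel : ∀ n m : ℤ × ℤ, (W n ∩ W m).Nonempty → ∃ k j : ℤ, m - n = k • D + j • v := by
    rintro n m ⟨x, ⟨t, s, hts⟩, t', s', hts'⟩
    obtain ⟨σ, hσ, -, hσΦ⟩ := h.exists_sign n
    have e : Φ (σ * (t' - t)) (c s) = c s' + latt (m - n) := by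
      have e1 : Φ (t' - t) (c s + latt n) = c s' + latt m := by
        rw [← hts, ← h.flow.add, sub_add_cancel, hts']
      rw [hσΦ] at e1
      rw [map_sub, ← add_sub_assoc, ← e1, add_sub_cancel_right]
    obtain ⟨k, j, hkj, -⟩ := h.hits hD e
    exact ⟨k, j, hkj⟩
  have hcl : IsClopen (W 0) := by
    refine ⟨⟨?_⟩, hopen 0⟩
    rw [isOpen_iff_mem_nhds]
    intro x hx
    obtain ⟨t, s, n, htn⟩ := h.complete x
    filter_upwards [(hopen n).mem_nhds ⟨t, s, htn⟩] with y hy hy0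
    exact hx (hsub n 0 (hrel n 0 ⟨y, hy, hy0⟩) ⟨t, s, htn⟩)
  have huniv := hcl.eq_univ ⟨c 0, 0, 0, by simp [h.flow.zero]⟩
  obtain ⟨t, s, hts⟩ : x ∈ W 0 := huniv ▸ mem_univ x
  exact ⟨t, s, by simpa using hts⟩

/-- Since every orbit meets `c` itself, an orbit from `c - n` to `c` expresses `n` by `D` and `v`.
-/
lemma generates (h : GlobalSection X Φ c v) {D : ℤ × ℤ}
    (hD : ∀ s, ∃ R s', FirstHit Φ c s R s' D) : Generates D v := by
  intro n
  obtain ⟨t, s, hts⟩ := h.exists_hit hD (c 0 + latt (-n))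
  obtain ⟨σ, hσ, -, hσΦ⟩ := h.exists_sign (-n)
  rw [hσΦ] at hts
  obtain ⟨k, j, hkj, -⟩ := h.hits hD (s := 0) (t := σ * t) (s' := s) (n := n) (by
    rw [← hts, map_neg, neg_add_cancel_right])
  exact ⟨k, j, hkj⟩

end GlobalSection

/-- The plane is the product of the leaf coordinate `u`, normalized on the curve `c`, and of the
flow of `X`; the translates `c + k D` of the curve are crossed in order by each orbit. -/
structure LeafCoordinate (X : ℝ × ℝ → ℝ × ℝ) (Φ : ℝ → ℝ × ℝ → ℝ × ℝ) (c : ℝ → ℝ × ℝ)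
    (v D : ℤ × ℤ) (u : ℝ × ℝ → ℝ) : Prop where
  globalSection : GlobalSection X Φ c v
  generates : Generates D v
  field_period : ∀ n x, X (x + latt n) = X x
  contDiff : ContDiff ℝ 1 u
  fderiv_eq : ∀ x, ∃ κ > 0, ∀ ξ, fderiv ℝ u x ξ = κ * cross (X x) ξ
  apply_flow : ∀ s t, u (Φ t (c s)) = s
  exists_time : ∀ x, ∃ t, Φ t (c (u x)) = x
  crossing : ∃ δ > 0, ∀ k : ℤ, ∀ s, ∃ t s', Φ t (c s) = c s' + latt (k • D) ∧
    (0 ≤ k → k * δ ≤ t) ∧ (k ≤ 0 → t ≤ k * δ)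

/-- Every orbit meets `c` in exactly one point; its parameter is the leaf coordinate. It is `C¹`
because near each point it is a first integral obtained by transport along the orbit. -/
lemma GlobalSection.exists_leafCoordinate {X : ℝ × ℝ → ℝ × ℝ} {Φ : ℝ → ℝ × ℝ → ℝ × ℝ}
    {c : ℝ → ℝ × ℝ} {v : ℤ × ℤ} (h : GlobalSection X Φ c v) :
    ∃ D u, LeafCoordinate X Φ c v D u := by
  obtain ⟨D, hD⟩ := h.exists_firstHit_const
  have hgen := h.generates hD
  have hper := hgen.period (h.firstHit_sign hD) h.field_period
  have hex : ∀ x, ∃ s t, Φ t (c s) = x := by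
    intro x
    obtain ⟨t, s, hts⟩ := h.exists_hit hD x
    exact ⟨s, -t, by rw [← hts, h.flow.neg_apply]⟩
  have huniq : ∀ s s' t t', Φ t (c s) = Φ t' (c s') → s = s' := by
    intro s s' t t' hst
    have e : Φ (-t' + t) (c s) = c s' := by rw [h.flow.add, hst, h.flow.neg_apply]
    obtain ⟨k, j, hkj, hk0⟩ := h.hits hD (n := 0) (by simpa using e)
    obtain ⟨rfl, rfl⟩ := hgen.independent hkj.symm
    rw [hk0 rfl, h.flow.zero] at e
    obtain ⟨j, hj, hjv⟩ := h.simple s s' 0 (by simpa using e)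
    have := hgen.independent (k := 0) (j := j) (by rw [← hjv]; simp)
    rw [hj, this.2]; simp
  choose u tm hu using hex
  have happ : ∀ s t, u (Φ t (c s)) = s := fun s t => huniq _ _ _ _ (hu (Φ t (c s)))
  have hloc : ∀ x, ∃ w, IsFirstIntegralAt X Φ c (u x) (tm x) w ∧ u =ᶠ[𝓝 x] w := by
    intro x
    obtain ⟨w, hw⟩ := exists_firstIntegral h.lineField h.flow h.curve (u x) (tm x)
    refine ⟨w, hw, ?_⟩
    have := hw.flow_apply 1 one_pos
    rw [hu] at this
    filter_upwards [this] with y hy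
    obtain ⟨r, -, hr⟩ := hy
    conv_lhs => rw [← hr]
    exact happ _ _
  refine ⟨D, u, h, hgen, hper, ?_, ?_, happ, fun x => ⟨tm x, hu x⟩, h.exists_crossing hD⟩
  · rw [contDiff_iff_contDiffAt]
    intro x
    obtain ⟨w, hw, hev⟩ := hloc x
    have := hw.contDiffAt
    rw [hu] at this
    exact this.congr_of_eventuallyEq hev
  · intro x
    obtain ⟨w, hw, hev⟩ := hloc x
    have := hw.fderiv_eq
    rw [hu] at this
    rw [hev.fderiv_eq]
    exact this

namespace LeafCoordinate
variable {X : ℝ × ℝ → ℝ × ℝ} {Φ : ℝ → ℝ × ℝ → ℝ × ℝ} {c : ℝ → ℝ × ℝ} {v D : ℤ × ℤ}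
  {u : ℝ × ℝ → ℝ}

lemma apply_curve (h : LeafCoordinate X Φ c v D u) (s : ℝ) : u (c s) = s := by
  have := h.apply_flow s 0
  rwa [h.globalSection.flow.zero] at this

lemma flow_translate (h : LeafCoordinate X Φ c v D u) (n : ℤ × ℤ) (t : ℝ) (x : ℝ × ℝ) :
    Φ t (x + latt n) = Φ t x + latt n :=
  h.globalSection.flow_translate (h.field_period n) t x

lemma flow_apply (h : LeafCoordinate X Φ c v D u) (t : ℝ) (x : ℝ × ℝ) : u (Φ t x) = u x := by
  obtain ⟨r, hr⟩ := h.exists_time x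
  conv_lhs => rw [← hr]
  rw [← h.globalSection.flow.add, h.apply_flow]

lemma add_latt (h : LeafCoordinate X Φ c v D u) (x : ℝ × ℝ) : u (x + latt v) = u x + 1 := by
  obtain ⟨r, hr⟩ := h.exists_time x
  conv_lhs => rw [← hr]
  rw [← h.flow_translate, ← h.globalSection.period, h.apply_flow]

lemma hasFDerivAt (h : LeafCoordinate X Φ c v D u) (x : ℝ × ℝ) :
    HasFDerivAt u (fderiv ℝ u x) x :=
  (h.contDiff.differentiable (by norm_num) x).hasFDerivAt

end LeafCoordinate

/-! ### Construction of the height function -/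

/-- The square of the positive part. -/
noncomputable def posSq (x : ℝ) : ℝ := max x 0 ^ 2

lemma posSq_nonneg (x : ℝ) : 0 ≤ posSq x := sq_nonneg _

lemma posSq_of_nonpos {x : ℝ} (hx : x ≤ 0) : posSq x = 0 := by simp [posSq, hx]

lemma posSq_pos {x : ℝ} (hx : 0 < x) : 0 < posSq x := by
  unfold posSq; rw [max_eq_left hx.le]; positivity

lemma hasDerivAt_posSq (x : ℝ) : HasDerivAt posSq (2 * max x 0) x := by
  rcases lt_trichotomy x 0 with hx | rfl | hx
  · rw [max_eq_right hx.le, mul_zero]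
    refine (hasDerivAt_const x (0 : ℝ)).congr_of_eventuallyEq ?_
    filter_upwards [isOpen_Iio.mem_nhds hx] with y hy using posSq_of_nonpos (le_of_lt hy)
  · rw [hasDerivAt_iff_isLittleO]
    have h : ∀ y : ℝ, ‖posSq y‖ ≤ ‖y ^ 2‖ := by
      intro y
      rw [Real.norm_of_nonneg (posSq_nonneg y), Real.norm_of_nonneg (sq_nonneg y)]
      rcases le_total y 0 with hy | hy
      · rw [posSq_of_nonpos hy]; positivity
      · unfold posSq; rw [max_eq_left hy]
    have h2 : (fun y : ℝ => y ^ 2) =o[𝓝 0] fun y => y := by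
      simpa using Asymptotics.isLittleO_pow_pow (𝕜 := ℝ) (show 1 < 2 by norm_num)
    simpa [posSq_of_nonpos le_rfl] using
      (Asymptotics.isBigO_of_le (𝓝 0) h).trans_isLittleO h2
  · rw [max_eq_left hx.le]
    have : HasDerivAt (fun y : ℝ => y ^ 2) (2 * x) x := by simpa using hasDerivAt_pow 2 x
    refine this.congr_of_eventuallyEq ?_
    filter_upwards [isOpen_Ioi.mem_nhds hx] with y hy
    unfold posSq; rw [max_eq_left (le_of_lt hy)]

lemma contDiff_posSq : ContDiff ℝ 1 posSq := by
  rw [contDiff_one_iff_deriv]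
  refine ⟨fun x => (hasDerivAt_posSq x).differentiableAt, ?_⟩
  have : deriv posSq = fun x => 2 * max x 0 := funext fun x => (hasDerivAt_posSq x).deriv
  rw [this]; fun_prop

/-- A `C¹` function of two real variables, not both nonpositive, that increases from `0` to `1`:
it is increasing in the first one and decreasing in the second one. -/
noncomputable def ramp (a b : ℝ) : ℝ := posSq a / (posSq a + posSq b)

lemma ramp_of_nonpos_left {a b : ℝ} (ha : a ≤ 0) : ramp a b = 0 := by
  simp [ramp, posSq_of_nonpos ha]

lemma ramp_of_nonpos_right {a b : ℝ} (ha : 0 < a) (hb : b ≤ 0) : ramp a b = 1 := by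
  simp [ramp, posSq_of_nonpos hb, (posSq_pos ha).ne']

lemma ramp_nonneg (a b : ℝ) : 0 ≤ ramp a b :=
  div_nonneg (posSq_nonneg _) (add_nonneg (posSq_nonneg _) (posSq_nonneg _))

lemma ramp_le_one (a b : ℝ) : ramp a b ≤ 1 :=
  div_le_one_of_le₀ (by linarith [posSq_nonneg b]) (add_nonneg (posSq_nonneg _) (posSq_nonneg _))

lemma posSq_add_pos {a b : ℝ} (h : 0 < a ∨ 0 < b) : 0 < posSq a + posSq b := by
  rcases h with h | h
  · linarith [posSq_pos h, posSq_nonneg b]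
  · linarith [posSq_pos h, posSq_nonneg a]

section ramp
variable {f g : ℝ × ℝ → ℝ} {x : ℝ × ℝ}

lemma contDiffAt_ramp (hf : ContDiffAt ℝ 1 f x) (hg : ContDiffAt ℝ 1 g x)
    (h : 0 < f x ∨ 0 < g x) : ContDiffAt ℝ 1 (fun y => ramp (f y) (g y)) x := by
  have h1 : ContDiffAt ℝ 1 (fun y => posSq (f y)) x := contDiff_posSq.contDiffAt.comp x hf
  have h2 : ContDiffAt ℝ 1 (fun y => posSq (g y)) x := contDiff_posSq.contDiffAt.comp x hg
  exact h1.div (h1.add h2) (posSq_add_pos h).ne'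

lemma fderiv_ramp (hf : ContDiffAt ℝ 1 f x) (hg : ContDiffAt ℝ 1 g x)
    (h : 0 < f x ∨ 0 < g x) (ξ : ℝ × ℝ) :
    fderiv ℝ (fun y => ramp (f y) (g y)) x ξ =
      (2 * max (f x) 0 * fderiv ℝ f x ξ * posSq (g x)
        - posSq (f x) * (2 * max (g x) 0 * fderiv ℝ g x ξ)) / (posSq (f x) + posSq (g x)) ^ 2 := by
  have line : ∀ {F : ℝ × ℝ → ℝ}, ContDiffAt ℝ 1 F x →
      HasDerivAt (fun s : ℝ => F (x + s • ξ)) (fderiv ℝ F x ξ) 0 := fun hF =>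
    (hF.differentiableAt (by norm_num)).hasFDerivAt.hasLineDerivAt ξ
  have hx : x + (0 : ℝ) • ξ = x := by simp
  have d1 : HasDerivAt (fun s : ℝ => posSq (f (x + s • ξ))) (2 * max (f x) 0 * fderiv ℝ f x ξ) 0 :=
    HasDerivAt.comp (h₂ := posSq) (h := fun s : ℝ => f (x + s • ξ)) 0
      (by simp only [hx]; exact hasDerivAt_posSq (f x)) (line hf)
  have d2 : HasDerivAt (fun s : ℝ => posSq (g (x + s • ξ))) (2 * max (g x) 0 * fderiv ℝ g x ξ) 0 :=
    HasDerivAt.comp (h₂ := posSq) (h := fun s : ℝ => g (x + s • ξ)) 0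
      (by simp only [hx]; exact hasDerivAt_posSq (g x)) (line hg)
  have d3 := d1.div (d1.add d2) (by simp only [Pi.add_apply, hx]; exact (posSq_add_pos h).ne')
  rw [(line (contDiffAt_ramp hf hg h)).unique d3]
  simp only [Pi.add_apply, hx]
  congr 1
  ring

lemma fderiv_ramp_nonneg (hf : ContDiffAt ℝ 1 f x) (hg : ContDiffAt ℝ 1 g x)
    (h : 0 < f x ∨ 0 < g x) {ξ : ℝ × ℝ} (hfξ : 0 ≤ fderiv ℝ f x ξ) (hgξ : fderiv ℝ g x ξ ≤ 0) :
    0 ≤ fderiv ℝ (fun y => ramp (f y) (g y)) x ξ := by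
  rw [fderiv_ramp hf hg h]
  refine div_nonneg (sub_nonneg.2 (le_trans (b := 0) ?_ ?_)) (sq_nonneg _)
  · exact mul_nonpos_of_nonneg_of_nonpos (posSq_nonneg _)
      (mul_nonpos_of_nonneg_of_nonpos (by positivity) hgξ)
  · exact mul_nonneg (mul_nonneg (by positivity) hfξ) (posSq_nonneg _)

lemma fderiv_ramp_pos (hf : ContDiffAt ℝ 1 f x) (hg : ContDiffAt ℝ 1 g x)
    (hfx : 0 < f x) (hgx : 0 < g x) {ξ : ℝ × ℝ} (hfξ : 0 < fderiv ℝ f x ξ)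
    (hgξ : fderiv ℝ g x ξ ≤ 0) : 0 < fderiv ℝ (fun y => ramp (f y) (g y)) x ξ := by
  rw [fderiv_ramp hf hg (Or.inl hfx)]
  refine div_pos (sub_pos.2 (lt_of_le_of_lt (b := 0) ?_ ?_))
    (pow_pos (posSq_add_pos (Or.inl hfx)) 2)
  · exact mul_nonpos_of_nonneg_of_nonpos (posSq_nonneg _)
      (mul_nonpos_of_nonneg_of_nonpos (by positivity) hgξ)
  · have : 0 < max (f x) 0 := lt_max_of_lt_left hfx
    exact mul_pos (by positivity) (posSq_pos hgx)

end ramp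

/-- A `C¹` function on the plane, invariant under `v`, whose zero set together with its translates
by multiples of `D` cuts the plane into strips: below its zero set `τ` is negative and the
translate `τ (· - D)` is even smaller than `-m`, above the zero set of `τ (· - D)` it is larger
than `m`. -/
structure StripFunction (v D : ℤ × ℤ) (τ : ℝ × ℝ → ℝ) (m : ℝ) : Prop where
  contDiff : ContDiff ℝ 1 τ
  pos : 0 < m
  period : ∀ x, τ (x + latt v) = τ x
  above : ∀ x, 0 ≤ τ (x - latt D) → m ≤ τ x
  below : ∀ x, τ x ≤ 0 → τ (x - latt D) ≤ -m
  strip : ∀ x, ∃ k : ℤ, 0 ≤ τ (x - latt (k • D)) ∧ τ (x - latt ((k + 1) • D)) < 0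

/-- The translate of a function by `k D`. -/
def translate (D : ℤ × ℤ) (τ : ℝ × ℝ → ℝ) (k : ℤ) (x : ℝ × ℝ) : ℝ := τ (x - latt (k • D))

section translate
variable {D : ℤ × ℤ} {τ : ℝ × ℝ → ℝ}

lemma translate_contDiff (h : ContDiff ℝ 1 τ) (k : ℤ) : ContDiff ℝ 1 (translate D τ k) :=
  h.comp (contDiff_id.sub contDiff_const)

lemma fderiv_translate (h : ContDiff ℝ 1 τ) (k : ℤ) (x : ℝ × ℝ) :
    fderiv ℝ (translate D τ k) x = fderiv ℝ τ (x - latt (k • D)) := by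
  have h1 := ((h.differentiable (by norm_num)) (x - latt (k • D))).hasFDerivAt
  exact (h1.comp x ((hasFDerivAt_id x).sub_const _)).fderiv

lemma translate_zero (x : ℝ × ℝ) : translate D τ 0 x = τ x := by simp [translate]

lemma translate_add_latt (k : ℤ) (x : ℝ × ℝ) :
    translate D τ k (x + latt D) = translate D τ (k - 1) x := by
  simp only [translate, sub_smul, one_smul, map_sub]
  congr 1; abel

lemma translate_add_of_period {v : ℤ × ℤ} (h : ∀ x, τ (x + latt v) = τ x) (k : ℤ) (x : ℝ × ℝ) :
    translate D τ k (x + latt v) = translate D τ k x := by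
  have := h (x - latt (k • D))
  rw [translate, translate, ← this]
  congr 1; abel

end translate

namespace StripFunction
variable {v D : ℤ × ℤ} {τ : ℝ × ℝ → ℝ} {m : ℝ}

lemma le_of_nonneg (h : StripFunction v D τ m) {x : ℝ × ℝ} {j k : ℤ} (hjk : j < k)
    (hk : 0 ≤ translate D τ k x) : m ≤ translate D τ j x := by
  have step : ∀ i : ℤ, 0 ≤ translate D τ (i + 1) x → m ≤ translate D τ i x := by
    intro i hi
    apply h.above
    rwa [sub_sub, ← map_add, ← add_one_zsmul]
  obtain ⟨l, rfl⟩ : ∃ l : ℕ, k = j + 1 + l := ⟨(k - j - 1).toNat, by omega⟩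
  clear hjk
  induction l with
  | zero => exact step j (by simpa using hk)
  | succ l ih =>
    apply ih
    have := step (j + 1 + l) (by push_cast at hk; rwa [← add_assoc] at hk)
    exact h.pos.le.trans this

lemma le_of_nonpos (h : StripFunction v D τ m) {x : ℝ × ℝ} {j k : ℤ} (hjk : j < k)
    (hj : translate D τ j x ≤ 0) : translate D τ k x ≤ -m := by
  have step : ∀ i : ℤ, translate D τ i x ≤ 0 → translate D τ (i + 1) x ≤ -m := by
    intro i hi
    have := h.below _ hi
    rwa [sub_sub, ← map_add, ← add_one_zsmul] at this
  obtain ⟨l, rfl⟩ : ∃ l : ℕ, k = j + 1 + l := ⟨(k - j - 1).toNat, by omega⟩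
  clear hjk
  induction l with
  | zero => simpa using step j hj
  | succ l ih =>
    have := step (j + 1 + l) (ih.trans (by linarith [h.pos]))
    push_cast
    rwa [← add_assoc]

end StripFunction

/-- The elementary step across the `k`-th strip, bounded below by the zero set of the `k`-th
translate of `τ` and above by that of the next one. It is `0` below the strip underneath and `1`
above the strip. The first summand increases inside the strip, but has zero derivative on its
lower boundary; the second one increases across this boundary. -/
noncomputable def stripStep (D : ℤ × ℤ) (τ : ℝ × ℝ → ℝ) (m : ℝ) (k : ℤ) (x : ℝ × ℝ) : ℝ :=
  ramp (translate D τ k x) (-translate D τ (k + 1) x) / 2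
    + ramp (translate D τ k x + m) (m - translate D τ k x) / 2

/-- The height near the `j`-th boundary curve. On this curve the three steps are `1`, `1 / 4`
and `0`, so that the constant `5 / 4` gives it the height `j`. -/
noncomputable def localHeight (D : ℤ × ℤ) (τ : ℝ × ℝ → ℝ) (m : ℝ) (j : ℤ) (x : ℝ × ℝ) : ℝ :=
  j + (stripStep D τ m (j - 1) x + stripStep D τ m j x + stripStep D τ m (j + 1) x) - 5 / 4

/-- The neighbourhood of the `j`-th boundary curve made of the two adjacent open strips and of the
curve itself. -/
def bigStrip (D : ℤ × ℤ) (τ : ℝ × ℝ → ℝ) (j : ℤ) : Set (ℝ × ℝ) :=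
  {x | 0 < translate D τ (j - 1) x ∧ translate D τ (j + 1) x < 0}

namespace StripFunction
variable {v D : ℤ × ℤ} {τ : ℝ × ℝ → ℝ} {m : ℝ}

/-- The denominator of the first ramp does not vanish: two consecutive translates of `τ` cannot
enclose a point from the wrong sides. -/
lemma ramp_admissible (h : StripFunction v D τ m) (k : ℤ) (x : ℝ × ℝ) :
    0 < translate D τ k x ∨ 0 < -translate D τ (k + 1) x := by
  by_contra! hcon
  have := h.le_of_nonpos (lt_add_one k) hcon.1
  linarith [h.pos, hcon.2]

lemma stripStep_eq_one (h : StripFunction v D τ m) {k : ℤ} {x : ℝ × ℝ}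
    (hk : 0 ≤ translate D τ (k + 1) x) : stripStep D τ m k x = 1 := by
  have h1 := h.le_of_nonneg (lt_add_one k) hk
  have := h.pos
  rw [stripStep, ramp_of_nonpos_right (by linarith) (by linarith),
    ramp_of_nonpos_right (by linarith) (by linarith)]
  norm_num

lemma stripStep_eq_zero (h : StripFunction v D τ m) {k : ℤ} {x : ℝ × ℝ}
    (hk : translate D τ (k - 1) x ≤ 0) : stripStep D τ m k x = 0 := by
  have h1 := h.le_of_nonpos (sub_one_lt k) hk
  have := h.pos
  rw [stripStep, ramp_of_nonpos_left (by linarith), ramp_of_nonpos_left (by linarith)]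
  norm_num

lemma ramp_contDiffAt_left (h : StripFunction v D τ m) (k : ℤ) (x : ℝ × ℝ) :
    ContDiffAt ℝ 1 (fun y => ramp (translate D τ k y) (-translate D τ (k + 1) y)) x :=
  contDiffAt_ramp (translate_contDiff h.contDiff k).contDiffAt
    (translate_contDiff h.contDiff (k + 1)).neg.contDiffAt (h.ramp_admissible k x)

lemma ramp_admissible' (h : StripFunction v D τ m) (k : ℤ) (x : ℝ × ℝ) :
    0 < translate D τ k x + m ∨ 0 < m - translate D τ k x := by
  by_contra! hcon
  linarith [h.pos, hcon.1, hcon.2]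

lemma ramp_contDiffAt_right (h : StripFunction v D τ m) (k : ℤ) (x : ℝ × ℝ) :
    ContDiffAt ℝ 1 (fun y => ramp (translate D τ k y + m) (m - translate D τ k y)) x :=
  contDiffAt_ramp ((translate_contDiff h.contDiff k).add contDiff_const).contDiffAt
    (contDiff_const.sub (translate_contDiff h.contDiff k)).contDiffAt (h.ramp_admissible' k x)

lemma stripStep_contDiffAt (h : StripFunction v D τ m) (k : ℤ) (x : ℝ × ℝ) :
    ContDiffAt ℝ 1 (stripStep D τ m k) x :=
  ((h.ramp_contDiffAt_left k x).div_const 2).add ((h.ramp_contDiffAt_right k x).div_const 2)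

section increasing
variable {Z : ℝ × ℝ → ℝ × ℝ}

lemma fderiv_translate_pos (h : StripFunction v D τ m) (hZ : ∀ n x, Z (x + latt n) = Z x)
    (hτ : ∀ x, 0 < fderiv ℝ τ x (Z x)) (k : ℤ) (x : ℝ × ℝ) :
    0 < fderiv ℝ (translate D τ k) x (Z x) := by
  rw [fderiv_translate h.contDiff]
  have := hτ (x - latt (k • D))
  have e := hZ (k • D) (x - latt (k • D))
  rw [sub_add_cancel] at e
  rwa [e]

/-- Each step is nondecreasing along `Z`, and strictly increasing in the strip and on its lower
boundary. -/
lemma fderiv_stripStep (h : StripFunction v D τ m) (hZ : ∀ n x, Z (x + latt n) = Z x)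
    (hτ : ∀ x, 0 < fderiv ℝ τ x (Z x)) (k : ℤ) (x : ℝ × ℝ) :
    0 ≤ fderiv ℝ (stripStep D τ m k) x (Z x) ∧
      (0 ≤ translate D τ k x → translate D τ (k + 1) x < 0 →
        0 < fderiv ℝ (stripStep D τ m k) x (Z x)) := by
  have dk := h.fderiv_translate_pos hZ hτ k x
  have dk1 := h.fderiv_translate_pos hZ hτ (k + 1) x
  have ck := (translate_contDiff (D := D) h.contDiff k).contDiffAt (x := x)
  have ck1 := (translate_contDiff (D := D) h.contDiff (k + 1)).contDiffAt (x := x)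
  have n1 : fderiv ℝ (fun y => -translate D τ (k + 1) y) x (Z x) ≤ 0 := by
    rw [fderiv_fun_neg]; simpa using dk1.le
  have p2 : 0 < fderiv ℝ (fun y => translate D τ k y + m) x (Z x) := by
    rw [fderiv_add_const]; exact dk
  have n2 : fderiv ℝ (fun y => m - translate D τ k y) x (Z x) ≤ 0 := by
    rw [fderiv_const_sub]; simpa using dk.le
  have r1 := fderiv_ramp_nonneg ck ck1.neg (h.ramp_admissible k x) dk.le n1
  have r2 := fderiv_ramp_nonneg (ck.add contDiffAt_const) (contDiffAt_const.sub ck)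
    (h.ramp_admissible' k x) p2.le n2
  have e : fderiv ℝ (stripStep D τ m k) x (Z x)
      = fderiv ℝ (fun y => ramp (translate D τ k y) (-translate D τ (k + 1) y)) x (Z x) / 2
        + fderiv ℝ (fun y => ramp (translate D τ k y + m) (m - translate D τ k y)) x (Z x) / 2 := by
    have a1 := ((h.ramp_contDiffAt_left k x).differentiableAt (by norm_num)).hasFDerivAt
    have a2 := ((h.ramp_contDiffAt_right k x).differentiableAt (by norm_num)).hasFDerivAt
    have := ((a1.mul_const (2⁻¹ : ℝ)).add (a2.mul_const (2⁻¹ : ℝ))).congr_of_eventuallyEq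
      (f₁ := stripStep D τ m k) (Filter.Eventually.of_forall fun y => by
        simp [stripStep, div_eq_mul_inv])
    rw [this.fderiv]
    simp [div_eq_mul_inv, mul_comm]
  rw [e]
  refine ⟨by positivity, fun h0 h1 => ?_⟩
  rcases h0.eq_or_lt with h0 | h0
  · have := fderiv_ramp_pos (ck.add (contDiffAt_const (c := m))) ((contDiffAt_const (c := m)).sub ck)
      (by rw [← h0]; linarith [h.pos]) (by rw [← h0]; linarith [h.pos]) p2 n2
    linarith
  · have := fderiv_ramp_pos ck ck1.neg h0 (by linarith) dk n1
    linarith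

end increasing

lemma isOpen_bigStrip (h : StripFunction v D τ m) (j : ℤ) : IsOpen (bigStrip D τ j) :=
  (isOpen_lt continuous_const (translate_contDiff h.contDiff _).continuous).inter
    (isOpen_lt (translate_contDiff h.contDiff _).continuous continuous_const)

lemma exists_bigStrip (h : StripFunction v D τ m) (x : ℝ × ℝ) : ∃ j, x ∈ bigStrip D τ j := by
  obtain ⟨k, hk, hk1⟩ := h.strip x
  exact ⟨k, h.pos.trans_le (h.le_of_nonneg (sub_one_lt k) hk), hk1⟩

/-- The local heights agree on overlaps. -/
lemma localHeight_eq (h : StripFunction v D τ m) {x : ℝ × ℝ} {j k : ℤ} (hj : x ∈ bigStrip D τ j)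
    (hk : x ∈ bigStrip D τ k) : localHeight D τ m j x = localHeight D τ m k x := by
  have key : ∀ j k : ℤ, j < k → x ∈ bigStrip D τ j → x ∈ bigStrip D τ k →
      localHeight D τ m j x = localHeight D τ m k x := by
    intro j k hlt hj hk
    have hk1 : k = j + 1 := by
      by_contra hne
      have hlt' : j + 1 ≤ k - 1 := by omega
      have h1 : translate D τ (j + 1) x < 0 := hj.2
      have h2 : 0 < translate D τ (k - 1) x := hk.1
      rcases hlt'.eq_or_lt with heq | hlt'
      · rw [heq] at h1; linarith
      · linarith [h.le_of_nonneg hlt' h2.le, h.pos]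
    subst hk1
    have e1 : stripStep D τ m (j - 1) x = 1 := h.stripStep_eq_one (by
      have := hk.1.le; rw [add_sub_cancel_right] at this; rwa [sub_add_cancel])
    have e2 : stripStep D τ m (j + 1 + 1) x = 0 := h.stripStep_eq_zero (by
      rw [add_sub_cancel_right]; exact hj.2.le)
    unfold localHeight
    rw [e1, e2, add_sub_cancel_right]
    push_cast; ring
  rcases lt_trichotomy j k with hlt | rfl | hlt
  · exact key j k hlt hj hk
  · rfl
  · exact (key k j hlt hk hj).symm

/-- There is a height function on the plane that passes to a circle-valued function on the torus,
vanishes on the zero set of `τ`, and increases along every periodic vector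
field along which `τ` increases. -/
lemma exists_height (h : StripFunction v D τ m) :
    ∃ t : ℝ × ℝ → ℝ, ContDiff ℝ 1 t ∧ (∀ x, t (x + latt v) = t x) ∧
      (∀ x, t (x + latt D) = t x + 1) ∧ (∀ x, τ x = 0 → t x = 0) ∧
      ∀ Z : ℝ × ℝ → ℝ × ℝ, (∀ n x, Z (x + latt n) = Z x) → (∀ x, 0 < fderiv ℝ τ x (Z x)) →
        ∀ x, 0 < fderiv ℝ t x (Z x) := by
  choose J hJ using h.exists_bigStrip
  let t : ℝ × ℝ → ℝ := fun x => localHeight D τ m (J x) x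
  have ht : ∀ j x, x ∈ bigStrip D τ j → t x = localHeight D τ m j x := fun j x hx =>
    h.localHeight_eq (hJ x) hx
  have hev : ∀ j x, x ∈ bigStrip D τ j → t =ᶠ[𝓝 x] localHeight D τ m j := by
    intro j x hx
    filter_upwards [(h.isOpen_bigStrip j).mem_nhds hx] with y hy using ht j y hy
  have hlC : ∀ j x, ContDiffAt ℝ 1 (localHeight D τ m j) x := fun j x =>
    (contDiffAt_const.add (((h.stripStep_contDiffAt _ x).add (h.stripStep_contDiffAt _ x)).add
      (h.stripStep_contDiffAt _ x))).sub contDiffAt_const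
  refine ⟨t, contDiff_iff_contDiffAt.2 fun x => (hlC (J x) x).congr_of_eventuallyEq
    (hev (J x) x (hJ x)), fun x => ?_, fun x => ?_, fun x hx => ?_, fun Z hZ hτ x => ?_⟩
  · have hx : x + latt v ∈ bigStrip D τ (J x) := by
      have := hJ x
      simpa only [bigStrip, mem_ofPred_eq, translate_add_of_period h.period] using this
    rw [ht (J x) _ hx]
    simp only [t, localHeight, stripStep, translate_add_of_period h.period]
  · have hx : x + latt D ∈ bigStrip D τ (J x + 1) := by
      have := hJ x
      simpa only [bigStrip, mem_ofPred_eq, translate_add_latt, add_sub_cancel_right] using this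
    have hS : ∀ k, stripStep D τ m k (x + latt D) = stripStep D τ m (k - 1) x := by
      intro k
      simp only [stripStep, translate_add_latt, add_sub_cancel_right, sub_add_cancel]
    rw [ht _ _ hx]
    simp only [t, localHeight, hS, add_sub_cancel_right]
    push_cast; ring
  · have h0 : translate D τ 0 x = 0 := by rw [translate_zero, hx]
    have hm1 := h.le_of_nonneg (show (-1 : ℤ) < 0 by norm_num) h0.ge
    have hp1 := h.le_of_nonpos (show (0 : ℤ) < 1 by norm_num) h0.le
    have hm := h.pos
    have hmem : x ∈ bigStrip D τ 0 := by
      refine ⟨?_, ?_⟩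
      · rw [zero_sub]; linarith
      · rw [zero_add]; linarith
    rw [ht 0 x hmem, localHeight, h.stripStep_eq_one (by simp [h0]),
      h.stripStep_eq_zero (k := 0 + 1) (by simp [h0]), stripStep, h0,
      ramp_of_nonpos_left le_rfl]
    have : ramp (0 + m) (m - 0) = 1 / 2 := by
      have := (posSq_pos hm).ne'
      rw [ramp, zero_add, sub_zero]; field_simp; norm_num
    rw [this]; norm_num
  · rw [(hev (J x) x (hJ x)).fderiv_eq]
    set j := J x with hj
    have d := fun k => ((h.stripStep_contDiffAt k x).differentiableAt (by norm_num)).hasFDerivAt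
    have e : HasFDerivAt (localHeight D τ m j) (fderiv ℝ (stripStep D τ m (j - 1)) x
        + fderiv ℝ (stripStep D τ m j) x + fderiv ℝ (stripStep D τ m (j + 1)) x) x :=
      ((((d (j - 1)).add (d j)).add (d (j + 1))).const_add (j : ℝ)).sub_const (5 / 4)
    rw [e.fderiv]
    simp only [add_apply]
    have f1 := h.fderiv_stripStep hZ hτ (j - 1) x
    have f2 := h.fderiv_stripStep hZ hτ j x
    have f3 := h.fderiv_stripStep hZ hτ (j + 1) x
    obtain ⟨hj1, hj2⟩ := hJ x
    rw [← hj] at hj1 hj2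
    rcases le_or_gt 0 (translate D τ j x) with h0 | h0
    · linarith [f1.1, f2.2 h0 hj2, f3.1]
    · linarith [f1.2 hj1.le (by rwa [sub_add_cancel]), f2.1, f3.1]

end StripFunction

/-! ### Height and leaf coordinate as coordinates on the plane -/

/-- A nowhere vanishing continuous function on a connected space has constant sign. -/
lemma exists_sign_of_ne_zero {α : Type*} [TopologicalSpace α] [PreconnectedSpace α] {f : α → ℝ}
    (hf : Continuous f) (h0 : ∀ x, f x ≠ 0) :
    ∃ ε : ℝ, (ε = 1 ∨ ε = -1) ∧ ∀ x, 0 < ε * f x := by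
  have hr : (range f).OrdConnected := (isPreconnected_range hf).ordConnected
  by_cases h : ∀ x, 0 < f x
  · exact ⟨1, Or.inl rfl, fun x => by simpa using h x⟩
  · push Not at h
    obtain ⟨y, hy⟩ := h
    refine ⟨-1, Or.inr rfl, fun x => ?_⟩
    by_contra! hx
    obtain ⟨z, hz⟩ := hr.out (mem_range_self y) (mem_range_self x) ⟨hy, by linarith⟩
    exact h0 z hz

lemma exists_pos_le_of_periodic {f : ℝ → ℝ} (hf : Continuous f) (hper : ∀ s, f (s + 1) = f s)
    (hpos : ∀ s, 0 < f s) : ∃ m > 0, ∀ s, m ≤ f s := by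
  obtain ⟨s₀, -, hs₀⟩ := isCompact_Icc.exists_isMinOn (nonempty_Icc.2 zero_le_one) hf.continuousOn
  refine ⟨f s₀, hpos s₀, fun s => ?_⟩
  obtain ⟨y, hy, hys⟩ := Function.Periodic.exists_mem_Ico₀ hper one_pos s
  rw [hys]
  exact hs₀ (Ico_subset_Icc_self hy)

lemma apply_add_latt_zsmul {f : ℝ × ℝ → ℝ} {D : ℤ × ℤ} (h : ∀ x, f (x + latt D) = f x + 1)
    (k : ℤ) (x : ℝ × ℝ) : f (x + latt (k • D)) = f x + k := by
  induction k using Int.induction_on generalizing x with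
  | zero => simp
  | succ i ih =>
    rw [add_smul, one_smul, map_add, ← add_assoc, h, ih]; push_cast; ring
  | pred i ih =>
    have e : x + latt ((-(i : ℤ) - 1) • D) + latt D = x + latt (-(i : ℤ) • D) := by
      rw [sub_smul, one_smul, map_sub]; abel
    have := h (x + latt ((-(i : ℤ) - 1) • D))
    rw [e, ih] at this
    push_cast at this ⊢; linarith

/-- A function with positive derivative along `X` increases along the orbits. -/
lemma IsFlowOf.strictMono {X : ℝ × ℝ → ℝ × ℝ} {Φ : ℝ → ℝ × ℝ → ℝ × ℝ} (hΦ : IsFlowOf X Φ)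
    {f : ℝ × ℝ → ℝ} (hf : ContDiff ℝ 1 f) (hpos : ∀ x, 0 < fderiv ℝ f x (X x)) (x : ℝ × ℝ) :
    StrictMono fun r => f (Φ r x) :=
  strictMono_of_hasDerivAt_pos
    (fun r => ((hf.differentiable (by norm_num) (Φ r x)).hasFDerivAt).comp_hasDerivAt r
      (hΦ.hasDerivAt x r)) fun _ => hpos _

namespace LeafCoordinate
variable {X : ℝ × ℝ → ℝ × ℝ} {Φ : ℝ → ℝ × ℝ → ℝ × ℝ} {c : ℝ → ℝ × ℝ} {v D : ℤ × ℤ}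
  {u : ℝ × ℝ → ℝ}

/-- A point of `c - k D`, carried along its orbit, is on `c` at a time of the sign of `k`, at least
linear in `k`. -/
lemma exists_shift (h : LeafCoordinate X Φ c v D u) :
    ∃ δ > 0, ∀ k : ℤ, ∀ s, ∃ t s', c s - latt (k • D) = Φ (-t) (c s') ∧
      (0 ≤ k → k * δ ≤ t) ∧ (k ≤ 0 → t ≤ k * δ) := by
  obtain ⟨δ, hδ, hc⟩ := h.crossing
  refine ⟨δ, hδ, fun k s => ?_⟩
  obtain ⟨t, s', h1, h2⟩ := hc k s
  refine ⟨t, s', ?_, h2⟩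
  have e : Φ t (c s - latt (k • D)) = c s' := by
    rw [sub_eq_add_neg, ← map_neg, h.flow_translate, h1, map_neg, add_neg_cancel_right]
  rw [← e, h.globalSection.flow.neg_apply]

/-- A function that vanishes on the section and increases along the leaves is a strip function:
its sign at a point tells on which side of the section the point lies on its leaf. -/
lemma exists_stripFunction (h : LeafCoordinate X Φ c v D u) {τ : ℝ × ℝ → ℝ}
    (hτ : ContDiff ℝ 1 τ) (hper : ∀ x, τ (x + latt v) = τ x) (hcurve : ∀ s, τ (c s) = 0)
    (hpos : ∀ x, 0 < fderiv ℝ τ x (X x)) : ∃ m, StripFunction v D τ m := by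
  have mono := h.globalSection.flow.strictMono hτ hpos
  have hΦ0 : ∀ x, Φ 0 x = x := h.globalSection.flow.zero
  have hnn : ∀ r s, 0 ≤ τ (Φ r (c s)) ↔ 0 ≤ r := by
    intro r s
    have := (mono (c s)).le_iff_le (a := 0) (b := r)
    simpa [hΦ0, hcurve] using this
  have hnp : ∀ r s, τ (Φ r (c s)) ≤ 0 ↔ r ≤ 0 := by
    intro r s
    have := (mono (c s)).le_iff_le (a := r) (b := 0)
    simpa [hΦ0, hcurve] using this
  have hsub : ∀ (n : ℤ × ℤ) r x, Φ r x - latt n = Φ r (x - latt n) := by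
    intro n r x
    rw [sub_eq_add_neg, sub_eq_add_neg, ← map_neg, h.flow_translate]
  obtain ⟨δ, hδ, hshift⟩ := h.exists_shift
  have hcc : Continuous c := h.globalSection.curve.contDiff.continuous
  have hpD : ∀ s, 0 < τ (c s + latt D) := by
    intro s
    obtain ⟨t, s', e, -, ht⟩ := hshift (-1) s
    rw [neg_one_smul, map_neg, sub_neg_eq_add] at e
    rw [e]
    have := ht (by norm_num)
    push_cast at this
    by_contra! hcon
    linarith [(hnp _ _).1 hcon]
  have hnD : ∀ s, 0 < -τ (c s - latt D) := by
    intro s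
    obtain ⟨t, s', e, ht, -⟩ := hshift 1 s
    rw [one_smul] at e
    rw [e]
    have := ht (by norm_num)
    push_cast at this
    by_contra! hcon
    linarith [(hnn (-t) s').1 (by linarith)]
  have hτc := hτ.continuous
  -- the constant is the minimum over one period of `|τ|` on the two neighbouring translates of `c`
  obtain ⟨m, hm, hle⟩ := exists_pos_le_of_periodic
    (f := fun s => min (τ (c s + latt D)) (-τ (c s - latt D))) (by fun_prop) (fun s => by
      have e1 := hper (c s + latt D)
      have e2 := hper (c s - latt D)
      rw [add_right_comm] at e1
      rw [sub_add_eq_add_sub] at e2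
      simp only [h.globalSection.period, e1, e2]) fun s => lt_min (hpD s) (hnD s)
  refine ⟨m, hτ, hm, hper, fun x hx => ?_, fun x hx => ?_, fun x => ?_⟩
  · obtain ⟨r, hr⟩ := h.exists_time (x - latt D)
    set s := u (x - latt D)
    have hr0 : 0 ≤ r := by rw [← hr] at hx; exact (hnn _ _).1 hx
    have e : x = Φ r (c s + latt D) := by rw [h.flow_translate, hr, sub_add_cancel]
    have := (mono (c s + latt D)).monotone hr0
    simp only [hΦ0] at this
    rw [e]
    exact ((hle s).trans (min_le_left _ _)).trans this
  · obtain ⟨r, hr⟩ := h.exists_time x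
    set s := u x
    have hr0 : r ≤ 0 := by rw [← hr] at hx; exact (hnp _ _).1 hx
    have := (mono (c s - latt D)).monotone hr0
    simp only [hΦ0] at this
    rw [← hr, hsub]
    linarith [(hle s).trans (min_le_right _ _)]
  · obtain ⟨r, hr⟩ := h.exists_time x
    set s := u x
    have key : ∀ k : ℤ, ∃ t : ℝ, (0 ≤ τ (x - latt (k • D)) ↔ t ≤ r) ∧
        (0 ≤ k → k * δ ≤ t) ∧ (k ≤ 0 → t ≤ k * δ) := by
      intro k
      obtain ⟨t, s', e, ht⟩ := hshift k s
      refine ⟨t, ?_, ht⟩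
      rw [← hr, hsub, e, ← h.globalSection.flow.add, hnn, ← sub_eq_add_neg, sub_nonneg]
    obtain ⟨N, hN⟩ := exists_nat_gt (|r| / δ)
    rw [div_lt_iff₀ hδ] at hN
    obtain ⟨k, hk, hmax⟩ := Int.exists_greatest_of_bdd
      (P := fun k : ℤ => 0 ≤ τ (x - latt (k • D))) ⟨N, fun k hk => by
        by_contra! hlt
        obtain ⟨t, h1, h2, -⟩ := key k
        have := h2 (by omega)
        have hNk : (N : ℝ) ≤ k := by exact_mod_cast hlt.le
        have := mul_le_mul_of_nonneg_right hNk hδ.le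
        linarith [h1.1 hk, le_abs_self r]⟩ ⟨-N, by
        obtain ⟨t, h1, -, h3⟩ := key (-N)
        refine h1.2 ?_
        have := h3 (by omega)
        push_cast at this
        linarith [neg_abs_le r]⟩
    refine ⟨k, hk, ?_⟩
    by_contra! hcon
    have := hmax _ hcon
    omega

/-- The leaf coordinate of the translate `x - k D` is an increasing function of that of `x`,
commuting with the translation by `1`. -/
lemma exists_translate_eq (h : LeafCoordinate X Φ c v D u) (k : ℤ) :
    ∃ f : ℝ → ℝ, Continuous f ∧ StrictMono f ∧ (∀ s, f (s + 1) = f s + 1) ∧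
      ∀ x, translate D u k x = f (u x) := by
  refine ⟨fun s => u (c s - latt (k • D)), ?_, ?_, ?_, ?_⟩
  · exact h.contDiff.continuous.comp
      (h.globalSection.curve.contDiff.continuous.sub continuous_const)
  · have hd : ∀ s, HasDerivAt (fun s => u (c s - latt (k • D)))
        (fderiv ℝ u (c s - latt (k • D)) (deriv c s)) s := fun s =>
      (h.hasFDerivAt _).comp_hasDerivAt s ((h.globalSection.curve.hasDerivAt s).sub_const _)
    refine strictMono_of_hasDerivAt_pos hd fun s => ?_
    obtain ⟨κ, hκ, e⟩ := h.fderiv_eq (c s - latt (k • D))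
    have e2 := h.field_period (k • D) (c s - latt (k • D))
    rw [sub_add_cancel] at e2
    rw [e, ← e2]
    exact mul_pos hκ (h.globalSection.curve.cross_pos s)
  · intro s
    simp only
    rw [h.globalSection.period, ← sub_add_eq_add_sub, h.add_latt]
  · intro x
    obtain ⟨r, hr⟩ := h.exists_time x
    have := h.flow_apply r (c (u x) - latt (k • D))
    rwa [sub_eq_add_neg, ← map_neg, h.flow_translate, hr, map_neg, ← sub_eq_add_neg,
      ← sub_eq_add_neg] at this

/-- The leaf coordinate and a height function increasing along the leaves are coordinates on the
plane: on each leaf the height takes all integer values, on the translates of the section. -/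
lemma existsUnique_of_height (h : LeafCoordinate X Φ c v D u) {t : ℝ × ℝ → ℝ}
    (ht : ContDiff ℝ 1 t) (hD : ∀ x, t (x + latt D) = t x + 1) (hcurve : ∀ s, t (c s) = 0)
    (hpos : ∀ x, 0 < fderiv ℝ t x (X x)) (s T : ℝ) : ∃! x, u x = s ∧ t x = T := by
  have mono := h.globalSection.flow.strictMono ht hpos (c s)
  obtain ⟨δ, -, hc⟩ := h.crossing
  have hval : ∀ k : ℤ, ∃ r, t (Φ r (c s)) = k := by
    intro k
    obtain ⟨r, s', e, -⟩ := hc k s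
    exact ⟨r, by rw [e, apply_add_latt_zsmul hD, hcurve, zero_add]⟩
  obtain ⟨r₁, h1⟩ := hval ⌊T⌋
  obtain ⟨r₂, h2⟩ := hval ⌈T⌉
  have hcont : Continuous fun r => t (Φ r (c s)) :=
    continuous_iff_continuousAt.2 fun r =>
      (((ht.differentiable (by norm_num) (Φ r (c s))).hasFDerivAt).comp_hasDerivAt r
        (h.globalSection.flow.hasDerivAt (c s) r)).continuousAt
  obtain ⟨r, hr⟩ := mem_range_of_exists_le_of_exists_ge hcont
    ⟨r₁, h1.trans_le (Int.floor_le T)⟩ ⟨r₂, (Int.le_ceil T).trans_eq h2.symm⟩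
  refine ⟨Φ r (c s), ⟨h.apply_flow s r, hr⟩, ?_⟩
  rintro y ⟨hy1, hy2⟩
  obtain ⟨r', hr'⟩ := h.exists_time y
  rw [hy1] at hr'
  have : r' = r := mono.injective (by simp only [hr', hy2, hr])
  rw [← hr', this]

end LeafCoordinate

/-! ### The angular coordinate and the straightening of the plane -/

/-- The inverse of a `C¹` bijection of the plane without critical points is `C¹`. -/
lemma contDiff_of_inverse {Θ Λ : ℝ × ℝ → ℝ × ℝ} (hΘ : ContDiff ℝ 1 Θ)
    (hl : ∀ x, Λ (Θ x) = x) (hr : ∀ y, Θ (Λ y) = y)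
    (hinj : ∀ x ξ, fderiv ℝ Θ x ξ = 0 → ξ = 0) : ContDiff ℝ 1 Λ := by
  rw [contDiff_iff_contDiffAt]
  intro y
  have hi : Function.Injective (fderiv ℝ Θ (Λ y) : ℝ × ℝ →ₗ[ℝ] ℝ × ℝ) :=
    (injective_iff_map_eq_zero _).2 fun ξ => hinj (Λ y) ξ
  let e := (LinearEquiv.ofInjectiveEndo _ hi).toContinuousLinearEquiv
  have hd : HasFDerivAt Θ (e : ℝ × ℝ →L[ℝ] ℝ × ℝ) (Λ y) := by
    have e1 : (e : ℝ × ℝ →L[ℝ] ℝ × ℝ) = fderiv ℝ Θ (Λ y) := by ext <;> rfl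
    rw [e1]
    exact (hΘ.differentiable (by norm_num) _).hasFDerivAt
  have h1 := hΘ.contDiffAt.to_localInverse hd (by norm_num)
  have h2 := (hΘ.contDiffAt.hasStrictFDerivAt' hd (by norm_num)).eventually_right_inverse
  rw [hr] at h1 h2
  refine h1.congr_of_eventuallyEq ?_
  filter_upwards [h2] with z hz
  have := congrArg Λ hz
  rw [hl] at this
  exact this.symm

/-- A continuous map of the line commuting with the translation by `1` is onto. -/
lemma surjective_of_add_one {f : ℝ → ℝ} (hf : Continuous f) (h1 : ∀ s, f (s + 1) = f s + 1) :
    Function.Surjective f := by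
  have hk : ∀ k : ℤ, f k = f 0 + k := by
    intro k
    induction k using Int.induction_on with
    | zero => simp
    | succ i ih => push_cast at ih ⊢; rw [h1, ih]; ring
    | pred i ih =>
      have := h1 (-(i : ℝ) - 1)
      rw [sub_add_cancel] at this
      push_cast at ih ⊢; linarith
  intro T
  refine mem_range_of_exists_le_of_exists_ge hf ⟨(⌊T - f 0⌋ : ℤ), ?_⟩ ⟨(⌈T - f 0⌉ : ℤ), ?_⟩
  · rw [hk]; linarith [Int.floor_le (T - f 0)]
  · rw [hk]; linarith [Int.le_ceil (T - f 0)]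

/-- The weight with which the `(k + 1)`-st translate of the leaf coordinate enters the angular
coordinate, at height between `k` and `k + 1`. -/
noncomputable def weight (t : ℝ × ℝ → ℝ) (k : ℤ) (x : ℝ × ℝ) : ℝ := ramp (t x - k) (1 - (t x - k))

/-- The angular coordinate: at height `k` it is the leaf coordinate translated by `k D`, and it
interpolates between these translates at the other heights. -/
noncomputable def angle (D : ℤ × ℤ) (u t : ℝ × ℝ → ℝ) (x : ℝ × ℝ) : ℝ :=
  translate D u ⌊t x⌋ x
    + weight t ⌊t x⌋ x * (translate D u (⌊t x⌋ + 1) x - translate D u ⌊t x⌋ x)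

/-- A single expression for the angular coordinate at heights between `j - 1` and `j + 1`. -/
noncomputable def localAngle (D : ℤ × ℤ) (u t : ℝ × ℝ → ℝ) (j : ℤ) (x : ℝ × ℝ) : ℝ :=
  translate D u (j - 1) x + weight t (j - 1) x * (translate D u j x - translate D u (j - 1) x)
    + weight t j x * (translate D u (j + 1) x - translate D u j x)

section angle
variable {D : ℤ × ℤ} {u t : ℝ × ℝ → ℝ}

lemma weight_eq_zero {k : ℤ} {x : ℝ × ℝ} (h : t x ≤ k) : weight t k x = 0 :=
  ramp_of_nonpos_left (by linarith)

lemma weight_eq_one {k : ℤ} {x : ℝ × ℝ} (h : k + 1 ≤ t x) : weight t k x = 1 :=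
  ramp_of_nonpos_right (by linarith) (by linarith)

lemma weight_admissible (k : ℤ) (x : ℝ × ℝ) : 0 < t x - k ∨ 0 < 1 - (t x - k) := by
  by_contra! h; linarith [h.1, h.2]

lemma weight_contDiffAt (ht : ContDiff ℝ 1 t) (k : ℤ) (x : ℝ × ℝ) :
    ContDiffAt ℝ 1 (weight t k) x :=
  contDiffAt_ramp (ht.sub contDiff_const).contDiffAt
    (contDiff_const.sub (ht.sub contDiff_const)).contDiffAt (weight_admissible k x)

lemma fderiv_weight (ht : ContDiff ℝ 1 t) (k : ℤ) {x ξ : ℝ × ℝ} (hξ : fderiv ℝ t x ξ = 0) :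
    fderiv ℝ (weight t k) x ξ = 0 := by
  have h1 : fderiv ℝ (fun y => t y - k) x ξ = 0 := by rw [fderiv_sub_const, hξ]
  have h2 : fderiv ℝ (fun y => 1 - (t y - k)) x ξ = 0 := by
    rw [fderiv_const_sub, neg_apply, h1, neg_zero]
  have := fderiv_ramp (ht.sub contDiff_const).contDiffAt
    (contDiff_const.sub (ht.sub contDiff_const)).contDiffAt (weight_admissible k x) ξ
  unfold weight
  rw [this, h1, h2]
  simp

lemma angle_eq_localAngle {j : ℤ} {x : ℝ × ℝ} (h1 : j - 1 < t x) (h2 : t x < j + 1) :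
    angle D u t x = localAngle D u t j x := by
  rcases le_or_gt (j : ℝ) (t x) with h | h
  · have hJ : ⌊t x⌋ = j := Int.floor_eq_iff.2 ⟨h, h2⟩
    rw [angle, localAngle, hJ, weight_eq_one (k := j - 1) (by push_cast; linarith)]
    ring
  · have hJ : ⌊t x⌋ = j - 1 := Int.floor_eq_iff.2 (by push_cast; constructor <;> linarith)
    rw [angle, localAngle, hJ, weight_eq_zero (k := j) h.le, sub_add_cancel]
    ring

lemma angle_eventuallyEq (ht : ContDiff ℝ 1 t) (x : ℝ × ℝ) :
    angle D u t =ᶠ[𝓝 x] localAngle D u t ⌊t x⌋ := by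
  have hx1 := Int.floor_le (t x)
  have hx2 := Int.lt_floor_add_one (t x)
  filter_upwards [ht.continuous.continuousAt.eventually (isOpen_Ioo.mem_nhds
    (⟨by linarith, hx2⟩ : t x ∈ Ioo ((⌊t x⌋ : ℝ) - 1) (⌊t x⌋ + 1)))] with y hy
  exact angle_eq_localAngle hy.1 hy.2

lemma localAngle_contDiffAt (hu : ContDiff ℝ 1 u) (ht : ContDiff ℝ 1 t) (j : ℤ) (x : ℝ × ℝ) :
    ContDiffAt ℝ 1 (localAngle D u t j) x := by
  have h := fun k => (translate_contDiff (D := D) hu k).contDiffAt (x := x)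
  exact ((h _).add ((weight_contDiffAt ht _ x).mul ((h _).sub (h _)))).add
    ((weight_contDiffAt ht _ x).mul ((h _).sub (h _)))

lemma angle_contDiff (hu : ContDiff ℝ 1 u) (ht : ContDiff ℝ 1 t) : ContDiff ℝ 1 (angle D u t) :=
  contDiff_iff_contDiffAt.2 fun x =>
    (localAngle_contDiffAt hu ht _ x).congr_of_eventuallyEq (angle_eventuallyEq ht x)

/-- On the vectors tangent to the level sets of the height, the differential of the angle is a
convex combination of differentials of translates of the leaf coordinate. -/
lemma fderiv_angle (hu : ContDiff ℝ 1 u) (ht : ContDiff ℝ 1 t) {x ξ : ℝ × ℝ}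
    (hξ : fderiv ℝ t x ξ = 0) :
    fderiv ℝ (angle D u t) x ξ = (1 - weight t ⌊t x⌋ x) * fderiv ℝ (translate D u ⌊t x⌋) x ξ
      + weight t ⌊t x⌋ x * fderiv ℝ (translate D u (⌊t x⌋ + 1)) x ξ := by
  rw [(angle_eventuallyEq ht x).fderiv_eq]
  have d := fun k => ((translate_contDiff (D := D) hu k).differentiable (by norm_num) x).hasFDerivAt
  have b := fun k => ((weight_contDiffAt ht k x).differentiableAt (by norm_num)).hasFDerivAt
  set j := ⌊t x⌋ with hj
  have e : HasFDerivAt (localAngle D u t j) _ x :=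
    ((d (j - 1)).add ((b (j - 1)).mul ((d j).sub (d (j - 1))))).add
      ((b j).mul ((d (j + 1)).sub (d j)))
  have h1 : weight t (j - 1) x = 1 := weight_eq_one (by
    have := Int.floor_le (t x); rw [← hj] at this; push_cast; linarith)
  rw [e.fderiv]
  simp only [add_apply, sub_apply, smul_apply, smul_eq_mul, fderiv_weight ht _ hξ, h1, mul_zero,
    add_zero]
  ring

lemma angle_add_latt (htD : ∀ x, t (x + latt D) = t x + 1) (x : ℝ × ℝ) :
    angle D u t (x + latt D) = angle D u t x := by
  have hw : weight t (⌊t x⌋ + 1) (x + latt D) = weight t ⌊t x⌋ x := by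
    simp only [weight, htD]; push_cast; congr 1 <;> ring
  simp only [angle, htD, Int.floor_add_one, translate_add_latt, add_sub_cancel_right] at hw ⊢
  rw [hw]

lemma angle_add_latt_of_period {v : ℤ × ℤ} (huv : ∀ x, u (x + latt v) = u x + 1)
    (htv : ∀ x, t (x + latt v) = t x) (x : ℝ × ℝ) :
    angle D u t (x + latt v) = angle D u t x + 1 := by
  have hu : ∀ k, translate D u k (x + latt v) = translate D u k x + 1 := by
    intro k
    rw [translate, ← sub_add_eq_add_sub, huv, translate]
  simp only [angle, weight, htv, hu]
  ring

end angle

/-- On each level of the height function, the angular coordinate is an increasing function of the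
leaf coordinate, with the whole line as its range. -/
lemma LeafCoordinate.exists_angle_eq {X : ℝ × ℝ → ℝ × ℝ} {Φ : ℝ → ℝ × ℝ → ℝ × ℝ}
    {c : ℝ → ℝ × ℝ} {v D : ℤ × ℤ} {u : ℝ × ℝ → ℝ} (h : LeafCoordinate X Φ c v D u)
    (t : ℝ × ℝ → ℝ) (T : ℝ) :
    ∃ g : ℝ → ℝ, Function.Bijective g ∧ ∀ x, t x = T → angle D u t x = g (u x) := by
  obtain ⟨f₀, hc₀, hm₀, hp₀, he₀⟩ := h.exists_translate_eq ⌊T⌋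
  obtain ⟨f₁, hc₁, hm₁, hp₁, he₁⟩ := h.exists_translate_eq (⌊T⌋ + 1)
  set b := ramp (T - ⌊T⌋) (1 - (T - ⌊T⌋))
  have hb0 : 0 ≤ b := ramp_nonneg _ _
  have hb1 : b ≤ 1 := ramp_le_one _ _
  refine ⟨fun s => f₀ s + b * (f₁ s - f₀ s), ⟨StrictMono.injective fun s s' hs => ?_,
    surjective_of_add_one (by fun_prop) fun s => ?_⟩, ?_⟩
  · have e0 := hm₀ hs
    have e1 := hm₁ hs
    have := mul_le_mul_of_nonneg_left e1.le hb0
    rcases hb1.eq_or_lt with h1 | h1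
    · simp only [h1]; linarith
    · have := mul_lt_mul_of_pos_left e0 (sub_pos.2 h1)
      linarith
  · simp only [hp₀, hp₁]; ring
  · rintro x rfl
    rw [angle, weight, he₀, he₁]

/-- The two families of leaves, and the translates of the common section, can be straightened
simultaneously: there are equivariant `C¹` coordinates on the plane whose second one increases
along the leaves of both families and vanishes exactly on the section. -/
theorem LeafCoordinate.exists_straightening {X Y : ℝ × ℝ → ℝ × ℝ} {Φ Ψ : ℝ → ℝ × ℝ → ℝ × ℝ}
    {c : ℝ → ℝ × ℝ} {v D D' : ℤ × ℤ} {u w : ℝ × ℝ → ℝ} (hX : LeafCoordinate X Φ c v D u)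
    (hY : LeafCoordinate Y Ψ c v D' w) (hXY : ∀ x, cross (X x) (Y x) ≠ 0) :
    ∃ Θ Λ : ℝ × ℝ → ℝ × ℝ, ContDiff ℝ 1 Θ ∧ ContDiff ℝ 1 Λ ∧ (∀ x, Λ (Θ x) = x) ∧
      (∀ y, Θ (Λ y) = y) ∧ (∀ x, Θ (x + latt v) = Θ x + (1, 0)) ∧
      (∀ x, Θ (x + latt D) = Θ x + (0, 1)) ∧ (∀ x, (Θ x).2 = 0 ↔ ∃ s, c s = x) ∧
      (∀ x, 0 < (fderiv ℝ Θ x (X x)).2) ∧ ∀ x, 0 < (fderiv ℝ Θ x (Y x)).2 := by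
  obtain ⟨ε, -, hε⟩ := exists_sign_of_ne_zero (f := fun x => cross (X x) (Y x))
    (continuous_cross hX.globalSection.lineField.continuous
      hY.globalSection.lineField.continuous) hXY
  -- `u` is constant along `X` and monotone along `Y`, and conversely for `w`: with the right sign,
  -- their difference increases along both
  let τ : ℝ × ℝ → ℝ := fun x => ε * (u x - w x)
  have hτC : ContDiff ℝ 1 τ := contDiff_const.mul (hX.contDiff.sub hY.contDiff)
  have hτd : ∀ x ξ, fderiv ℝ τ x ξ = ε * (fderiv ℝ u x ξ - fderiv ℝ w x ξ) := by
    intro x ξ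
    have e : HasFDerivAt τ _ x := ((hX.hasFDerivAt x).sub (hY.hasFDerivAt x)).const_mul ε
    rw [e.fderiv]; rfl
  have hτX : ∀ x, 0 < fderiv ℝ τ x (X x) := by
    intro x
    obtain ⟨κ, -, e⟩ := hX.fderiv_eq x
    obtain ⟨κ', hκ', e'⟩ := hY.fderiv_eq x
    rw [hτd, e, e', cross_self, cross_comm (Y x)]
    have := mul_pos hκ' (hε x)
    linarith
  have hτY : ∀ x, 0 < fderiv ℝ τ x (Y x) := by
    intro x
    obtain ⟨κ, hκ, e⟩ := hX.fderiv_eq x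
    obtain ⟨κ', -, e'⟩ := hY.fderiv_eq x
    rw [hτd, e, e', cross_self]
    have := mul_pos hκ (hε x)
    linarith
  have hτc : ∀ s, τ (c s) = 0 := fun s => by simp [τ, hX.apply_curve, hY.apply_curve]
  obtain ⟨m, hS⟩ := hX.exists_stripFunction hτC
    (fun x => by simp only [τ, hX.add_latt, hY.add_latt]; ring) hτc hτX
  obtain ⟨t, htC, htv, htD, ht0, htZ⟩ := hS.exists_height
  have htX := htZ X hX.field_period hτX
  have htY := htZ Y hY.field_period hτY
  have htc : ∀ s, t (c s) = 0 := fun s => ht0 _ (hτc s)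
  have hcoord := hX.existsUnique_of_height htC htD htc htX
  let Θ : ℝ × ℝ → ℝ × ℝ := fun x => (angle D u t x, t x)
  have haC : ContDiff ℝ 1 (angle D u t) := angle_contDiff hX.contDiff htC
  have hΘC : ContDiff ℝ 1 Θ := haC.prodMk htC
  have hΘd : ∀ x ξ, fderiv ℝ Θ x ξ = (fderiv ℝ (angle D u t) x ξ, fderiv ℝ t x ξ) := by
    intro x ξ
    rw [((haC.differentiable (by norm_num) x).hasFDerivAt.prodMk
      (htC.differentiable (by norm_num) x).hasFDerivAt).fderiv]
    rfl
  -- on the level `T` of the height, `angle` is a bijective function of the leaf coordinate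
  have hbij : ∀ y, ∃! x, Θ x = y := by
    rintro ⟨A, T⟩
    obtain ⟨g, hg, hgx⟩ := hX.exists_angle_eq t T
    obtain ⟨s, rfl⟩ := hg.surjective A
    obtain ⟨x, ⟨hx1, hx2⟩, hx3⟩ := hcoord s T
    refine ⟨x, by simp only [Θ, hgx x hx2, hx1, hx2], fun y hy => ?_⟩
    have hy2 : t y = T := congrArg Prod.snd hy
    have hy1 : angle D u t y = g s := congrArg Prod.fst hy
    rw [hgx y hy2] at hy1
    exact hx3 y ⟨hg.injective hy1, hy2⟩
  choose Λ hΛ hΛu using hbij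
  have hΛΘ : ∀ x, Λ (Θ x) = x := fun x => (hΛu _ x rfl).symm
  refine ⟨Θ, Λ, hΘC, contDiff_of_inverse hΘC hΛΘ hΛ fun x ξ hξ => ?_, hΛΘ, hΛ,
    fun x => ?_, fun x => ?_, fun x => ⟨fun hx => ?_, ?_⟩, fun x => ?_, fun x => ?_⟩
  · rw [hΘd] at hξ
    have h2 : fderiv ℝ t x ξ = 0 := congrArg Prod.snd hξ
    have h1 : fderiv ℝ (angle D u t) x ξ = 0 := congrArg Prod.fst hξ
    have key : ∀ k, ∃ κ > 0, fderiv ℝ (translate D u k) x ξ = κ * cross (X x) ξ := by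
      intro k
      obtain ⟨κ, hκ, e⟩ := hX.fderiv_eq (x - latt (k • D))
      have e2 := hX.field_period (k • D) (x - latt (k • D))
      rw [sub_add_cancel] at e2
      exact ⟨κ, hκ, by rw [fderiv_translate hX.contDiff, e, e2]⟩
    obtain ⟨κ, hκ, e⟩ := key ⌊t x⌋
    obtain ⟨κ', hκ', e'⟩ := key (⌊t x⌋ + 1)
    rw [fderiv_angle hX.contDiff htC h2, e, e'] at h1
    have hb0 : 0 ≤ weight t ⌊t x⌋ x := ramp_nonneg _ _
    have hb1 : weight t ⌊t x⌋ x ≤ 1 := ramp_le_one _ _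
    have hcoef : 0 < (1 - weight t ⌊t x⌋ x) * κ + weight t ⌊t x⌋ x * κ' := by
      rcases hb0.eq_or_lt with h | h
      · rw [← h]; simpa using hκ
      · have := mul_pos h hκ'
        have := mul_nonneg (sub_nonneg.2 hb1) hκ.le
        linarith
    have hcr : cross (X x) ξ = 0 := by
      have : ((1 - weight t ⌊t x⌋ x) * κ + weight t ⌊t x⌋ x * κ') * cross (X x) ξ = 0 := by
        linarith
      exact (mul_eq_zero.1 this).resolve_left hcoef.ne'
    obtain ⟨k, rfl⟩ := exists_smul_of_cross_eq_zero (hX.globalSection.lineField.unit x) hcr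
    rw [map_smul, smul_eq_mul] at h2
    rw [(mul_eq_zero.1 h2).resolve_right (htX x).ne', zero_smul]
  · simp only [Θ, angle_add_latt_of_period hX.add_latt htv, htv, Prod.mk_add_mk, add_zero]
  · simp only [Θ, angle_add_latt htD, htD, Prod.mk_add_mk, add_zero]
  · refine ⟨u x, (hcoord (u x) 0).unique ⟨hX.apply_curve _, htc _⟩ ⟨rfl, hx⟩⟩
  · rintro ⟨s, rfl⟩; exact htc s
  · rw [hΘd]; exact htX x
  · rw [hΘd]; exact htY x

/-! ### From foliations of the torus to flows on the plane, and back -/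

/-- A continuous curve in the lattice is constant. -/
lemma exists_latt_of_continuous {f : ℝ → ℝ × ℝ} (hf : Continuous f) (hl : ∀ s, ∃ n, f s = latt n) :
    ∃ n, ∀ s, f s = latt n := by
  have hloc : IsLocallyConstant f := (IsLocallyConstant.iff_eventually_eq f).2 fun s =>
    eventually_eq_of_latt hf.continuousAt (Filter.Eventually.of_forall hl)
  obtain ⟨n, hn⟩ := hl 0
  exact ⟨n, fun s => by rw [← hn]; exact hloc.apply_eq_of_preconnectedSpace s 0⟩

/-- A continuous map of the plane that respects the fibres of `proj` descends to the torus. -/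
lemma exists_torusMap {Θ : ℝ × ℝ → ℝ × ℝ} (hΘ : Continuous Θ)
    (h : ∀ n x, proj (Θ (x + latt n)) = proj (Θ x)) :
    ∃ f : Torus → Torus, Continuous f ∧ ∀ x, f (proj x) = proj (Θ x) := by
  have hs := Function.surjInv_eq proj_surjective
  let f : Torus → Torus := fun p => proj (Θ (Function.surjInv proj_surjective p))
  have hf : ∀ x, f (proj x) = proj (Θ x) := by
    intro x
    obtain ⟨n, hn⟩ := proj_eq_proj_iff.1 (hs (proj x))
    simp only [f, hn, h]
  refine ⟨f, ?_, hf⟩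
  rw [isOpenQuotientMap_proj.isQuotientMap.continuous_iff]
  exact (continuous_proj.comp hΘ).congr fun x => (hf x).symm

/-- A `C¹` diffeomorphism of the plane that conjugates the translations by a basis of the lattice
to the translations by the standard basis passes to the torus. -/
lemma exists_diff1 {Θ Λ : ℝ × ℝ → ℝ × ℝ} (hΘ : ContDiff ℝ 1 Θ) (hΛ : ContDiff ℝ 1 Λ)
    (hl : ∀ x, Λ (Θ x) = x) (hr : ∀ y, Θ (Λ y) = y) {v D : ℤ × ℤ} (hgen : Generates D v)
    (hv : ∀ x, Θ (x + latt v) = Θ x + (1, 0)) (hD : ∀ x, Θ (x + latt D) = Θ x + (0, 1)) :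
    ∃ θ : Diff1, (∀ x, θ.toHomeomorph (proj x) = proj (Θ x)) ∧
      ∀ y, θ.toHomeomorph.symm (proj y) = proj (Λ y) := by
  have e10 : ((1, 0) : ℝ × ℝ) = latt (1, 0) := by ext <;> simp
  have e01 : ((0, 1) : ℝ × ℝ) = latt (0, 1) := by ext <;> simp
  have hΘn : ∀ n x, proj (Θ (x + latt n)) = proj (Θ x) := fun n x =>
    hgen.period (f := fun x => proj (Θ x)) (fun x => by simp only [hD, e01, proj_add_latt])
      (fun x => by simp only [hv, e10, proj_add_latt]) n x
  have hstd : Generates (0, 1) (1, 0) := fun n => ⟨n.2, n.1, by ext <;> simp⟩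
  have hΛn : ∀ n y, proj (Λ (y + latt n)) = proj (Λ y) := fun n y =>
    hstd.period (f := fun y => proj (Λ y))
      (fun y => by
        have := hl (Λ y + latt D)
        rw [hD, hr, e01] at this
        simp only [this, proj_add_latt])
      (fun y => by
        have := hl (Λ y + latt v)
        rw [hv, hr, e10] at this
        simp only [this, proj_add_latt]) n y
  obtain ⟨f, hfc, hf⟩ := exists_torusMap hΘ.continuous hΘn
  obtain ⟨g, hgc, hg⟩ := exists_torusMap hΛ.continuous hΛn
  refine ⟨⟨⟨⟨f, g, fun p => ?_, fun p => ?_⟩, hfc, hgc⟩, ⟨Θ, hΘ, fun x => (hf x).symm⟩,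
    ⟨Λ, hΛ, fun x => (hg x).symm⟩⟩, hf, hg⟩
  · obtain ⟨x, rfl⟩ := proj_surjective p
    rw [hf, hg, hl]
  · obtain ⟨x, rfl⟩ := proj_surjective p
    rw [hg, hf, hr]

namespace Foliation

namespace TangentField
variable {F : Foliation} {X : ℝ × ℝ → ℝ × ℝ} {Φ : ℝ → ℝ × ℝ → ℝ × ℝ}

lemma smul (h : F.TangentField X) {σ : ℝ} (hσ : σ = 1 ∨ σ = -1) :
    F.TangentField fun x => σ • X x := by
  refine ⟨h.continuous.const_smul σ, fun x => ?_, fun φ hφ x hx => ?_⟩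
  · have := h.unit x
    rcases hσ with rfl | rfl <;> simpa
  · obtain ⟨k, hk, e⟩ := h.conormal φ hφ x hx
    refine ⟨k * σ, mul_ne_zero hk (by rcases hσ with rfl | rfl <;> norm_num), fun w => ?_⟩
    rw [e, cross_smul_left]
    rcases hσ with rfl | rfl <;> ring

/-- The tangent line is spanned by `X`. -/
lemma mem_tangentLine_iff (h : F.TangentField X) {x w : ℝ × ℝ} :
    w ∈ F.tangentLine x ↔ cross (X x) w = 0 := by
  simp only [tangentLine, Submodule.mem_iInf, LinearMap.mem_ker]
  constructor
  · intro hw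
    obtain ⟨φ, hφ, hx⟩ := F.cover (proj x)
    obtain ⟨k, hk, e⟩ := h.conormal φ hφ x hx
    have h0 : fderiv ℝ (fun z => (φ (proj z)).2) x w = 0 := hw φ hφ hx
    rw [e] at h0
    exact (mul_eq_zero.1 h0).resolve_left hk
  · intro hw φ hφ hx
    obtain ⟨k, -, e⟩ := h.conormal φ hφ x hx
    have h0 : fderiv ℝ (fun z => (φ (proj z)).2) x w = 0 := by rw [e, hw, mul_zero]
    exact h0

/-- Every foliated chart lifts to a flow chart, after reversing the plaques if necessary. -/
lemma exists_flowChart (h : F.TangentField X) {φ : OpenPartialHomeomorph Torus (ℝ × ℝ)}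
    (hφ : φ ∈ F.atlas) {x₀ : ℝ × ℝ} (hx₀ : proj x₀ ∈ φ.source) :
    ∃ (ε : ℝ) (V : Set (ℝ × ℝ)) (L : ℝ × ℝ → ℝ × ℝ) (lam : ℝ × ℝ → ℝ), ε * ε = 1 ∧ x₀ ∈ V ∧
      FlowChart X V (fun x => (ε * (φ (proj x)).1, (φ (proj x)).2)) L lam ∧
      ∀ y, proj (L y) = φ.symm (ε * y.1, y.2) := by
  obtain ⟨V, L, hxV, hVs, hch, hL⟩ := (F.isC1Chart φ hφ).exists_planeChart hx₀
  have hLd : ∀ y, HasFDerivAt L (fderiv ℝ L y) y := fun y =>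
    (hch.contDiff.differentiable (by norm_num) y).hasFDerivAt
  -- the velocity of the horizontal lines of the chart is `m` times the unit field `X`
  let m : ℝ × ℝ → ℝ := fun y => (X (L y)).1 * (fderiv ℝ L y (1, 0)).1
    + (X (L y)).2 * (fderiv ℝ L y (1, 0)).2
  have hm : ∀ y, fderiv ℝ L y (1, 0) = m y • X (L y) := by
    intro y
    have hy : proj (L y) ∈ φ.source := hVs (hch.mapsTo y)
    obtain ⟨k, hk, e⟩ := h.conormal φ hφ (L y) hy
    have h1 := hch.fderiv_snd_apply (hch.mapsTo y) (fderiv ℝ L y (1, 0))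
    rw [hch.fderiv_symm_apply, e] at h1
    obtain ⟨κ, hκ⟩ := exists_smul_of_cross_eq_zero (h.unit (L y))
      ((mul_eq_zero.1 h1).resolve_left hk)
    have : m y = κ := by
      simp only [m, hκ, Prod.smul_fst, Prod.smul_snd, smul_eq_mul]
      linear_combination κ * h.unit (L y)
    rw [this, hκ]
  have hmc : Continuous m := by
    have h1 := h.continuous.comp hch.contDiff.continuous
    have h2 : Continuous fun y => fderiv ℝ L y (1, 0) :=
      (hch.contDiff.continuous_fderiv (by norm_num)).clm_apply continuous_const
    exact (h1.fst.mul h2.fst).add (h1.snd.mul h2.snd)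
  obtain ⟨ε, hε, hεm⟩ := exists_sign_of_ne_zero hmc fun y h0 => by
    have h1 := hch.fderiv_symm_apply y (1, 0)
    rw [hm, h0, zero_smul, map_zero] at h1
    simpa using congrArg Prod.fst h1
  have hεε : ε * ε = 1 := by rcases hε with rfl | rfl <;> norm_num
  -- reversing the horizontal lines makes the speed positive
  let ρ : ℝ × ℝ →L[ℝ] ℝ × ℝ :=
    (ε • ContinuousLinearMap.fst ℝ ℝ ℝ).prod (ContinuousLinearMap.snd ℝ ℝ ℝ)
  have hρ : ∀ y, ρ y = (ε * y.1, y.2) := fun y => rfl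
  have hρρ : ∀ y, ρ (ρ y) = y := fun y => by
    ext
    · simp only [hρ]; rw [← mul_assoc, hεε, one_mul]
    · rfl
  refine ⟨ε, V, fun y => L (ρ y), fun y => ε * m (ρ y), hεε, hxV,
    ⟨⟨hch.isOpen, ρ.contDiff.comp_contDiffOn hch.contDiffOn, hch.contDiff.comp ρ.contDiff,
      fun y => hch.mapsTo _, fun y => ?_, fun x hx => ?_⟩,
      continuous_const.mul (hmc.comp ρ.continuous), fun y => hεm _, fun y => ?_⟩, fun y => hL _⟩
  · have e1 : φ (proj (L (ρ y))) = ρ y := hch.left (ρ y)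
    simp only [e1]
    exact hρρ y
  · have : L (ρ (ρ (φ (proj x)))) = x := by rw [hρρ]; exact hch.right x hx
    exact this
  · have h1 := (hLd (ρ y)).comp y ρ.hasFDerivAt
    have h2 : fderiv ℝ (fun y => L (ρ y)) y = (fderiv ℝ L (ρ y)).comp ρ := h1.fderiv
    have h3 : ρ (1, 0) = ε • ((1, 0) : ℝ × ℝ) := by simp [hρ]
    rw [h2, ContinuousLinearMap.comp_apply, h3, map_smul, hm, smul_smul]

/-- The deck transformations preserve the tangent line field, hence preserve `X` up to a sign,
which is constant since the plane is connected. -/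
lemma exists_sign (h : F.TangentField X) (n : ℤ × ℤ) :
    ∃ σ : ℝ, (σ = 1 ∨ σ = -1) ∧ ∀ x, X (x + latt n) = σ • X x := by
  let κ : ℝ × ℝ → ℝ := fun x =>
    (X x).1 * (X (x + latt n)).1 + (X x).2 * (X (x + latt n)).2
  have hκ : ∀ x, X (x + latt n) = κ x • X x := by
    intro x
    obtain ⟨φ, hφ, hx⟩ := F.cover (proj x)
    obtain ⟨k, hk, e⟩ := h.conormal φ hφ x hx
    obtain ⟨k', hk', e'⟩ := h.conormal φ hφ (x + latt n) (by rwa [proj_add_latt])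
    have hd : fderiv ℝ (fun z => (φ (proj z)).2) (x + latt n)
        = fderiv ℝ (fun z => (φ (proj z)).2) x := by
      rw [← fderiv_comp_add_right]
      simp only [proj_add_latt]
    have h1 := e (X (x + latt n))
    rw [← hd, e', cross_self, mul_zero] at h1
    obtain ⟨μ, hμ⟩ := exists_smul_of_cross_eq_zero (h.unit x)
      ((mul_eq_zero.1 h1.symm).resolve_left hk)
    have : κ x = μ := by
      simp only [κ, hμ, Prod.smul_fst, Prod.smul_snd, smul_eq_mul]
      linear_combination μ * h.unit x
    rw [this, hμ]
  have hκ2 : ∀ x, κ x * κ x = 1 := by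
    intro x
    have h1 := h.unit (x + latt n)
    rw [hκ] at h1
    simp only [Prod.smul_fst, Prod.smul_snd, smul_eq_mul] at h1
    linear_combination h1 - κ x * κ x * h.unit x
  have hκc : Continuous κ := by
    have h1 := h.continuous
    have h2 : Continuous fun x => X (x + latt n) := h1.comp (continuous_id.add continuous_const)
    exact (h1.fst.mul h2.fst).add (h1.snd.mul h2.snd)
  obtain ⟨σ, hσ, hσκ⟩ := exists_sign_of_ne_zero hκc fun x h0 => by
    have := hκ2 x
    rw [h0] at this; norm_num at this
  refine ⟨σ, hσ, fun x => ?_⟩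
  have h1 := hσκ x
  have : κ x = σ := by
    rcases mul_self_eq_one_iff.1 (hκ2 x) with h2 | h2 <;> rcases hσ with rfl | rfl <;>
      rw [h2] at h1 ⊢ <;> norm_num at h1
  rw [hκ, this]

lemma lineField (h : F.TangentField X) : LineField X := by
  refine ⟨h.continuous, h.unit, fun x => ?_, h.exists_sign⟩
  obtain ⟨φ, hφ, hx⟩ := F.cover (proj x)
  obtain ⟨ε, V, L, lam, -, hV, hch, -⟩ := h.exists_flowChart hφ hx
  exact ⟨V, _, L, lam, hV, hch⟩

lemma exists_flow_of_samePlaque (h : F.TangentField X) (hΦ : IsFlowOf X Φ) {p q : Torus}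
    (hpq : F.SamePlaque p q) {x : ℝ × ℝ} (hx : proj x = p) : ∃ t, proj (Φ t x) = q := by
  obtain ⟨φ, hφ, hp, hq, he⟩ := hpq
  subst hx
  obtain ⟨ε, V, L, lam, hε, hV, hch, hL⟩ := h.exists_flowChart hφ hp
  obtain ⟨t, ht⟩ := hch.exists_flow_eq_of_snd_eq hΦ
    (y := (ε * (φ (proj x)).1, (φ (proj x)).2)) (z := (ε * (φ q).1, (φ q).2)) he
  refine ⟨t, ?_⟩
  have := hch.right x hV
  rw [this] at ht
  rw [ht, hL]
  simp only
  rw [← mul_assoc, hε, one_mul]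
  exact φ.left_inv hq

/-- The leaves are the projections of the orbits. -/
lemma exists_flow_of_mem_leaf (h : F.TangentField X) (hΦ : IsFlowOf X Φ) {x : ℝ × ℝ} {q : Torus}
    (hq : q ∈ F.leaf (proj x)) : ∃ t, proj (Φ t x) = q := by
  have hsymm : ∀ {p q}, F.SamePlaque p q → F.SamePlaque q p := by
    rintro p q ⟨φ, hφ, hp, hq, he⟩
    exact ⟨φ, hφ, hq, hp, he.symm⟩
  have key : ∀ {p q}, Relation.EqvGen F.SamePlaque p q →
      (∀ x, proj x = p → ∃ t, proj (Φ t x) = q) ∧ ∀ x, proj x = q → ∃ t, proj (Φ t x) = p := by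
    intro p q hpq
    induction hpq with
    | rel p q hpq =>
      exact ⟨fun x hx => h.exists_flow_of_samePlaque hΦ hpq hx,
        fun x hx => h.exists_flow_of_samePlaque hΦ (hsymm hpq) hx⟩
    | refl p => exact ⟨fun x hx => ⟨0, by rw [hΦ.zero, hx]⟩, fun x hx => ⟨0, by rw [hΦ.zero, hx]⟩⟩
    | symm p q _ ih => exact ih.symm
    | trans p q r _ _ ih₁ ih₂ =>
      refine ⟨fun x hx => ?_, fun x hx => ?_⟩
      · obtain ⟨t, ht⟩ := ih₁.1 x hx
        obtain ⟨t', ht'⟩ := ih₂.1 _ ht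
        exact ⟨t' + t, by rw [hΦ.add, ht']⟩
      · obtain ⟨t, ht⟩ := ih₂.2 x hx
        obtain ⟨t', ht'⟩ := ih₁.2 _ ht
        exact ⟨t' + t, by rw [hΦ.add, ht']⟩
  exact (key hq).1 x rfl

/-- A curve transverse to a foliation is transverse to it along each of its lifts. -/
lemma cross_deriv_ne_zero (h : F.TangentField X) {γ : UnitAddCircle → Torus}
    (hγ : F.TransverseToCurve γ) {c : ℝ → ℝ × ℝ} (hc : Continuous c)
    (hcγ : ∀ s : ℝ, proj (c s) = γ s) (s : ℝ) : cross (X (c s)) (deriv c s) ≠ 0 := by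
  obtain ⟨b, hb, hbγ, hbt⟩ := hγ
  obtain ⟨n, hn⟩ := exists_latt_of_continuous (hb.continuous.sub hc) fun s => by
    obtain ⟨n, hn⟩ := proj_eq_proj_iff.1 ((hbγ s).trans (hcγ s).symm)
    exact ⟨n, by rw [Pi.sub_apply, hn, add_sub_cancel_left]⟩
  have hbc : b = fun s => c s + latt n := funext fun s => by
    rw [← hn s, Pi.sub_apply, add_sub_cancel]
  have h1 := hbt s
  rw [h.mem_tangentLine_iff, hbc] at h1
  simp only [deriv_add_const] at h1
  obtain ⟨σ, -, hσ⟩ := h.exists_sign n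
  rw [hσ, cross_smul_left] at h1
  exact right_ne_zero_of_mul h1

/-- The common period and the lift of the curve being given, the tangent field can be oriented so
that the curve crosses it positively; completeness says that every orbit meets a translate. -/
lemma exists_globalSection {γ : UnitAddCircle → Torus} (hγ : F.IsCompleteTransversal γ)
    {c : ℝ → ℝ × ℝ} {v : ℤ × ℤ} (hc : ContDiff ℝ 1 c) (hcγ : ∀ s : ℝ, proj (c s) = γ s)
    (hv : ∀ s, c (s + 1) = c s + latt v) :
    ∃ X Φ, F.TangentField X ∧ GlobalSection X Φ c v := by
  obtain ⟨X₀, hX₀⟩ := F.exists_tangentField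
  obtain ⟨σ, hσ, hσc⟩ := exists_sign_of_ne_zero
    (continuous_cross (hX₀.continuous.comp hc.continuous) (hc.continuous_deriv (by norm_num)))
    (hX₀.cross_deriv_ne_zero hγ.transverse hc.continuous hcγ)
  have hX := hX₀.smul hσ
  obtain ⟨Φ, hΦ⟩ := hX.lineField.exists_flow
  refine ⟨_, Φ, hX, hX.lineField, hΦ, ⟨hc, fun s => by rw [cross_smul_left]; exact hσc s⟩, hv,
    fun s s' n hn => ?_, fun x => ?_⟩
  · have e : γ s = γ s' := by rw [← hcγ, ← hcγ, hn, proj_add_latt]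
    obtain ⟨j, rfl⟩ := coe_eq_coe_iff_exists_int.1 (hγ.simple e)
    refine ⟨j, rfl, ?_⟩
    rw [curve_add_intCast hv] at hn
    exact (latt_injective (add_left_cancel hn)).symm
  · obtain ⟨q, hq, ⟨s, rfl⟩⟩ := hγ.meets_leaf (proj x)
    obtain ⟨t, ht⟩ := hX.exists_flow_of_mem_leaf hΦ hq
    obtain ⟨s, rfl⟩ := QuotientAddGroup.mk_surjective s
    obtain ⟨n, hn⟩ := proj_eq_proj_iff.1 (ht.trans (hcγ s).symm)
    exact ⟨t, s, n, hn⟩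

/-- A foliation whose leaves are nowhere horizontal after straightening is mapped to a foliation
transverse to the horizontal circles. -/
lemma transverseToCurve_map (h : F.TangentField X) {θ : Diff1} {Θ Λ : ℝ × ℝ → ℝ × ℝ}
    (hΘ : ContDiff ℝ 1 Θ) (hΛ : ContDiff ℝ 1 Λ) (hr : ∀ y, Θ (Λ y) = y)
    (hθ : ∀ y, θ.toHomeomorph.symm (proj y) = proj (Λ y))
    (hpos : ∀ x, (fderiv ℝ Θ x (X x)).2 ≠ 0) (t : UnitAddCircle) :
    (F.map θ).TransverseToCurve fun s => (s, t) := by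
  obtain ⟨T, rfl⟩ := QuotientAddGroup.mk_surjective t
  have hd : ∀ s, HasDerivAt (fun s : ℝ => (s, T)) ((1, 0) : ℝ × ℝ) s := fun s =>
    (hasDerivAt_id s).prodMk (hasDerivAt_const s T)
  refine ⟨fun s => (s, T), contDiff_id.prodMk contDiff_const, fun s => rfl, fun s hmem => ?_⟩
  rw [(hd s).deriv] at hmem
  set y : ℝ × ℝ := (s, T)
  obtain ⟨φ, hφ, hx⟩ := F.cover (proj (Λ y))
  obtain ⟨k, hk, e⟩ := h.conormal φ hφ (Λ y) hx
  have hdΛ := (hΛ.differentiable (by norm_num) y).hasFDerivAt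
  have hdφ : HasFDerivAt (fun z => (φ (proj z)).2) (fderiv ℝ (fun z => (φ (proj z)).2) (Λ y))
      (Λ y) :=
    (((F.contDiffOn_snd hφ).contDiffAt ((φ.open_source.preimage continuous_proj).mem_nhds hx)
      ).differentiableAt (by norm_num)).hasFDerivAt
  have h0 : fderiv ℝ (fun z => (φ (proj (Λ z))).2) y (1, 0) = 0 := by
    simp only [tangentLine, Submodule.mem_iInf, LinearMap.mem_ker] at hmem
    have := hmem (θ.toHomeomorph.symm.transOpenPartialHomeomorph φ) ⟨φ, hφ, rfl⟩ (by
      simpa [hθ] using hx)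
    simpa [hθ] using this
  have h1 : fderiv ℝ (fun z => (φ (proj (Λ z))).2) y
      = (fderiv ℝ (fun z => (φ (proj z)).2) (Λ y)).comp (fderiv ℝ Λ y) := (hdφ.comp y hdΛ).fderiv
  rw [h1, ContinuousLinearMap.comp_apply, e] at h0
  obtain ⟨μ, hμ⟩ := exists_smul_of_cross_eq_zero (h.unit _) ((mul_eq_zero.1 h0).resolve_left hk)
  -- a horizontal vector tangent to the image foliation would be the image of a multiple of `X`,
  -- along which the second coordinate of `Θ` has nonzero derivative
  have h2 : fderiv ℝ Θ (Λ y) (fderiv ℝ Λ y (1, 0)) = (1, 0) := by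
    have := ((hΘ.differentiable (by norm_num) (Λ y)).hasFDerivAt.comp y hdΛ)
    rw [show Θ ∘ Λ = id from funext hr] at this
    have := this.unique (hasFDerivAt_id y)
    rw [← ContinuousLinearMap.comp_apply, this]; rfl
  rw [hμ, map_smul] at h2
  have h3 : μ * (fderiv ℝ Θ (Λ y) (X (Λ y))).2 = 0 := congrArg Prod.snd h2
  rw [(mul_eq_zero.1 h3).resolve_right (hpos _), zero_smul] at h2
  exact zero_ne_one (congrArg Prod.fst h2)

end TangentField

lemma Transverse.cross_ne_zero {F G : Foliation} (h : F.Transverse G) {X Y : ℝ × ℝ → ℝ × ℝ}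
    (hX : F.TangentField X) (hY : G.TangentField Y) (x : ℝ × ℝ) : cross (X x) (Y x) ≠ 0 := by
  intro h0
  have h1 : Y x ∈ F.tangentLine x := hX.mem_tangentLine_iff.2 h0
  have h2 : Y x ∈ G.tangentLine x := hY.mem_tangentLine_iff.2 (cross_self _)
  have h3 := Submodule.disjoint_def.1 (h x).disjoint _ h1 h2
  have := hY.unit x
  rw [h3] at this
  norm_num at this

end Foliation
end TorusFoliation

open TorusFoliation

theorem mainTheorem9 (F G : TorusFoliation.Foliation) (hFG : F.Transverse G)
    (γ : UnitAddCircle → TorusFoliation.Torus)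
    (hF : F.IsCompleteTransversal γ) (hG : G.IsCompleteTransversal γ) :
    ∃ θ : TorusFoliation.Diff1,
      θ.toHomeomorph '' Set.range γ = (Set.univ : Set UnitAddCircle) ×ˢ {(0 : UnitAddCircle)} ∧
      ∀ t : UnitAddCircle,
        (F.map θ).TransverseToCurve (fun s => (s, t)) ∧
        (G.map θ).TransverseToCurve (fun s => (s, t)) := by
  obtain ⟨c, hc, hcγ, -⟩ := hF.transverse
  obtain ⟨v, hv⟩ : ∃ v, ∀ s, c (s + 1) - c s = latt v :=
    exists_latt_of_continuous (by fun_prop) fun s => by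
      obtain ⟨n, hn⟩ := proj_eq_proj_iff.1 (show proj (c (s + 1)) = proj (c s) by
        rw [hcγ, hcγ]; simp)
      exact ⟨n, by rw [hn, add_sub_cancel_left]⟩
  have hv' : ∀ s, c (s + 1) = c s + latt v := fun s => by rw [← hv s, add_sub_cancel]
  -- one lift `c` serves for both foliations, so that the two leaf coordinates agree on it
  obtain ⟨X, Φ, hX, hXΦ⟩ := Foliation.TangentField.exists_globalSection hF hc hcγ hv'
  obtain ⟨Y, Ψ, hY, hYΨ⟩ := Foliation.TangentField.exists_globalSection hG hc hcγ hv'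
  obtain ⟨D, u, hu⟩ := hXΦ.exists_leafCoordinate
  obtain ⟨D', w, hw⟩ := hYΨ.exists_leafCoordinate
  obtain ⟨Θ, Λ, hΘ, hΛ, hl, hr, hΘv, hΘD, hΘ0, hΘX, hΘY⟩ :=
    hu.exists_straightening hw (hFG.cross_ne_zero hX hY)
  obtain ⟨θ, hθ, hθs⟩ := exists_diff1 hΘ hΛ hl hr hu.generates hΘv hΘD
  refine ⟨θ, ?_, fun t => ⟨hX.transverseToCurve_map hΘ hΛ hr hθs (fun x => (hΘX x).ne') t,
    hY.transverseToCurve_map hΘ hΛ hr hθs (fun x => (hΘY x).ne') t⟩⟩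
  ext p
  simp only [Set.mem_image, Set.mem_range, Set.mem_prod, Set.mem_univ, true_and,
    Set.mem_singleton_iff]
  constructor
  · rintro ⟨_, ⟨s, rfl⟩, rfl⟩
    obtain ⟨s, rfl⟩ := QuotientAddGroup.mk_surjective s
    have e : γ ((s : ℝ) : UnitAddCircle) = proj (c s) := (hcγ s).symm
    have e2 : θ.toHomeomorph (γ (s : UnitAddCircle)) = proj (Θ (c s)) := by rw [e, hθ]
    refine (congrArg Prod.snd e2).trans ?_
    simp [proj, (hΘ0 (c s)).2 ⟨s, rfl⟩]
  · intro hp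
    obtain ⟨a, ha⟩ := QuotientAddGroup.mk_surjective p.1
    obtain ⟨s, hs⟩ := (hΘ0 (Λ (a, 0))).1 (by rw [hr])
    refine ⟨γ s, ⟨s, rfl⟩, ?_⟩
    rw [← hcγ, hθ, hs, hr]
    exact Prod.ext ha (by simp [proj, hp])
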